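/- **Definitions.** For a probability measure $\nu$ on $\mathbb R$, let $\mathrm{Med}(\nu)$ be the midpoint of its interval of medians, and for $Y\sim\nu$ let $\mathrm{MAD}(\nu)$ be the median of $|Y-\mathrm{Med}(\nu)|$. For a distribution $F$ on $\mathbb R^d$ ($d\ge 1$) let $F_u$ be the law of $u'X$, $X\sim F$, and put $$O(x,F)=\sup_{\|u\|=1}\frac{u'x-\mathrm{Med}(F_u)}{\mathrm{MAD}(F_u)},\qquad PD(x,F)=\frac1{1+O(x,F)} .$$ For weight functions $w_1,w_2$ on $[0,1]$ let $$L(F)=\frac{\int x\,w_1(PD(x,F))\,dF(x)}{\int w_1(PD(x,F))\,dF(x)},\qquad PWS(F)=\frac{\int (x-L(F))(x-L(F))'\,w_2(PD(x,F))\,dF(x)}{\int w_2(PD(x,F))\,dF(x)} .$$ The influence function of a functional $T$ at $x$ and $F$ is $IF(x;T,F)=\lim_{\varepsilon\to0^+}\big(T((1-\varepsilon)F+\varepsilon\delta_x)-T(F)\big)/\varepsilon$. **Assumptions.** $X\sim F=F_{\theta,\Sigma}$ is elliptically symmetric: $\Sigma$ is positive definite and there is a real random variable $Y\stackrel d=-Y$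 with $u'(X-\theta)\stackrel d=\sqrt{u'\Sigma u}\,Y$ for every unit vector $u$. $Y$ has a continuous density $p$, $\mathrm{MAD}(Y)=m_0$ and $p(0)p(m_0)>0$. The $w_i$ are differentiable on $[0,1]$, $w_1'$ is continuous and $w_2'$ is Lipschitz on $[0,1]$, $w_i'(r)=O(r^i)$ for small $r\ge0$, $\int w_i(PD(x,F))\,dF(x)>0$, and $\int\|x\|^i\,|w_i(PD(x,F))|\,dF(x)<\infty$, $i=1,2$ (the last condition is automatic if $w_i(0)=0$). **Constants.** Let $F_{0,I_d}$ be the law of $Z=\Sigma^{-1/2}(X-\theta)$, let $U=Z/\|Z\|$ with first coordinate $U_1$, and $$s_0(x)=\frac1{1+x/m_0},\qquad s_i(x)=E\big(U_1^{2(i-1)}\,\mathrm{sign}(|U_1|x-m_0)\big)\ (i=1,2),$$ $$c_0=E\,w_2(s_0(\|Z\|)),\qquad c_1=\frac{E(\|Z\|^2w_2(s_0(\|Z\|)))}{d\,c_0},\qquad c_j=\frac{E\big(\|Z\|^{2j-3}s_0^2(\|Z\|)\,w_2'(s_0(\|Z\|))\big)}{4m_0^2\,p(m_0)}\ (j=2,3),$$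 $$t_1(x)=c_3\Big(s_2(x)-\frac{s_1(x)-s_2(x)}{d-1}\Big)+x^2w_2(s_0(x)),$$ $$t_2(x)=c_3\,\frac{s_1(x)-s_2(x)}{d-1}-c_1c_2\,s_1(x)-c_1\,w_2(s_0(x)),$$ where $(s_1(x)-s_2(x))/(d-1)$ is defined to be $0$ when $d=1$. **Corollary 3.2.** $PWS$ is well defined at $F_{\theta,\Sigma}$, at $F_{0,I_d}$ and, for every $x$ and all small $\varepsilon>0$ (depending on $x$), at their contaminations by $\varepsilon\delta_x$: the MADs of all projections are positive, the outlyingness is finite, $\int w_i(PD)$ is positive and $\int\|y\|^i w_i(PD)$ converges absolutely under the distribution in question. For every $x\in\mathbb R^d$, with $\|x\|\neq m_0$ if $d=1$, the influence function of $PWS$ exists at $F_{0,I_d}$ and $$IF(x;PWS,F_{0,I_d})=\frac1{c_0}\Big(t_1(\|x\|)\,\frac{xx'}{\|x\|^2}+t_2(\|x\|)\,I_d\Big),$$ where $xx'/\|x\|^2$ is read as $I_d/d$ at $x=0$. Moreover, for every $x\in\mathbb R^d$, $$IF(x;PWS,F_{\theta,\Sigma})=\Sigma^{1/2}\,\big(IF(\Sigma^{-1/2}(x-\theta);PWS,F_{0,I_d})\big)\,\Sigma^{1/2},$$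 either side existing if and only if the other does. -/

import Mathlib

open MeasureTheory Filter Topology Set
open scoped Matrix MatrixOrder

noncomputable section

namespace DepthScatter

/-- Euclidean space `ℝ^d`. -/
abbrev E (d : ℕ) : Type := EuclideanSpace ℝ (Fin d)

/-- The matrix `x x'`. -/
def outer {d : ℕ} (x : E d) : Matrix (Fin d) (Fin d) ℝ := Matrix.of fun i j => x i * x j

/-- The vector `A x`. -/
def act {d : ℕ} (A : Matrix (Fin d) (Fin d) ℝ) (x : E d) : E d :=
  WithLp.toLp 2 (A *ᵥ x.ofLp)

/-- The quadratic form `u' A u`. -/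
def quad {d : ℕ} (A : Matrix (Fin d) (Fin d) ℝ) (u : E d) : ℝ := u.ofLp ⬝ᵥ (A *ᵥ u.ofLp)

/-- The median of a probability measure on `ℝ`: the midpoint of the interval of all medians (the
affine equivariant version). -/
def median (ν : Measure ℝ) : ℝ :=
  (sInf {t : ℝ | 1 / 2 ≤ ν.real (Iic t)} + sSup {t : ℝ | 1 / 2 ≤ ν.real (Ici t)}) / 2

/-- The median absolute deviation from the median, `Med |Y - Med Y|`. -/
def mad (ν : Measure ℝ) : ℝ := median (ν.map fun y => |y - median ν|)

/-- `F_u`, the law of `u'X` when `X` has law `F`. -/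
def projLaw {d : ℕ} (F : Measure (E d)) (u : E d) : Measure ℝ :=
  F.map fun x => inner ℝ u x

/-- The ratio `(u'x - Med F_u) / MAD F_u`. -/
def projRatio {d : ℕ} (x : E d) (F : Measure (E d)) (u : E d) : ℝ :=
  (inner ℝ u x - median (projLaw F u)) / mad (projLaw F u)

/-- The outlyingness `O(x, F)`, a supremum over all unit vectors. -/
def outlyingness {d : ℕ} (x : E d) (F : Measure (E d)) : ℝ :=
  ⨆ u : Metric.sphere (0 : E d) 1, projRatio x F u

/-- The projection depth `PD(x, F) = 1 / (1 + O(x, F))` for `(Med, MAD)`. -/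
def PD {d : ℕ} (x : E d) (F : Measure (E d)) : ℝ := 1 / (1 + outlyingness x F)

/-- The depth weighted mean `L(F)` with weight function `w`, for a general depth `D`. -/
def depthMean {d : ℕ} (w : ℝ → ℝ) (D : E d → Measure (E d) → ℝ) (F : Measure (E d)) : E d :=
  (∫ x, w (D x F) ∂F)⁻¹ • ∫ x, w (D x F) • x ∂F

/-- The depth weighted scatter `S(F)`: location weights `w₁`, scatter weights `w₂`, depth `D`. The
matrix integral is taken entrywise. -/
def depthScatter {d : ℕ} (w₁ w₂ : ℝ → ℝ) (D : E d → Measure (E d) → ℝ) (F : Measure (E d)) :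
    Matrix (Fin d) (Fin d) ℝ :=
  Matrix.of fun i j =>
    (∫ x, outer (x - depthMean w₁ D F) i j * w₂ (D x F) ∂F) / ∫ x, w₂ (D x F) ∂F

/-- The projection depth weighted scatter functional. -/
def PWS {d : ℕ} (w₁ w₂ : ℝ → ℝ) (F : Measure (E d)) : Matrix (Fin d) (Fin d) ℝ :=
  depthScatter w₁ w₂ PD F

/-- The moment requirement on the `i`-th weight function:
`∫ w(PD(x, F)) dF > 0` and `∫ ‖x‖ ^ i w(PD(x, F)) dF` exists. -/
def WeightIntegrable {d : ℕ} (i : ℕ) (w : ℝ → ℝ) (F : Measure (E d)) : Prop :=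
  0 < ∫ x, w (PD x F) ∂F ∧ Integrable (fun x => ‖x‖ ^ i * w (PD x F)) F

/-- Everything entering `PWS(F)` is well defined: the scales `MAD F_u` are positive, the suprema
defining the outlyingness are finite, and the weighted integrals exist. -/
def PWSWellDefined {d : ℕ} (w₁ w₂ : ℝ → ℝ) (F : Measure (E d)) : Prop :=
  (∀ u : Metric.sphere (0 : E d) 1, 0 < mad (projLaw F u)) ∧
  (∀ x : E d, BddAbove (range fun u : Metric.sphere (0 : E d) 1 => projRatio x F u)) ∧
  WeightIntegrable 1 w₁ F ∧ WeightIntegrable 2 w₂ F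

/-- The derivative of a weight function on `[0, 1]`, one sided at the end points. -/
def wderiv (w : ℝ → ℝ) (r : ℝ) : ℝ := derivWithin w (Icc 0 1) r

/-- `w` is continuously differentiable on `[0, 1]` and `w' (r) = O(r ^ i)` for small `r ≥ 0`. -/
def IsSmoothWeight (i : ℕ) (w : ℝ → ℝ) : Prop :=
  DifferentiableOn ℝ w (Icc 0 1) ∧ ContinuousOn (wderiv w) (Icc 0 1) ∧
    wderiv w =O[𝓝[≥] 0] fun r => r ^ i

/-- The contaminated distribution `F(ε, δ_x) = (1 - ε) F + ε δ_x`. -/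
def contaminate {d : ℕ} (F : Measure (E d)) (ε : ℝ) (x : E d) : Measure (E d) :=
  ENNReal.ofReal (1 - ε) • F + ENNReal.ofReal ε • Measure.dirac x

/-- The influence function `IF(x; T, F)` exists and equals `M`. -/
def HasInfluenceFunction {d : ℕ} (T : Measure (E d) → Matrix (Fin d) (Fin d) ℝ)
    (F : Measure (E d)) (x : E d) (M : Matrix (Fin d) (Fin d) ℝ) : Prop :=
  Tendsto (fun ε : ℝ => ε⁻¹ • (T (contaminate F ε x) - T F)) (𝓝[>] 0) (𝓝 M)

/-- `F` is elliptically symmetric about `θ` with associated matrix `A`, where `ν` is the law of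
`Y`: for every unit vector `u`, `u'(X - θ)` and `√(u'Au) Y` have the same law, and `Y` and `-Y`
have the same law. -/
def IsElliptical {d : ℕ} (F : Measure (E d)) (θ : E d) (A : Matrix (Fin d) (Fin d) ℝ)
    (ν : Measure ℝ) : Prop :=
  A.PosDef ∧ ν.map (fun y => -y) = ν ∧
    ∀ u : E d, ‖u‖ = 1 →
      F.map (fun x => inner ℝ u (x - θ)) = ν.map fun y => √(quad A u) * y

/-- `A^{1/2}`, the positive semidefinite square root. -/
def rootMat {d : ℕ} (A : Matrix (Fin d) (Fin d) ℝ) : Matrix (Fin d) (Fin d) ℝ := CFC.sqrt A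

/-- The standardization `A^{-1/2} (x - θ)`. -/
def standardize {d : ℕ} (θ : E d) (A : Matrix (Fin d) (Fin d) ℝ) (x : E d) : E d :=
  act (rootMat A)⁻¹ (x - θ)

section Constants

/- `F₀` is the law of `Z`, `w₂` the scatter weight function, `m₀` the MAD of `Y` and `pm₀` the
value at `m₀` of the density of `Y`. -/

def s₀ (m₀ x : ℝ) : ℝ := 1 / (1 + x / m₀)

/-- `s_i(x) = E (U₁^{2(i-1)} sign(|U₁| x - m₀))`, `U = Z / ‖Z‖`. -/
def s {d : ℕ} [NeZero d] (F₀ : Measure (E d)) (m₀ : ℝ) (i : ℕ) (x : ℝ) : ℝ :=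
  ∫ z, (z 0 / ‖z‖) ^ (2 * (i - 1)) * Real.sign (|z 0 / ‖z‖| * x - m₀) ∂F₀

def c₀ {d : ℕ} (w₂ : ℝ → ℝ) (F₀ : Measure (E d)) (m₀ : ℝ) : ℝ := ∫ z, w₂ (s₀ m₀ ‖z‖) ∂F₀

def c₁ {d : ℕ} (w₂ : ℝ → ℝ) (F₀ : Measure (E d)) (m₀ : ℝ) : ℝ :=
  (∫ z, ‖z‖ ^ 2 * w₂ (s₀ m₀ ‖z‖) ∂F₀) / (d * c₀ w₂ F₀ m₀)

/-- `c_j` for `j = 2, 3`. -/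
def c {d : ℕ} (w₂ : ℝ → ℝ) (F₀ : Measure (E d)) (m₀ pm₀ : ℝ) (j : ℕ) : ℝ :=
  (∫ z, ‖z‖ ^ (2 * j - 3) * s₀ m₀ ‖z‖ ^ 2 * wderiv w₂ (s₀ m₀ ‖z‖) ∂F₀) / (4 * m₀ ^ 2 * pm₀)

/-- `(s_1(x) - s_2(x)) / (d - 1)`, which is `0` for `d = 1`. -/
def sTilde {d : ℕ} [NeZero d] (F₀ : Measure (E d)) (m₀ x : ℝ) : ℝ :=
  if d = 1 then 0 else (s F₀ m₀ 1 x - s F₀ m₀ 2 x) / ((d : ℝ) - 1)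

def t₁ {d : ℕ} [NeZero d] (w₂ : ℝ → ℝ) (F₀ : Measure (E d)) (m₀ pm₀ x : ℝ) : ℝ :=
  c w₂ F₀ m₀ pm₀ 3 * (s F₀ m₀ 2 x - sTilde F₀ m₀ x) + x ^ 2 * w₂ (s₀ m₀ x)

def t₂ {d : ℕ} [NeZero d] (w₂ : ℝ → ℝ) (F₀ : Measure (E d)) (m₀ pm₀ x : ℝ) : ℝ :=
  c w₂ F₀ m₀ pm₀ 3 * sTilde F₀ m₀ x - c₁ w₂ F₀ m₀ * c w₂ F₀ m₀ pm₀ 2 * s F₀ m₀ 1 x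
    - c₁ w₂ F₀ m₀ * w₂ (s₀ m₀ x)

end Constants

/-- `x x' / ‖x‖²` for `x ≠ 0`, read as `I_d / d` (its average over all directions) at `x = 0`. In
dimension one this is the number `1` for every `x`. -/
def dirOuter {d : ℕ} (x : E d) : Matrix (Fin d) (Fin d) ℝ :=
  if x = 0 then (1 / (d : ℝ)) • (1 : Matrix (Fin d) (Fin d) ℝ) else (1 / ‖x‖ ^ 2) • outer x

end DepthScatter

end

/-! Affine equivariance of Med and MAD makes the depth affine invariant and PWS equivariant
(`PD_map_affine`, `PWS_map_affine`). Standardization turns F into a spherical law F₀ all of whose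
unit projections have the law of Y, so well-definedness and influence functions can be transported
between F₀ and F.

At F₀ the outlyingness of y ≠ 0 is ‖y‖/m₀, attained only at u = y/‖y‖. On the line, contamination at
t moves the median by ε sign(t)/(2p(0)) and the MAD by ε sign(|t| - m₀)/(4p(m₀)), up to o(ε) and
locally uniformly in t away from the jumps; over all t both shifts are O(ε) uniformly
(`median_bounds`, `mad_bounds`). Because the maximizer is unique, the supremum changes to first
order as the single ratio at y/‖y‖ does (`tendsto_iSup_ratio`). The chain rule then differentiates
w_i(PD(y)) in ε for almost every y (`regularAt`). The decay w_i'(r) = O(r^i) keeps the difference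
quotients of k(y) w_i(PD(y)) bounded whenever k grows at most like ‖y‖^(i+1), so dominated
convergence with a constant differentiates the weighted integrals (`hasDerivWithinAt_integral`).

Symmetry does the rest. The mean and the first weighted moments vanish at ε = 0 and enter PWS only
through their products, so they leave no trace (`hasDerivWithinAt_PWS`). The contribution of the
median is odd in y and integrates to zero; only that of the MAD survives, and p(0) disappears
(`integral_mul_depthDeriv`). Norm and direction of Z are uncorrelated
(`integral_norm_mul_direction`), which produces the products c_j s_i. Invariance under the
isometries fixing x forces the matrix of second moments to be a combination of xx'/‖x‖² and the
identity, with coefficients read off from the moment along x and from the trace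
(`crossMoment_axial`). -/

noncomputable section

namespace DepthScatter

/-! ### Medians: one-sided estimates and affine equivariance -/

section Median

variable (ρ : Measure ℝ) [IsProbabilityMeasure ρ]

lemma real_Ici_eq (t : ℝ) : ρ.real (Ici t) = 1 - ρ.real (Iio t) := by
  rw [← probReal_compl_eq_one_sub measurableSet_Iio, compl_Iio]

lemma real_Iic_eq (t : ℝ) : ρ.real (Iic t) = 1 - ρ.real (Ioi t) := by
  rw [← probReal_compl_eq_one_sub measurableSet_Ioi, compl_Ioi]

lemma exists_real_Iic_lt : ∃ t, ρ.real (Iic t) < 1 / 2 := by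
  have h := (ProbabilityTheory.tendsto_cdf_atBot ρ).eventually (gt_mem_nhds (by norm_num : (0:ℝ) < 1 / 2))
  obtain ⟨t, ht⟩ := h.exists
  exact ⟨t, by rwa [ProbabilityTheory.cdf_eq_real] at ht⟩

lemma exists_lt_real_Iic : ∃ t, 1 / 2 < ρ.real (Iic t) := by
  have h := (ProbabilityTheory.tendsto_cdf_atTop ρ).eventually (lt_mem_nhds (by norm_num : (1 / 2 : ℝ) < 1))
  obtain ⟨t, ht⟩ := h.exists
  exact ⟨t, by rwa [ProbabilityTheory.cdf_eq_real] at ht⟩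

lemma lowerMedians_nonempty : {t : ℝ | 1 / 2 ≤ ρ.real (Iic t)}.Nonempty :=
  (exists_lt_real_Iic ρ).imp fun _ h => h.le

lemma bddBelow_lowerMedians : BddBelow {t : ℝ | 1 / 2 ≤ ρ.real (Iic t)} := by
  obtain ⟨a, ha⟩ := exists_real_Iic_lt ρ
  refine ⟨a, fun t ht => ?_⟩
  by_contra! h
  have := measureReal_mono (μ := ρ) (Iic_subset_Iic.2 h.le)
  simp only [mem_ofPred_eq] at ht
  linarith

lemma upperMedians_nonempty : {t : ℝ | 1 / 2 ≤ ρ.real (Ici t)}.Nonempty := by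
  obtain ⟨a, ha⟩ := exists_real_Iic_lt ρ
  refine ⟨a, ?_⟩
  have := measureReal_mono (μ := ρ) (Iio_subset_Iic_self (a := a))
  simp only [mem_ofPred_eq, real_Ici_eq]
  linarith

lemma bddAbove_upperMedians : BddAbove {t : ℝ | 1 / 2 ≤ ρ.real (Ici t)} := by
  obtain ⟨a, ha⟩ := exists_lt_real_Iic ρ
  refine ⟨a, fun t ht => ?_⟩
  by_contra! h
  have := measureReal_mono (μ := ρ) (Iic_subset_Iio.2 h)
  simp only [mem_ofPred_eq, real_Ici_eq] at ht
  linarith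

variable {ρ}

/-- Both end points of the median interval lie above `a`, so the midpoint does too. With its mirror
image `median_le`, this reduces estimates of a median to strict inequalities between masses, without
any uniqueness of the median. -/
lemma le_median {a : ℝ} (h : ρ.real (Iio a) < 1 / 2) : a ≤ median ρ := by
  have h1 : a ≤ sInf {t : ℝ | 1 / 2 ≤ ρ.real (Iic t)} := by
    refine le_csInf (lowerMedians_nonempty ρ) fun t ht => ?_
    by_contra! hlt
    have := measureReal_mono (μ := ρ) (Iic_subset_Iio.2 hlt)
    simp only [mem_ofPred_eq] at ht
    linarith
  have h2 : a ≤ sSup {t : ℝ | 1 / 2 ≤ ρ.real (Ici t)} := by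
    refine le_csSup (bddAbove_upperMedians ρ) ?_
    simp only [mem_ofPred_eq, real_Ici_eq]
    linarith
  rw [median]
  linarith

lemma median_le {b : ℝ} (h : ρ.real (Ioi b) < 1 / 2) : median ρ ≤ b := by
  have h1 : sInf {t : ℝ | 1 / 2 ≤ ρ.real (Iic t)} ≤ b := by
    refine csInf_le (bddBelow_lowerMedians ρ) ?_
    simp only [mem_ofPred_eq, real_Iic_eq]
    linarith
  have h2 : sSup {t : ℝ | 1 / 2 ≤ ρ.real (Ici t)} ≤ b := by
    refine csSup_le (upperMedians_nonempty ρ) fun t ht => ?_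
    by_contra! hlt
    have := measureReal_mono (μ := ρ) (Ici_subset_Ioi.2 hlt)
    simp only [mem_ofPred_eq] at ht
    linarith
  rw [median]
  linarith

lemma median_map_affine {c : ℝ} (hc : 0 < c) (b : ℝ) :
    median (ρ.map fun y => c * y + b) = c * median ρ + b := by
  have hm : Measurable fun y : ℝ => c * y + b := by fun_prop
  let e : ℝ ≃o ℝ := (OrderIso.mulLeft₀ c hc).trans (OrderIso.addRight b)
  have he : ∀ y, e y = c * y + b := fun y => rfl
  have h1 : {t : ℝ | 1 / 2 ≤ (ρ.map fun y => c * y + b).real (Iic t)}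
      = e '' {t : ℝ | 1 / 2 ≤ ρ.real (Iic t)} := by
    rw [e.image_eq_preimage_symm]
    ext t
    obtain ⟨t, rfl⟩ := e.surjective t
    have : (fun y => c * y + b) ⁻¹' Iic (e t) = Iic t := by
      ext y; simp [← he]
    simp [map_measureReal_apply hm measurableSet_Iic, this]
  have h2 : {t : ℝ | 1 / 2 ≤ (ρ.map fun y => c * y + b).real (Ici t)}
      = e '' {t : ℝ | 1 / 2 ≤ ρ.real (Ici t)} := by
    rw [e.image_eq_preimage_symm]
    ext t
    obtain ⟨t, rfl⟩ := e.surjective t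
    have : (fun y => c * y + b) ⁻¹' Ici (e t) = Ici t := by
      ext y; simp [← he]
    simp [map_measureReal_apply hm measurableSet_Ici, this]
  have i1 := e.map_csInf' (lowerMedians_nonempty ρ) (bddBelow_lowerMedians ρ)
  have i2 := e.map_csSup' (upperMedians_nonempty ρ) (bddAbove_upperMedians ρ)
  rw [median, median, h1, h2, ← i1, ← i2, he, he]
  ring

omit [IsProbabilityMeasure ρ] in
-- Reflection exchanges the two sets of half-medians. The real infimum is by definition minus the
-- supremum of the negated set, so no boundedness is needed.
lemma median_map_neg : median (ρ.map fun y => -y) = -median ρ := by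
  have hm : Measurable fun y : ℝ => -y := by fun_prop
  have h1 : {t : ℝ | 1 / 2 ≤ (ρ.map fun y => -y).real (Iic t)}
      = -{t : ℝ | 1 / 2 ≤ ρ.real (Ici t)} := by
    ext t
    simp [map_measureReal_apply hm measurableSet_Iic]
  have h2 : {t : ℝ | 1 / 2 ≤ (ρ.map fun y => -y).real (Ici t)}
      = -{t : ℝ | 1 / 2 ≤ ρ.real (Iic t)} := by
    ext t
    simp [map_measureReal_apply hm measurableSet_Ici]
  rw [median, median, h1, h2, Real.sInf_def, neg_neg, Real.sInf_def]
  ring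

lemma mad_map_affine {c : ℝ} (hc : 0 < c) (b : ℝ) :
    mad (ρ.map fun y => c * y + b) = c * mad ρ := by
  have hm : Measurable fun y : ℝ => c * y + b := by fun_prop
  have hm' : Measurable fun y : ℝ => |y - median ρ| := by fun_prop
  rw [mad, mad, median_map_affine hc, Measure.map_map (by fun_prop) hm]
  have : IsProbabilityMeasure (ρ.map fun y => |y - median ρ|) :=
    Measure.isProbabilityMeasure_map hm'.aemeasurable
  have h := median_map_affine (ρ := ρ.map fun y => |y - median ρ|) hc 0
  rw [Measure.map_map (by fun_prop) hm', add_zero] at h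
  rw [← h]
  congr 2
  ext y
  simp only [Function.comp_apply, add_zero]
  rw [← abs_of_pos hc, ← abs_mul, abs_of_pos hc]
  congr 1
  ring

omit [IsProbabilityMeasure ρ] in
lemma mad_map_neg : mad (ρ.map fun y => -y) = mad ρ := by
  have hm : Measurable fun y : ℝ => -y := by fun_prop
  rw [mad, mad, median_map_neg, Measure.map_map (by fun_prop) hm]
  congr 2
  ext y
  simp only [Function.comp_apply]
  rw [← abs_neg]
  congr 1
  ring

omit [IsProbabilityMeasure ρ] in
lemma median_eq_zero_of_symm (h : ρ.map (fun y => -y) = ρ) : median ρ = 0 := by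
  have := median_map_neg (ρ := ρ)
  rw [h] at this
  linarith

end Median

/-! ### Affine invariance of the depth and equivariance of the weighted mean and scatter -/

section Equivariance

variable {d : ℕ}

lemma act_eq (B : Matrix (Fin d) (Fin d) ℝ) (x : E d) :
    act B x = Matrix.toEuclideanCLM (𝕜 := ℝ) B x := rfl

lemma act_act (B C : Matrix (Fin d) (Fin d) ℝ) (x : E d) : act B (act C x) = act (B * C) x := by
  simp [act]

lemma act_one (x : E d) : act 1 x = x := by
  simp [act]

lemma act_sub (B : Matrix (Fin d) (Fin d) ℝ) (x y : E d) :
    act B (x - y) = act B x - act B y := by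
  simp [act_eq]

lemma act_smul (B : Matrix (Fin d) (Fin d) ℝ) (r : ℝ) (x : E d) :
    act B (r • x) = r • act B x := by
  simp [act_eq]

lemma inner_act (B : Matrix (Fin d) (Fin d) ℝ) (u x : E d) :
    inner ℝ u (act B x) = inner ℝ (act Bᵀ u) x := by
  simp only [act, EuclideanSpace.inner_eq_star_dotProduct, star_trivial]
  rw [dotProduct_comm, Matrix.dotProduct_mulVec, dotProduct_comm, Matrix.mulVec_transpose]

lemma continuous_act (B : Matrix (Fin d) (Fin d) ℝ) : Continuous (act B) :=
  (Matrix.toEuclideanCLM (𝕜 := ℝ) B).continuous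

lemma act_injective {B : Matrix (Fin d) (Fin d) ℝ} (hB : IsUnit B.det) :
    Function.Injective (act B) := by
  intro x y h
  have := congrArg (act B⁻¹) h
  rwa [act_act, act_act, Matrix.nonsing_inv_mul _ hB, act_one, act_one] at this

/-- The affine map `z ↦ B z + b`. -/
def affine (B : Matrix (Fin d) (Fin d) ℝ) (b z : E d) : E d := act B z + b

lemma continuous_affine (B : Matrix (Fin d) (Fin d) ℝ) (b : E d) : Continuous (affine B b) :=
  (continuous_act B).add continuous_const

lemma measurableEmbedding_affine {B : Matrix (Fin d) (Fin d) ℝ} (hB : IsUnit B.det) (b : E d) :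
    MeasurableEmbedding (affine B b) :=
  (continuous_affine B b).measurableEmbedding fun _ _ h => act_injective hB (add_right_cancel h)

instance isProbabilityMeasure_projLaw (F : Measure (E d)) [IsProbabilityMeasure F] (u : E d) :
    IsProbabilityMeasure (projLaw F u) :=
  Measure.isProbabilityMeasure_map (by fun_prop)

instance isProbabilityMeasure_map_affine (F : Measure (E d)) [IsProbabilityMeasure F]
    (B : Matrix (Fin d) (Fin d) ℝ) (b : E d) : IsProbabilityMeasure (F.map (affine B b)) :=
  Measure.isProbabilityMeasure_map (continuous_affine B b).aemeasurable

lemma projLaw_smul (F : Measure (E d)) (c : ℝ) (u : E d) :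
    projLaw F (c • u) = (projLaw F u).map fun y => c * y := by
  rw [projLaw, projLaw, Measure.map_map (by fun_prop) (by fun_prop)]
  congr 1
  ext x
  simp [inner_smul_left]

lemma projLaw_map_affine (F : Measure (E d)) (B : Matrix (Fin d) (Fin d) ℝ) (b u : E d) :
    projLaw (F.map (affine B b)) u = (projLaw F (act Bᵀ u)).map fun y => y + inner ℝ u b := by
  rw [projLaw, projLaw, Measure.map_map (by fun_prop) (continuous_affine B b).measurable,
    Measure.map_map (by fun_prop) (by fun_prop)]
  congr 1
  ext x
  simp [affine, inner_add_right, inner_act]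

/-- The normalized image `B' u / ‖B' u‖` of a direction. -/
def pullDir (B : Matrix (Fin d) (Fin d) ℝ) (u : E d) : E d := ‖act Bᵀ u‖⁻¹ • act Bᵀ u

lemma act_transpose_ne_zero {B : Matrix (Fin d) (Fin d) ℝ} (hB : IsUnit B.det) {u : E d}
    (hu : u ≠ 0) : act Bᵀ u ≠ 0 := by
  intro h
  refine hu (act_injective (B := Bᵀ) (by rwa [Matrix.det_transpose]) ?_)
  rw [h, act_eq, map_zero]

lemma norm_pullDir {B : Matrix (Fin d) (Fin d) ℝ} (hB : IsUnit B.det) {u : E d}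
    (hu : ‖u‖ = 1) : ‖pullDir B u‖ = 1 := by
  have hu0 : u ≠ 0 := by rintro rfl; simp at hu
  have := act_transpose_ne_zero hB hu0
  rw [pullDir, norm_smul, norm_inv, norm_norm, inv_mul_cancel₀ (norm_ne_zero_iff.2 this)]

lemma exists_pullDir {B : Matrix (Fin d) (Fin d) ℝ} (hB : IsUnit B.det) {v : E d}
    (hv : ‖v‖ = 1) : ∃ u, ‖u‖ = 1 ∧ pullDir B u = v := by
  have hB' : IsUnit (Bᵀ).det := by rwa [Matrix.det_transpose]
  have hv0 : v ≠ 0 := by rintro rfl; simp at hv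
  have h1 : act Bᵀ (act Bᵀ⁻¹ v) = v := by
    rw [act_act, Matrix.mul_nonsing_inv _ hB', act_one]
  have h2 : act Bᵀ⁻¹ v ≠ 0 := by
    intro h
    rw [h, act_eq, map_zero] at h1
    exact hv0 h1.symm
  have h3 : 0 < ‖act Bᵀ⁻¹ v‖ := norm_pos_iff.2 h2
  refine ⟨‖act Bᵀ⁻¹ v‖⁻¹ • act Bᵀ⁻¹ v, ?_, ?_⟩
  · rw [norm_smul, norm_inv, norm_norm, inv_mul_cancel₀ h3.ne']
  · rw [pullDir, act_smul, h1, norm_smul, hv, norm_inv, norm_norm, smul_smul]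
    field_simp
    simp

variable {G : Measure (E d)} [IsProbabilityMeasure G] {B : Matrix (Fin d) (Fin d) ℝ}

omit [IsProbabilityMeasure G] in
lemma projLaw_map_affine_pullDir (hB : IsUnit B.det) (b : E d) {u : E d} (hu : ‖u‖ = 1) :
    projLaw (G.map (affine B b)) u =
      (projLaw G (pullDir B u)).map fun y => ‖act Bᵀ u‖ * y + inner ℝ u b := by
  have hu0 : u ≠ 0 := by rintro rfl; simp at hu
  have h := norm_ne_zero_iff.2 (act_transpose_ne_zero hB hu0)
  rw [projLaw_map_affine, pullDir, projLaw_smul, Measure.map_map (by fun_prop) (by fun_prop)]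
  congr 1
  ext y
  simp only [Function.comp_apply]
  field_simp

lemma mad_projLaw_map_affine (hB : IsUnit B.det) (b : E d) {u : E d} (hu : ‖u‖ = 1) :
    mad (projLaw (G.map (affine B b)) u) = ‖act Bᵀ u‖ * mad (projLaw G (pullDir B u)) := by
  have hu0 : u ≠ 0 := by rintro rfl; simp at hu
  rw [projLaw_map_affine_pullDir hB b hu,
    mad_map_affine (norm_pos_iff.2 (act_transpose_ne_zero hB hu0))]

lemma projRatio_map_affine (hB : IsUnit B.det) (b z : E d) {u : E d} (hu : ‖u‖ = 1) :
    projRatio (affine B b z) (G.map (affine B b)) u = projRatio z G (pullDir B u) := by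
  have hu0 : u ≠ 0 := by rintro rfl; simp at hu
  have hn := norm_pos_iff.2 (act_transpose_ne_zero hB hu0)
  rw [projRatio, projRatio, mad_projLaw_map_affine hB b hu, projLaw_map_affine_pullDir hB b hu,
    median_map_affine hn, affine, inner_add_right, inner_act]
  have : inner ℝ (act Bᵀ u) z = ‖act Bᵀ u‖ * inner ℝ (pullDir B u) z := by
    rw [pullDir, inner_smul_left]
    simp only [conj_trivial]
    field_simp
  rw [this, ← mul_div_mul_left _ (mad (projLaw G (pullDir B u))) hn.ne']
  congr 1
  ring

/-- The map u ↦ B'u/‖B'u‖ is onto the unit sphere and preserves the ratios. Equality of ranges,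
rather than of suprema, also transports boundedness. -/
lemma range_projRatio_map_affine (hB : IsUnit B.det) (b z : E d) :
    (range fun u : Metric.sphere (0 : E d) 1 => projRatio (affine B b z) (G.map (affine B b)) u) =
      range fun u : Metric.sphere (0 : E d) 1 => projRatio z G u := by
  ext r
  constructor
  · rintro ⟨⟨u, hu⟩, rfl⟩
    rw [mem_sphere_zero_iff_norm] at hu
    exact ⟨⟨pullDir B u, mem_sphere_zero_iff_norm.2 (norm_pullDir hB hu)⟩,
      (projRatio_map_affine hB b z hu).symm⟩
  · rintro ⟨⟨v, hv⟩, rfl⟩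
    rw [mem_sphere_zero_iff_norm] at hv
    obtain ⟨u, hu, rfl⟩ := exists_pullDir hB hv
    exact ⟨⟨u, mem_sphere_zero_iff_norm.2 hu⟩, projRatio_map_affine hB b z hu⟩

lemma PD_map_affine (hB : IsUnit B.det) (b z : E d) :
    PD (affine B b z) (G.map (affine B b)) = PD z G := by
  rw [PD, PD, outlyingness, outlyingness, iSup, iSup, range_projRatio_map_affine hB]

omit [IsProbabilityMeasure G] in
-- Since (1 + r)^i ≤ 2^(i-1) (1 + r^i), the two integrability hypotheses dominate every weight of
-- growth i.
lemma integrable_mul_of_growth {i : ℕ} {v k : E d → ℝ} (hv : Integrable v G)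
    (hi : Integrable (fun x => ‖x‖ ^ i * v x) G) (hk : Measurable k) {C : ℝ}
    (hC : ∀ x, |k x| ≤ C * (1 + ‖x‖) ^ i) : Integrable (fun x => k x * v x) G := by
  have h : Integrable (fun x => C * 2 ^ (i - 1) * (‖v x‖ + ‖‖x‖ ^ i * v x‖)) G :=
    (hv.norm.add hi.norm).const_mul _
  refine h.mono' (hk.aestronglyMeasurable.mul hv.aestronglyMeasurable) (ae_of_all _ fun x => ?_)
  have hC0 : 0 ≤ C := by
    have := (abs_nonneg _).trans (hC 0)
    simpa using this
  have h1 : (1 + ‖x‖) ^ i ≤ 2 ^ (i - 1) * (1 ^ i + ‖x‖ ^ i) :=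
    add_pow_le zero_le_one (norm_nonneg x) i
  rw [norm_mul, norm_mul, norm_pow, norm_norm, Real.norm_eq_abs (k x)]
  calc |k x| * ‖v x‖ ≤ (C * (2 ^ (i - 1) * (1 ^ i + ‖x‖ ^ i))) * ‖v x‖ := by
        gcongr
        exact (hC x).trans (by gcongr)
    _ = _ := by ring

omit [IsProbabilityMeasure G] in
-- The Bochner integral of a non-integrable function is 0, so positivity of the integral already
-- contains integrability.
lemma WeightIntegrable.integrable {i : ℕ} {w : ℝ → ℝ} (h : WeightIntegrable i w G) :
    Integrable (fun x => w (PD x G)) G :=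
  Integrable.of_integral_ne_zero h.1.ne'

omit [IsProbabilityMeasure G] in
lemma WeightIntegrable.integrable_mul {i : ℕ} {w : ℝ → ℝ} (h : WeightIntegrable i w G)
    {k : E d → ℝ} (hk : Measurable k) {C : ℝ} (hC : ∀ x, |k x| ≤ C * (1 + ‖x‖) ^ i) :
    Integrable (fun x => k x * w (PD x G)) G :=
  integrable_mul_of_growth h.integrable h.2 hk hC

lemma WeightIntegrable.map_affine {i : ℕ} {w : ℝ → ℝ} (h : WeightIntegrable i w G)
    (hB : IsUnit B.det) (b : E d) : WeightIntegrable i w (G.map (affine B b)) := by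
  refine ⟨?_, ?_⟩
  · rw [(measurableEmbedding_affine hB b).integral_map]
    simp only [PD_map_affine hB]
    exact h.1
  · rw [(measurableEmbedding_affine hB b).integrable_map_iff]
    simp only [Function.comp_def, PD_map_affine hB]
    set M := Matrix.toEuclideanCLM (𝕜 := ℝ) B
    refine h.integrable_mul (C := (‖M‖ + ‖b‖) ^ i)
      ((continuous_affine B b).norm.pow i).measurable fun x => ?_
    rw [abs_of_nonneg (by positivity), ← mul_pow]
    gcongr
    calc ‖affine B b x‖ ≤ ‖M x‖ + ‖b‖ := norm_add_le _ _
      _ ≤ ‖M‖ * ‖x‖ + ‖b‖ := by gcongr; exact M.le_opNorm x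
      _ ≤ (‖M‖ + ‖b‖) * (1 + ‖x‖) := by
        have := mul_nonneg (norm_nonneg b) (norm_nonneg x)
        nlinarith [norm_nonneg M]

lemma PWSWellDefined.map_affine {w₁ w₂ : ℝ → ℝ} (h : PWSWellDefined w₁ w₂ G)
    (hB : IsUnit B.det) (b : E d) : PWSWellDefined w₁ w₂ (G.map (affine B b)) := by
  refine ⟨?_, ?_, h.2.2.1.map_affine hB b, h.2.2.2.map_affine hB b⟩
  · rintro ⟨u, hu⟩
    rw [mem_sphere_zero_iff_norm] at hu
    have hu0 : u ≠ 0 := by rintro rfl; simp at hu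
    rw [mad_projLaw_map_affine hB b hu]
    exact mul_pos (norm_pos_iff.2 (act_transpose_ne_zero hB hu0))
      (h.1 ⟨_, mem_sphere_zero_iff_norm.2 (norm_pullDir hB hu)⟩)
  · intro x
    obtain ⟨z, rfl⟩ : ∃ z, affine B b z = x :=
      ⟨act B⁻¹ (x - b), by rw [affine, act_act, Matrix.mul_nonsing_inv _ hB, act_one,
        sub_add_cancel]⟩
    rw [range_projRatio_map_affine hB]
    exact h.2.1 z

omit [IsProbabilityMeasure G] in
lemma WeightIntegrable.integrable_smul {w : ℝ → ℝ} (h : WeightIntegrable 1 w G) :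
    Integrable (fun x => w (PD x G) • x) G := by
  refine (integrable_norm_iff (h.integrable.aestronglyMeasurable.smul
    aestronglyMeasurable_id)).1 ?_
  refine h.2.norm.congr (ae_of_all _ fun x => ?_)
  simp [norm_smul, mul_comm]

lemma depthMean_map_affine {w : ℝ → ℝ} (h : WeightIntegrable 1 w G)
    (hB : IsUnit B.det) (b : E d) :
    depthMean w PD (G.map (affine B b)) = affine B b (depthMean w PD G) := by
  rw [depthMean, (measurableEmbedding_affine hB b).integral_map,
    (measurableEmbedding_affine hB b).integral_map]
  simp only [PD_map_affine hB]
  simp only [affine, smul_add, depthMean, act_eq]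
  set M := Matrix.toEuclideanCLM (𝕜 := ℝ) B
  have h1 : ∀ x : E d, w (PD x G) • M x = M (w (PD x G) • x) := fun x => by rw [map_smul]
  simp only [h1]
  -- The shift `b` comes out multiplied by the total weight, which the normalization cancels.
  rw [integral_add (M.integrable_comp h.integrable_smul) (h.integrable.smul_const b),
    M.integral_comp_comm h.integrable_smul, integral_smul_const, smul_add, smul_smul,
    inv_mul_cancel₀ h.1.ne', one_smul, map_smul]

lemma outer_act (B : Matrix (Fin d) (Fin d) ℝ) (x : E d) (i j : Fin d) :
    outer (act B x) i j = ∑ k, ∑ l, B i k * B j l * outer x k l := by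
  simp only [outer, act, Matrix.of_apply, Matrix.mulVec, dotProduct]
  rw [Finset.sum_mul_sum]
  exact Finset.sum_congr rfl fun k _ => Finset.sum_congr rfl fun l _ => by ring

lemma conj_apply (B M : Matrix (Fin d) (Fin d) ℝ) (i j : Fin d) :
    (B * M * Bᵀ) i j = ∑ k, ∑ l, B i k * B j l * M k l := by
  simp only [Matrix.mul_apply, Matrix.transpose_apply, Finset.sum_mul]
  rw [Finset.sum_comm]
  exact Finset.sum_congr rfl fun k _ => Finset.sum_congr rfl fun l _ => by ring

lemma abs_apply_le_norm (x : E d) (i : Fin d) : |x i| ≤ ‖x‖ := by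
  rw [← Real.norm_eq_abs]
  exact PiLp.norm_apply_le x i

omit [IsProbabilityMeasure G] in
lemma WeightIntegrable.integrable_outer {w : ℝ → ℝ} (h : WeightIntegrable 2 w G) (c : E d)
    (i j : Fin d) : Integrable (fun x => outer (x - c) i j * w (PD x G)) G := by
  refine h.integrable_mul (C := (1 + ‖c‖) ^ 2) ?_ fun x => ?_
  · simp only [outer, Matrix.of_apply]
    fun_prop
  · have h1 : ‖x - c‖ ≤ (1 + ‖c‖) * (1 + ‖x‖) := by
      nlinarith [norm_sub_le x c, norm_nonneg x, norm_nonneg c,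
        mul_nonneg (norm_nonneg x) (norm_nonneg c)]
    rw [outer, Matrix.of_apply, abs_mul, sq, sq, mul_mul_mul_comm]
    gcongr <;> exact (abs_apply_le_norm _ _).trans h1

lemma PWS_map_affine {w₁ w₂ : ℝ → ℝ} (h₁ : WeightIntegrable 1 w₁ G)
    (h₂ : WeightIntegrable 2 w₂ G) (hB : IsUnit B.det) (b : E d) :
    PWS w₁ w₂ (G.map (affine B b)) = B * PWS w₁ w₂ G * Bᵀ := by
  ext i j
  rw [conj_apply, PWS, PWS, depthScatter, depthScatter, Matrix.of_apply,
    (measurableEmbedding_affine hB b).integral_map, (measurableEmbedding_affine hB b).integral_map]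
  simp only [PD_map_affine hB, depthMean_map_affine h₁ hB, Matrix.of_apply]
  have h1 : ∀ x : E d, outer (affine B b x - affine B b (depthMean w₁ PD G)) i j * w₂ (PD x G) =
      ∑ k, ∑ l, B i k * B j l * (outer (x - depthMean w₁ PD G) k l * w₂ (PD x G)) := by
    intro x
    rw [affine, affine, add_sub_add_right_eq_sub, ← act_sub, outer_act, Finset.sum_mul]
    refine Finset.sum_congr rfl fun k _ => ?_
    rw [Finset.sum_mul]
    exact Finset.sum_congr rfl fun l _ => by ring
  simp only [h1]
  have hint := h₂.integrable_outer (depthMean w₁ PD G)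
  rw [integral_finsetSum _ fun k _ => integrable_finsetSum _ fun l _ => (hint k l).const_mul _,
    Finset.sum_div]
  refine Finset.sum_congr rfl fun k _ => ?_
  rw [integral_finsetSum _ fun l _ => (hint k l).const_mul _, Finset.sum_div]
  refine Finset.sum_congr rfl fun l _ => ?_
  rw [integral_const_mul, mul_div_assoc]

end Equivariance

/-! ### Median and MAD of a contaminated symmetric law on the line -/

section OneDimensional

/-- `ν` is a symmetric law with continuous density `p`, MAD `m₀` and `p 0, p m₀ > 0`. -/
structure IsSymmLaw (ν : Measure ℝ) (p : ℝ → ℝ) (m₀ : ℝ) : Prop where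
  prob : IsProbabilityMeasure ν
  cont : Continuous p
  nonneg : ∀ y, 0 ≤ p y
  density : ν = volume.withDensity fun y => ENNReal.ofReal (p y)
  symm : ν.map (fun y => -y) = ν
  mad_eq : mad ν = m₀
  pos_zero : 0 < p 0
  pos_mad : 0 < p m₀

namespace IsSymmLaw

variable {ν : Measure ℝ} {p : ℝ → ℝ} {m₀ : ℝ}

lemma nullSingletonClass (h : IsSymmLaw ν p m₀) : NullSingletonClass ν := by
  rw [h.density]; infer_instance

lemma real_Iio (h : IsSymmLaw ν p m₀) (y : ℝ) : ν.real (Iio y) = ν.real (Iic y) := by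
  have := h.nullSingletonClass
  exact measureReal_congr Iio_ae_eq_Iic

lemma real_Ioc (h : IsSymmLaw ν p m₀) {a b : ℝ} (hab : a ≤ b) :
    ν.real (Ioc a b) = ∫ y in a..b, p y := by
  rw [intervalIntegral.integral_of_le hab, measureReal_def, h.density,
    withDensity_apply _ measurableSet_Ioc,
    integral_eq_lintegral_of_nonneg_ae (ae_of_all _ h.nonneg) h.cont.aestronglyMeasurable]

lemma cdf_sub (h : IsSymmLaw ν p m₀) (a b : ℝ) :
    ν.real (Iic b) - ν.real (Iic a) = ∫ y in a..b, p y := by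
  have := h.prob
  have key : ∀ {a b : ℝ}, a ≤ b → ν.real (Iic b) - ν.real (Iic a) = ∫ y in a..b, p y := by
    intro a b hab
    rw [← h.real_Ioc hab, ← measureReal_sdiff (Iic_subset_Iic.2 hab) measurableSet_Iic,
      Iic_sdiff_Iic]
  rcases le_total a b with hab | hab
  · exact key hab
  · rw [intervalIntegral.integral_symm, ← key hab]; ring

lemma hasDerivAt_cdf (h : IsSymmLaw ν p m₀) (y : ℝ) :
    HasDerivAt (fun y => ν.real (Iic y)) (p y) y := by
  have h1 : (fun y => ν.real (Iic y)) = fun y => ν.real (Iic 0) + ∫ x in (0:ℝ)..y, p x := by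
    ext y
    rw [← h.cdf_sub]; ring
  rw [h1]
  exact (intervalIntegral.integral_hasDerivAt_right (h.cont.intervalIntegrable _ _)
    (h.cont.stronglyMeasurableAtFilter _ _) h.cont.continuousAt).const_add _

lemma cdf_neg (h : IsSymmLaw ν p m₀) (y : ℝ) : ν.real (Iic (-y)) = 1 - ν.real (Iic y) := by
  have := h.prob
  have h1 : ν.real (Iic (-y)) = ν.real (Ici y) := by
    conv_lhs => rw [← h.symm]
    rw [map_measureReal_apply (by fun_prop) measurableSet_Iic]
    congr 1
    ext; simp
  rw [h1, real_Ici_eq, h.real_Iio]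

lemma cdf_zero (h : IsSymmLaw ν p m₀) : ν.real (Iic 0) = 1 / 2 := by
  have := h.cdf_neg 0
  rw [neg_zero] at this
  linarith

/-- Symmetry turns the left end point into a second value of the distribution function near `m₀`.
The arguments are written as increments from `m₀` so that the derivative there applies directly. -/
lemma real_abs_sub_lt (h : IsSymmLaw ν p m₀) (μ : ℝ) {r : ℝ} (hr : 0 ≤ r) :
    ν.real {y | |y - μ| < r} = ν.real (Iic (m₀ + (r + μ - m₀))) +
      ν.real (Iic (m₀ + (r - μ - m₀))) - 1 := by
  have := h.prob
  have h1 : {y | |y - μ| < r} = Iio (r + μ) \ Iic (-(r - μ)) := by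
    ext y
    simp only [mem_ofPred_eq, abs_lt, Set.mem_sdiff, mem_Iio, mem_Iic, not_le]
    constructor <;> rintro ⟨h1, h2⟩ <;> constructor <;> linarith
  have e1 : m₀ + (r + μ - m₀) = r + μ := by ring
  have e2 : m₀ + (r - μ - m₀) = r - μ := by ring
  rw [h1, e1, e2]
  rcases eq_or_lt_of_le hr with rfl | hr
  -- At r = 0 the closed half-line is not contained in the open one, so subtraction of measures does
  -- not apply; the set is empty.
  · have : Iio (0 + μ) \ Iic (-(0 - μ)) = ∅ := by
      ext y
      simp only [Set.mem_sdiff, mem_Iio, mem_Iic, mem_empty_iff_false, iff_false]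
      intro h; exact h.2 (by linarith [h.1])
    have h2 := h.cdf_neg μ
    rw [this, measureReal_empty, zero_add, zero_sub]
    linarith
  · rw [measureReal_sdiff (fun y hy => by simp only [mem_Iic, mem_Iio] at *; linarith)
      measurableSet_Iic, h.cdf_neg, h.real_Iio]
    ring

lemma real_lt_abs_sub (h : IsSymmLaw ν p m₀) (μ r : ℝ) :
    ν.real {y | r < |y - μ|} = 1 - ν.real {y | |y - μ| < r} := by
  have := h.prob
  have := h.nullSingletonClass
  have hm : MeasurableSet {y : ℝ | |y - μ| ≤ r} :=
    measurableSet_le (by fun_prop) measurable_const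
  have h1 : {y | r < |y - μ|} = {y : ℝ | |y - μ| ≤ r}ᶜ := by
    ext y; simp
  have h2 : ν.real {y : ℝ | |y - μ| ≤ r} = ν.real {y | |y - μ| < r} := by
    have e1 : {y : ℝ | |y - μ| ≤ r} = Icc (μ - r) (μ + r) := by
      ext y
      simp only [mem_ofPred_eq, abs_le, mem_Icc]
      constructor <;> rintro ⟨h1, h2⟩ <;> constructor <;> linarith
    have e2 : {y : ℝ | |y - μ| < r} = Ioo (μ - r) (μ + r) := by
      ext y
      simp only [mem_ofPred_eq, abs_lt, mem_Ioo]
      constructor <;> rintro ⟨h1, h2⟩ <;> constructor <;> linarith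
    rw [e1, e2]
    exact measureReal_congr Ioo_ae_eq_Icc.symm
  rw [h1, probReal_compl_eq_one_sub hm, h2]

lemma median_eq_zero (h : IsSymmLaw ν p m₀) : median ν = 0 :=
  median_eq_zero_of_symm h.symm

lemma measurable_abs_sub (μ : ℝ) : Measurable fun y : ℝ => |y - μ| := by fun_prop

lemma real_map_abs_Iio (ρ : Measure ℝ) (μ r : ℝ) :
    (ρ.map fun y => |y - μ|).real (Iio r) = ρ.real {y | |y - μ| < r} :=
  map_measureReal_apply (measurable_abs_sub μ) measurableSet_Iio

lemma real_map_abs_Ioi (ρ : Measure ℝ) (μ r : ℝ) :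
    (ρ.map fun y => |y - μ|).real (Ioi r) = ρ.real {y | r < |y - μ|} :=
  map_measureReal_apply (measurable_abs_sub μ) measurableSet_Ioi

lemma continuous_cdf (h : IsSymmLaw ν p m₀) : Continuous fun y => ν.real (Iic y) :=
  continuous_iff_continuousAt.2 fun y => (h.hasDerivAt_cdf y).continuousAt

lemma real_abs_lt (h : IsSymmLaw ν p m₀) {r : ℝ} (hr : 0 ≤ r) :
    ν.real {y | |y - 0| < r} = 2 * ν.real (Iic r) - 1 := by
  rw [h.real_abs_sub_lt 0 hr]
  simp only [add_zero, sub_zero, add_sub_cancel]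
  ring

/-- Without an atom at 0, a small interval around 0 carries mass below 1/2. -/
lemma mad_pos (h : IsSymmLaw ν p m₀) : 0 < m₀ := by
  have := h.prob
  have : IsProbabilityMeasure (ν.map fun y => |y - 0|) :=
    Measure.isProbabilityMeasure_map (measurable_abs_sub 0).aemeasurable
  have hc : ∀ᶠ r in 𝓝[>] (0 : ℝ), ν.real (Iic r) < 3 / 4 :=
    (h.continuous_cdf.tendsto 0).mono_left nhdsWithin_le_nhds |>.eventually
      (gt_mem_nhds (by rw [h.cdf_zero]; norm_num))
  obtain ⟨r, hr, hr0⟩ := (hc.and self_mem_nhdsWithin).exists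
  have hr0 : 0 < r := hr0
  have h1 : r ≤ median (ν.map fun y => |y - 0|) := by
    refine le_median ?_
    rw [real_map_abs_Iio, h.real_abs_lt hr0.le]
    linarith
  rw [← h.mad_eq, mad, h.median_eq_zero]
  linarith

/-- If the value differed from 3/4, continuity would move the inequality to a point on the other
side of `m₀`, where it would bound the median of |Y| away from `m₀`. -/
lemma cdf_mad (h : IsSymmLaw ν p m₀) : ν.real (Iic m₀) = 3 / 4 := by
  have := h.prob
  have : IsProbabilityMeasure (ν.map fun y => |y - 0|) :=
    Measure.isProbabilityMeasure_map (measurable_abs_sub 0).aemeasurable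
  have hm := h.mad_pos
  have hmad : median (ν.map fun y => |y - 0|) = m₀ := by
    rw [← h.mad_eq, mad, h.median_eq_zero]
  apply le_antisymm
  · by_contra! hlt
    have hc : ∀ᶠ r in 𝓝[<] m₀, 3 / 4 < ν.real (Iic r) :=
      (h.continuous_cdf.tendsto m₀).mono_left nhdsWithin_le_nhds |>.eventually (lt_mem_nhds hlt)
    obtain ⟨r, ⟨hr, hr0⟩, hr1⟩ := ((hc.and (nhdsWithin_le_nhds (lt_mem_nhds hm))).and
      self_mem_nhdsWithin).exists
    have hr1 : r < m₀ := hr1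
    have h1 : median (ν.map fun y => |y - 0|) ≤ r := by
      refine median_le ?_
      rw [real_map_abs_Ioi, h.real_lt_abs_sub, h.real_abs_lt hr0.le]
      linarith
    linarith
  · by_contra! hlt
    have hc : ∀ᶠ r in 𝓝[>] m₀, ν.real (Iic r) < 3 / 4 :=
      (h.continuous_cdf.tendsto m₀).mono_left nhdsWithin_le_nhds |>.eventually (gt_mem_nhds hlt)
    obtain ⟨r, hr, hr1⟩ := (hc.and self_mem_nhdsWithin).exists
    have hr1 : m₀ < r := hr1
    have h1 : r ≤ median (ν.map fun y => |y - 0|) := by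
      refine le_median ?_
      rw [real_map_abs_Iio, h.real_abs_lt (hm.trans hr1).le]
      linarith
    linarith

/-- The increments ερ + μ and ερ - μ add up to 2ερ, so an O(ε) error of the centre cancels to first
order. This is why the shift of the median does not influence that of the MAD. -/
lemma real_abs_sub_lt_expansion (h : IsSymmLaw ν p m₀) (ρ C : ℝ) {η : ℝ} (hη : 0 < η) :
    ∀ᶠ ε in 𝓝[>] (0 : ℝ), ∀ μ, |μ| ≤ C * ε →
      |ν.real {y | |y - μ| < m₀ + ε * ρ} - (1 / 2 + 2 * p m₀ * ρ * ε)| ≤ η * ε := by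
  have hm := h.mad_pos
  set K := |ρ| + |C| + 1
  have hK : 0 < K := by positivity
  have hd := (hasDerivAt_iff_isLittleO_nhds_zero.1 (h.hasDerivAt_cdf m₀)).def
    (by positivity : 0 < η / (2 * K))
  obtain ⟨δ, hδ, hd⟩ := Metric.eventually_nhds_iff.1 hd
  have e1 : ∀ᶠ ε in 𝓝[>] (0 : ℝ), ε < δ / K :=
    nhdsWithin_le_nhds (gt_mem_nhds (by positivity))
  have e2 : ∀ᶠ ε in 𝓝[>] (0 : ℝ), ε < m₀ / K :=
    nhdsWithin_le_nhds (gt_mem_nhds (by positivity))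
  filter_upwards [e1, e2, self_mem_nhdsWithin] with ε h1 h2 h3 μ hμ
  have h3 : 0 < ε := h3
  rw [lt_div_iff₀ hK] at h1 h2
  have hCK : |ε * ρ| + |μ| ≤ ε * K := by
    rw [abs_mul, abs_of_pos h3]
    have := mul_le_mul_of_nonneg_right (le_abs_self C) h3.le
    simp only [K]; linarith
  have hr : 0 ≤ m₀ + ε * ρ := by
    have := neg_abs_le (ε * ρ)
    have := abs_nonneg μ
    linarith
  rw [h.real_abs_sub_lt μ hr]
  have b1 : |m₀ + ε * ρ + μ - m₀| ≤ ε * K := by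
    rw [show m₀ + ε * ρ + μ - m₀ = ε * ρ + μ by ring]
    exact (abs_add_le _ _).trans hCK
  have b2 : |m₀ + ε * ρ - μ - m₀| ≤ ε * K := by
    rw [show m₀ + ε * ρ - μ - m₀ = ε * ρ - μ by ring]
    exact (abs_sub _ _).trans hCK
  have d1 := hd (y := m₀ + ε * ρ + μ - m₀) (by rw [dist_zero_right, Real.norm_eq_abs]; linarith)
  have d2 := hd (y := m₀ + ε * ρ - μ - m₀) (by rw [dist_zero_right, Real.norm_eq_abs]; linarith)
  simp only [Real.norm_eq_abs, smul_eq_mul, h.cdf_mad] at d1 d2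
  have q : ∀ {a}, a ≤ ε * K → η / (2 * K) * a ≤ η * ε / 2 := by
    intro a ha
    calc η / (2 * K) * a ≤ η / (2 * K) * (ε * K) := by gcongr
      _ = η * ε / 2 := by field_simp
  have d1' := abs_le.1 (d1.trans (q b1))
  have d2' := abs_le.1 (d2.trans (q b2))
  rw [abs_le]
  constructor <;> nlinarith [d1'.1, d1'.2, d2'.1, d2'.2]

end IsSymmLaw

lemma eventually_lt_of_deriv_neg {f : ℝ → ℝ} {f' : ℝ} (hf : HasDerivAt f f' 0) (h : f' < 0) :
    ∀ᶠ ε in 𝓝[>] (0 : ℝ), f ε < f 0 := by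
  have h1 := (hasDerivAt_iff_tendsto_slope.1 hf).mono_left
    (nhdsWithin_mono 0 fun y (hy : 0 < y) => hy.ne')
  filter_upwards [h1.eventually (gt_mem_nhds h), self_mem_nhdsWithin] with ε h2 h3
  have h3 : 0 < ε := h3
  rw [slope_def_field, sub_zero, div_neg_iff] at h2
  rcases h2 with h2 | h2 <;> linarith [h2.1, h2.2]

/-- The contaminated law `(1 - ε) ν + ε δ_t` on the line. -/
def contaminateLine (ν : Measure ℝ) (ε t : ℝ) : Measure ℝ :=
  ENNReal.ofReal (1 - ε) • ν + ENNReal.ofReal ε • Measure.dirac t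

section contaminateLine

variable {ν : Measure ℝ} [IsProbabilityMeasure ν] {ε : ℝ}

lemma isProbabilityMeasure_contaminateLine (h0 : 0 ≤ ε) (h1 : ε ≤ 1) (t : ℝ) :
    IsProbabilityMeasure (contaminateLine ν ε t) := by
  refine ⟨?_⟩
  simp [contaminateLine, ← ENNReal.ofReal_add (sub_nonneg.2 h1) h0]

lemma real_contaminateLine (h0 : 0 ≤ ε) (h1 : ε ≤ 1) (t : ℝ) {S : Set ℝ}
    (hS : MeasurableSet S) :
    (contaminateLine ν ε t).real S = (1 - ε) * ν.real S + ε * S.indicator 1 t := by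
  have hfin : ∀ (c : ℝ) (μ : Measure ℝ) [IsProbabilityMeasure μ], (ENNReal.ofReal c • μ) S ≠ ⊤ :=
    fun c μ _ => ENNReal.mul_ne_top ENNReal.ofReal_ne_top (measure_ne_top μ S)
  rw [contaminateLine, measureReal_add_apply (hfin _ _) (hfin _ _), measureReal_ennreal_smul_apply, measureReal_ennreal_smul_apply,
    ENNReal.toReal_ofReal h0, ENNReal.toReal_ofReal (sub_nonneg.2 h1), measureReal_def (Measure.dirac t),
    Measure.dirac_apply' _ hS]
  congr 2
  by_cases ht : t ∈ S <;> simp [ht]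

omit [IsProbabilityMeasure ν] in
lemma map_neg_contaminateLine (hν : ν.map (fun y => -y) = ν) (ε t : ℝ) :
    (contaminateLine ν ε t).map (fun y => -y) = contaminateLine ν ε (-t) := by
  have hm : Measurable fun y : ℝ => -y := measurable_neg
  rw [contaminateLine, Measure.map_add _ _ hm, Measure.map_smul, Measure.map_smul, hν,
    Measure.map_dirac' hm, contaminateLine]

omit [IsProbabilityMeasure ν] in
lemma median_contaminateLine_neg (hν : ν.map (fun y => -y) = ν) (ε t : ℝ) :
    median (contaminateLine ν ε (-t)) = -median (contaminateLine ν ε t) := by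
  rw [← map_neg_contaminateLine hν, median_map_neg]

end contaminateLine

namespace IsSymmLaw

variable {ν : Measure ℝ} {p : ℝ → ℝ} {m₀ : ℝ}

/-- The left side equals 1/2 at ε = 0 and has derivative p(0)a + κ - 1/2 there. The number `κ`
stands for the share of the contaminating atom that is counted. -/
lemma eventually_cdf_lt (h : IsSymmLaw ν p m₀) {a κ : ℝ} (hκ : p 0 * a + κ < 1 / 2) :
    ∀ᶠ ε in 𝓝[>] (0 : ℝ), (1 - ε) * ν.real (Iic (ε * a)) + ε * κ < 1 / 2 := by
  have hd : HasDerivAt (fun ε : ℝ => ν.real (Iic (ε * a))) (p 0 * a) 0 := by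
    have h1 : HasDerivAt (fun ε : ℝ => ε * a) a 0 := by
      simpa using (hasDerivAt_id (0 : ℝ)).mul_const a
    have h2 := h.hasDerivAt_cdf ((0 : ℝ) * a)
    rw [zero_mul] at h2
    have h3 := HasDerivAt.comp (0 : ℝ) (h₂ := fun y => ν.real (Iic y)) (by simpa using h2) h1
    exact h3
  have hf : HasDerivAt (fun ε : ℝ => (1 - ε) * ν.real (Iic (ε * a)) + ε * κ)
      (-1 * ν.real (Iic (0 * a)) + (1 - 0) * (p 0 * a) + 1 * κ) 0 :=
    (((hasDerivAt_id (0 : ℝ)).const_sub 1).mul hd).add ((hasDerivAt_id (0 : ℝ)).mul_const κ)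
  have := eventually_lt_of_deriv_neg hf (by rw [zero_mul, h.cdf_zero]; linarith)
  simpa [h.cdf_zero] using this

/-- The atom enters only through an indicator, which is at most 1 always and is 0 once t lies to the
right of the threshold. These two cases, κ = 1 and κ = 0, make the estimates uniform in t. -/
lemma median_lower (h : IsSymmLaw ν p m₀) {η δ : ℝ} (hη : 0 < η) (hδ : 0 < δ) :
    ∀ᶠ ε in 𝓝[>] (0 : ℝ), ∀ t, -(ε * (1 / (2 * p 0) + η)) ≤ median (contaminateLine ν ε t) ∧
      (δ ≤ t → ε * (1 / (2 * p 0) - η) ≤ median (contaminateLine ν ε t)) := by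
  have := h.prob
  have hp := h.pos_zero
  have hpη := mul_pos hp hη
  have ha : p 0 * (1 / (2 * p 0)) = 1 / 2 := by field_simp
  -- In both choices p(0)a + κ equals 1/2 - p(0)η.
  have e1 := h.eventually_cdf_lt (a := -(1 / (2 * p 0) + η)) (κ := 1) (by nlinarith)
  have e2 := h.eventually_cdf_lt (a := 1 / (2 * p 0) - η) (κ := 0) (by nlinarith)
  have e3 : ∀ᶠ ε in 𝓝[>] (0 : ℝ), ε * (1 / (2 * p 0) - η) < δ := by
    have hc : Continuous fun ε : ℝ => ε * (1 / (2 * p 0) - η) := by fun_prop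
    exact nhdsWithin_le_nhds ((hc.tendsto 0).eventually (gt_mem_nhds (by simpa using hδ)))
  have e4 : ∀ᶠ ε in 𝓝[>] (0 : ℝ), ε < 1 := nhdsWithin_le_nhds (gt_mem_nhds one_pos)
  filter_upwards [e1, e2, e3, e4, self_mem_nhdsWithin] with ε h1 h2 h3 h4 h5 t
  have h5 : 0 < ε := h5
  have := isProbabilityMeasure_contaminateLine (ν := ν) h5.le h4.le t
  constructor
  · refine le_median ?_
    rw [real_contaminateLine h5.le h4.le t measurableSet_Iio, h.real_Iio,
      show -(ε * (1 / (2 * p 0) + η)) = ε * -(1 / (2 * p 0) + η) by ring]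
    refine lt_of_le_of_lt ?_ h1
    gcongr
    exact indicator_le_self' (fun _ _ => zero_le_one) t
  · intro ht
    refine le_median ?_
    rw [real_contaminateLine h5.le h4.le t measurableSet_Iio, h.real_Iio,
      indicator_of_notMem (by simp only [mem_Iio]; linarith)]
    exact h2

/-- The upper bounds are the lower bounds for the reflected atom -t. -/
lemma median_bounds (h : IsSymmLaw ν p m₀) {η δ : ℝ} (hη : 0 < η) (hδ : 0 < δ) :
    ∀ᶠ ε in 𝓝[>] (0 : ℝ), ∀ t, |median (contaminateLine ν ε t)| ≤ ε * (1 / (2 * p 0) + η) ∧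
      (δ ≤ t → ε * (1 / (2 * p 0) - η) ≤ median (contaminateLine ν ε t)) ∧
      (t ≤ -δ → median (contaminateLine ν ε t) ≤ -(ε * (1 / (2 * p 0) - η))) := by
  filter_upwards [h.median_lower hη hδ] with ε hε t
  have h1 := hε t
  have h2 := hε (-t)
  rw [median_contaminateLine_neg h.symm] at h2
  refine ⟨abs_le.2 ⟨h1.1, by linarith [h2.1]⟩, h1.2, fun ht => ?_⟩
  linarith [h2.2 (by linarith)]

lemma eventually_line_lt {a b : ℝ} (hab : a + b < 1 / 2) :
    ∀ᶠ ε in 𝓝[>] (0 : ℝ), (1 - ε) * (1 / 2 + ε * a) + ε * b < 1 / 2 := by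
  have hf : HasDerivAt (fun ε : ℝ => (1 - ε) * (1 / 2 + ε * a) + ε * b)
      (-1 * (1 / 2 + 0 * a) + (1 - 0) * (1 * a) + 1 * b) 0 :=
    (((hasDerivAt_id (0 : ℝ)).const_sub 1).mul
      (((hasDerivAt_id (0 : ℝ)).mul_const a).const_add (1 / 2))).add
      ((hasDerivAt_id (0 : ℝ)).mul_const b)
  have := eventually_lt_of_deriv_neg hf (by linarith)
  filter_upwards [this] with ε hε
  simpa using hε

lemma mad_lower (h : IsSymmLaw ν p m₀) {ρ κ : ℝ} (hρ : 2 * p m₀ * ρ + κ < 1 / 2) :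
    ∀ᶠ ε in 𝓝[>] (0 : ℝ), ∀ t,
      {y | |y - median (contaminateLine ν ε t)| < m₀ + ε * ρ}.indicator 1 t ≤ κ →
        ε * ρ ≤ mad (contaminateLine ν ε t) - m₀ := by
  have := h.prob
  -- Half of the slack pays for the expansion error; the other half keeps the final inequality
  -- strict.
  set η := (1 / 2 - (2 * p m₀ * ρ + κ)) / 2 with hη
  have hη0 : 0 < η := by rw [hη]; linarith
  have e1 := h.real_abs_sub_lt_expansion ρ (1 / (2 * p 0) + 1) hη0
  have e2 := h.median_bounds one_pos one_pos
  have e3 := eventually_line_lt (a := 2 * p m₀ * ρ + η) (b := κ) (by rw [hη]; linarith)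
  have e4 : ∀ᶠ ε in 𝓝[>] (0 : ℝ), ε < 1 := nhdsWithin_le_nhds (gt_mem_nhds one_pos)
  filter_upwards [e1, e2, e3, e4, self_mem_nhdsWithin] with ε h1 h2 h3 h4 h5 t ht
  have h5 : 0 < ε := h5
  have := isProbabilityMeasure_contaminateLine (ν := ν) h5.le h4.le t
  have := Measure.isProbabilityMeasure_map (μ := contaminateLine ν ε t)
    (measurable_abs_sub (median (contaminateLine ν ε t))).aemeasurable
  have hx := (abs_le.1 (h1 _ (by rw [mul_comm]; exact (h2 t).1))).2
  rw [le_sub_iff_add_le']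
  refine le_median ?_
  rw [real_map_abs_Iio, real_contaminateLine h5.le h4.le t
    (measurableSet_lt (measurable_abs_sub _) measurable_const)]
  refine lt_of_le_of_lt ?_ h3
  have h6 : 0 ≤ 1 - ε := by linarith
  gcongr
  linarith

lemma mad_upper (h : IsSymmLaw ν p m₀) {ρ κ : ℝ} (hρ : -(2 * p m₀ * ρ) + κ < 1 / 2) :
    ∀ᶠ ε in 𝓝[>] (0 : ℝ), ∀ t,
      {y | m₀ + ε * ρ < |y - median (contaminateLine ν ε t)|}.indicator 1 t ≤ κ →
        mad (contaminateLine ν ε t) - m₀ ≤ ε * ρ := by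
  have := h.prob
  set η := (1 / 2 - (-(2 * p m₀ * ρ) + κ)) / 2 with hη
  have hη0 : 0 < η := by rw [hη]; linarith
  have e1 := h.real_abs_sub_lt_expansion ρ (1 / (2 * p 0) + 1) hη0
  have e2 := h.median_bounds one_pos one_pos
  have e3 := eventually_line_lt (a := -(2 * p m₀ * ρ) + η) (b := κ) (by rw [hη]; linarith)
  have e4 : ∀ᶠ ε in 𝓝[>] (0 : ℝ), ε < 1 := nhdsWithin_le_nhds (gt_mem_nhds one_pos)
  filter_upwards [e1, e2, e3, e4, self_mem_nhdsWithin] with ε h1 h2 h3 h4 h5 t ht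
  have h5 : 0 < ε := h5
  have := isProbabilityMeasure_contaminateLine (ν := ν) h5.le h4.le t
  have := Measure.isProbabilityMeasure_map (μ := contaminateLine ν ε t)
    (measurable_abs_sub (median (contaminateLine ν ε t))).aemeasurable
  have hx := (abs_le.1 (h1 _ (by rw [mul_comm]; exact (h2 t).1))).1
  rw [sub_le_iff_le_add']
  refine median_le ?_
  rw [real_map_abs_Ioi, real_contaminateLine h5.le h4.le t
    (measurableSet_lt measurable_const (measurable_abs_sub _)), h.real_lt_abs_sub]
  refine lt_of_le_of_lt ?_ h3
  have h6 : 0 ≤ 1 - ε := by linarith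
  gcongr
  linarith

/-- Same scheme as for the median: κ = 1 gives the bounds valid for every t, κ = 0 the sharp ones
when the atom is clearly outside or clearly inside the ball of radius `m₀`. -/
lemma mad_bounds (h : IsSymmLaw ν p m₀) {η δ : ℝ} (hη : 0 < η) (hδ : 0 < δ) :
    ∀ᶠ ε in 𝓝[>] (0 : ℝ), ∀ t, |mad (contaminateLine ν ε t) - m₀| ≤ ε * (1 / (4 * p m₀) + η) ∧
      (m₀ + δ ≤ |t| → ε * (1 / (4 * p m₀) - η) ≤ mad (contaminateLine ν ε t) - m₀) ∧
      (|t| ≤ m₀ - δ → mad (contaminateLine ν ε t) - m₀ ≤ -(ε * (1 / (4 * p m₀) - η))) := by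
  have hp := h.pos_mad
  have hpη := mul_pos hp hη
  set β := 1 / (4 * p m₀) with hβ
  have ha : p m₀ * β = 1 / 4 := by rw [hβ]; field_simp
  have e1 := h.mad_lower (ρ := -(β + η)) (κ := 1) (by nlinarith)
  have e2 := h.mad_upper (ρ := β + η) (κ := 1) (by nlinarith)
  have e3 := h.mad_lower (ρ := β - η) (κ := 0) (by nlinarith)
  have e4 := h.mad_upper (ρ := -(β - η)) (κ := 0) (by nlinarith)
  have e5 := h.median_bounds one_pos one_pos
  -- The shift of the centre plus the change of the radius stays below δ, so the atom does not
  -- change sides.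
  have e6 : ∀ᶠ ε in 𝓝[>] (0 : ℝ), ε * (1 / (2 * p 0) + 1) + ε * |β - η| < δ := by
    have hc : Continuous fun ε : ℝ => ε * (1 / (2 * p 0) + 1) + ε * |β - η| := by fun_prop
    exact nhdsWithin_le_nhds ((hc.tendsto 0).eventually (gt_mem_nhds (by simpa using hδ)))
  filter_upwards [e1, e2, e3, e4, e5, e6, self_mem_nhdsWithin] with ε h1 h2 h3 h4 h5 h6 h7 t
  have h7 : 0 < ε := h7
  set μ := median (contaminateLine ν ε t) with hμ
  have hμb := (h5 t).1
  have k1 := mul_le_mul_of_nonneg_left (le_abs_self (β - η)) h7.le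
  refine ⟨abs_le.2 ⟨?_, ?_⟩, fun ht => ?_, fun ht => ?_⟩
  · have := h1 t (indicator_le_self' (fun _ _ => zero_le_one) t)
    linarith
  · exact h2 t (indicator_le_self' (fun _ _ => zero_le_one) t)
  · refine h3 t (le_of_eq (indicator_of_notMem ?_ _))
    have := abs_sub_abs_le_abs_sub t μ
    simp only [mem_ofPred_eq, not_lt, ← hμ]
    linarith
  · have := h4 t (le_of_eq (indicator_of_notMem ?_ _))
    · linarith
    · have := abs_sub t μ
      simp only [mem_ofPred_eq, not_lt, ← hμ]
      linarith

lemma exists_uniform_bound (h : IsSymmLaw ν p m₀) :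
    ∃ C, 0 < C ∧ ∀ᶠ ε in 𝓝[>] (0 : ℝ), ∀ t, |median (contaminateLine ν ε t)| ≤ C * ε ∧
      |mad (contaminateLine ν ε t) - m₀| ≤ C * ε := by
  have h0 := h.pos_zero
  have hp := h.pos_mad
  refine ⟨1 / (2 * p 0) + 1 + (1 / (4 * p m₀) + 1), by positivity, ?_⟩
  filter_upwards [h.median_bounds one_pos one_pos, h.mad_bounds one_pos one_pos,
    self_mem_nhdsWithin] with ε h1 h2 h3 t
  have h3 : 0 < ε := h3
  have k1 : 0 < ε * (1 / (2 * p 0) + 1) := by positivity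
  have k2 : 0 < ε * (1 / (4 * p m₀) + 1) := by positivity
  constructor
  · linarith [(h1 t).1]
  · linarith [(h2 t).1]

lemma tendsto_of_eventually_bounds {f : ℝ × ℝ → ℝ} {L : ℝ} {l : Filter (ℝ × ℝ)}
    (hl : ∀ᶠ q in l, 0 < q.1)
    (hf : ∀ η : ℝ, 0 < η → ∀ᶠ q in l, q.1 * (L - η) ≤ f q ∧ f q ≤ q.1 * (L + η)) :
    Tendsto (fun q => f q / q.1) l (𝓝 L) := by
  rw [Metric.tendsto_nhds]
  intro η hη
  filter_upwards [hl, hf (η / 2) (half_pos hη)] with q h1 h2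
  rw [Real.dist_eq, abs_lt]
  have := (le_div_iff₀' h1).2 h2.1
  have := (div_le_iff₀' h1).2 h2.2
  constructor <;> linarith

lemma eventually_prod_pos (l : Filter ℝ) : ∀ᶠ q in 𝓝[>] (0 : ℝ) ×ˢ l, 0 < q.1 :=
  tendsto_fst.eventually (self_mem_nhdsWithin (a := (0 : ℝ)) (s := Ioi 0))

/-- The limit is joint in ε and t because the outlyingness compares all directions near the
maximizing one, and t = u'x varies with them. -/
lemma tendsto_median (h : IsSymmLaw ν p m₀) {t₀ : ℝ} (ht₀ : t₀ ≠ 0) :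
    Tendsto (fun q : ℝ × ℝ => median (contaminateLine ν q.1 q.2) / q.1) (𝓝[>] 0 ×ˢ 𝓝 t₀)
      (𝓝 (1 / (2 * p 0) * Real.sign t₀)) := by
  refine tendsto_of_eventually_bounds (eventually_prod_pos _) fun η hη => ?_
  rcases ht₀.lt_or_gt with ht | ht
  · rw [Real.sign_of_neg ht]
    filter_upwards [(h.median_bounds hη (δ := -(t₀ / 2)) (by linarith)).prod_mk
      (gt_mem_nhds (show t₀ < t₀ / 2 by linarith))] with q hq
    have h1 := hq.1 q.2
    have h2 := abs_le.1 h1.1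
    have h3 := h1.2.2 (by linarith [hq.2])
    constructor <;> linarith [h2.1]
  · rw [Real.sign_of_pos ht]
    filter_upwards [(h.median_bounds hη (δ := t₀ / 2) (by linarith)).prod_mk
      (lt_mem_nhds (show t₀ / 2 < t₀ by linarith))] with q hq
    have h1 := hq.1 q.2
    have h2 := abs_le.1 h1.1
    have h3 := h1.2.1 (by linarith [hq.2])
    constructor <;> linarith [h2.2]

lemma median_contaminateLine_zero (h : IsSymmLaw ν p m₀) (ε : ℝ) :
    median (contaminateLine ν ε 0) = 0 := by
  refine median_eq_zero_of_symm ?_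
  rw [map_neg_contaminateLine h.symm, neg_zero]

lemma tendsto_mad (h : IsSymmLaw ν p m₀) {t₀ : ℝ} (ht₀ : |t₀| ≠ m₀) :
    Tendsto (fun q : ℝ × ℝ => (mad (contaminateLine ν q.1 q.2) - m₀) / q.1) (𝓝[>] 0 ×ˢ 𝓝 t₀)
      (𝓝 (1 / (4 * p m₀) * Real.sign (|t₀| - m₀))) := by
  refine tendsto_of_eventually_bounds (eventually_prod_pos _) fun η hη => ?_
  rcases ht₀.lt_or_gt with ht | ht
  · rw [Real.sign_of_neg (by linarith)]
    filter_upwards [(h.mad_bounds hη (δ := (m₀ - |t₀|) / 2) (by linarith)).prod_mk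
      (continuous_abs.tendsto t₀ (gt_mem_nhds (show |t₀| < (m₀ + |t₀|) / 2 by linarith)))] with q hq
    have h1 := hq.1 q.2
    have h2 := abs_le.1 h1.1
    have h3 : |q.2| < (m₀ + |t₀|) / 2 := hq.2
    have h3 := h1.2.2 (by linarith)
    constructor <;> linarith [h2.1]
  · rw [Real.sign_of_pos (by linarith)]
    filter_upwards [(h.mad_bounds hη (δ := (|t₀| - m₀) / 2) (by linarith)).prod_mk
      (continuous_abs.tendsto t₀ (lt_mem_nhds (show (m₀ + |t₀|) / 2 < |t₀| by linarith)))] with q hq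
    have h1 := hq.1 q.2
    have h2 := abs_le.1 h1.1
    have h3 : (m₀ + |t₀|) / 2 < |q.2| := hq.2
    have h3 := h1.2.1 (by linarith)
    constructor <;> linarith [h2.2]

end IsSymmLaw

end OneDimensional

/-! ### First order behaviour of the outlyingness under contamination -/

section Outlyingness

variable {d : ℕ}

lemma ciSup_le_ciSup_add {ι : Type*} [Nonempty ι] {f g : ι → ℝ} {c : ℝ}
    (hg : BddAbove (range g)) (h : ∀ i, f i ≤ g i + c) : ⨆ i, f i ≤ (⨆ i, g i) + c :=
  ciSup_le fun i => (h i).trans (by gcongr; exact le_ciSup hg i)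

lemma abs_ciSup_sub_ciSup_le {ι : Type*} [Nonempty ι] {f g : ι → ℝ} {c : ℝ}
    (hf : BddAbove (range f)) (hg : BddAbove (range g)) (h : ∀ i, |f i - g i| ≤ c) :
    |(⨆ i, f i) - ⨆ i, g i| ≤ c := by
  rw [abs_le]
  have h1 := ciSup_le_ciSup_add (f := f) (c := c) hg fun i => by linarith [(abs_le.1 (h i)).2]
  have h2 := ciSup_le_ciSup_add (f := g) (c := c) hf fun i => by linarith [(abs_le.1 (h i)).1]
  constructor <;> linarith

instance nonempty_sphere [NeZero d] : Nonempty (Metric.sphere (0 : E d) 1) :=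
  (NormedSpace.sphere_nonempty.2 zero_le_one).to_subtype

lemma norm_coe_sphere (u : Metric.sphere (0 : E d) 1) : ‖(u : E d)‖ = 1 :=
  mem_sphere_zero_iff_norm.1 u.2

lemma abs_inner_sphere_le (u : Metric.sphere (0 : E d) 1) (y : E d) :
    |inner ℝ (u : E d) y| ≤ ‖y‖ := by
  simpa [norm_coe_sphere u] using abs_real_inner_le_norm (u : E d) y

lemma bddAbove_inner (y : E d) (m : ℝ) :
    BddAbove (range fun u : Metric.sphere (0 : E d) 1 => inner ℝ (u : E d) y / m) := by
  refine ⟨‖y‖ / |m|, ?_⟩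
  rintro _ ⟨u, rfl⟩
  refine (le_abs_self _).trans ?_
  simp only [abs_div]
  gcongr
  exact abs_inner_sphere_le u y

/-- The direction of a non-zero vector, as a point of the sphere. -/
def direction (y : E d) (hy : y ≠ 0) : Metric.sphere (0 : E d) 1 :=
  ⟨‖y‖⁻¹ • y, by
    rw [mem_sphere_zero_iff_norm, norm_smul, norm_inv, norm_norm,
      inv_mul_cancel₀ (norm_ne_zero_iff.2 hy)]⟩

lemma inner_direction (y : E d) (hy : y ≠ 0) (x : E d) :
    inner ℝ (direction y hy : E d) x = inner ℝ y x / ‖y‖ := by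
  rw [direction, inner_smul_left]
  simp only [conj_trivial]
  ring

lemma inner_direction_self (y : E d) (hy : y ≠ 0) :
    inner ℝ (direction y hy : E d) y = ‖y‖ := by
  have := norm_ne_zero_iff.2 hy
  rw [inner_direction, real_inner_self_eq_norm_sq]
  field_simp

lemma iSup_inner_div [NeZero d] (y : E d) {m : ℝ} (hm : 0 < m) :
    ⨆ u : Metric.sphere (0 : E d) 1, inner ℝ (u : E d) y / m = ‖y‖ / m := by
  apply le_antisymm
  · refine ciSup_le fun u => ?_
    gcongr
    exact (le_abs_self _).trans (abs_inner_sphere_le u y)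
  · rcases eq_or_ne y 0 with rfl | hy
    · simp
    · have := le_ciSup (bddAbove_inner y m) (direction y hy)
      simpa only [inner_direction_self] using this

/-- First order expansion of the supremum of the perturbed ratios. -/
lemma tendsto_iSup_ratio [NeZero d] {m s : ℝ → Metric.sphere (0 : E d) 1 → ℝ} {m₀ C : ℝ}
    (hm₀ : 0 < m₀) (hs : ∀ᶠ ε in 𝓝[>] (0 : ℝ), ∀ u, 0 < s ε u) {y : E d} (hy : y ≠ 0)
    (hb : ∀ᶠ ε in 𝓝[>] (0 : ℝ), ∀ u : Metric.sphere (0 : E d) 1,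
      |(inner ℝ (u : E d) y - m ε u) / s ε u - inner ℝ (u : E d) y / m₀| ≤ C * ε)
    {a b : ℝ}
    (ha : Tendsto (fun q : ℝ × Metric.sphere (0 : E d) 1 => m q.1 q.2 / q.1)
      (𝓝[>] 0 ×ˢ 𝓝 (direction y hy)) (𝓝 a))
    (hb' : Tendsto (fun q : ℝ × Metric.sphere (0 : E d) 1 => (s q.1 q.2 - m₀) / q.1)
      (𝓝[>] 0 ×ˢ 𝓝 (direction y hy)) (𝓝 b)) :
    Tendsto (fun ε => ((⨆ u : Metric.sphere (0 : E d) 1, (inner ℝ (u : E d) y - m ε u) / s ε u) -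
      ‖y‖ / m₀) / ε) (𝓝[>] 0) (𝓝 (-a / m₀ - ‖y‖ * b / m₀ ^ 2)) := by
  set l : Filter (ℝ × Metric.sphere (0 : E d) 1) := 𝓝[>] 0 ×ˢ 𝓝 (direction y hy) with hl
  set L := -a / m₀ - ‖y‖ * b / m₀ ^ 2 with hL
  have hpos : ∀ᶠ q in l, 0 < q.1 :=
    tendsto_fst.eventually (self_mem_nhdsWithin (a := (0 : ℝ)) (s := Ioi 0))
  have hfst : Tendsto (fun q : ℝ × Metric.sphere (0 : E d) 1 => q.1) l (𝓝 0) :=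
    tendsto_fst.mono_right nhdsWithin_le_nhds
  have hslim : Tendsto (fun q : ℝ × Metric.sphere (0 : E d) 1 => s q.1 q.2) l (𝓝 m₀) := by
    have h1 := (hb'.mul hfst).add_const m₀
    rw [mul_zero, zero_add] at h1
    refine h1.congr' ?_
    filter_upwards [hpos] with q hq
    field_simp
    ring
  have hspos : ∀ᶠ q in l, 0 < s q.1 q.2 :=
    (tendsto_fst.eventually hs).mono fun q hq => hq q.2
  -- Replacing u'y by its maximum ‖y‖ gives an upper bound for the ratio that is exact at the
  -- direction of y and has a joint limit there.
  have hQ : Tendsto (fun q : ℝ × Metric.sphere (0 : E d) 1 =>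
      ((‖y‖ - m q.1 q.2) / s q.1 q.2 - ‖y‖ / m₀) / q.1) l (𝓝 L) := by
    have h1 : Tendsto (fun q : ℝ × Metric.sphere (0 : E d) 1 =>
        (-(m q.1 q.2 / q.1) * m₀ - ‖y‖ * ((s q.1 q.2 - m₀) / q.1)) / (s q.1 q.2 * m₀)) l (𝓝 L) := by
      have := ((ha.neg.mul_const m₀).sub (hb'.const_mul ‖y‖)).div (hslim.mul_const m₀)
        (by positivity)
      have hval : (-a * m₀ - ‖y‖ * b) / (m₀ * m₀) = L := by
        rw [hL]
        field_simp
      rw [hval] at this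
      exact this
    refine h1.congr' ?_
    filter_upwards [hpos, hspos] with q h1 h2
    field_simp
    ring
  have hdir : Tendsto (fun ε : ℝ => (ε, direction y hy)) (𝓝[>] 0) l :=
    tendsto_id.prodMk tendsto_const_nhds
  have hD := hQ.comp hdir
  rw [Metric.tendsto_nhds] at hD hQ ⊢
  intro η hη
  obtain ⟨P, hP, V, hV, hPV⟩ := eventually_prod_iff.1 (hQ (η / 2) (half_pos hη))
  obtain ⟨r, hr, hrV⟩ := Metric.eventually_nhds_iff.1 hV
  have hny : 0 < ‖y‖ := norm_pos_iff.2 hy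
  -- `u'y` stays below `‖y‖` away from the maximizing direction
  have hfar : ∀ u : Metric.sphere (0 : E d) 1, r ≤ dist u (direction y hy) →
      inner ℝ (u : E d) y ≤ ‖y‖ - ‖y‖ * r ^ 2 / 2 := by
    intro u hu
    have h1 : r ^ 2 ≤ ‖(u : E d) - direction y hy‖ ^ 2 := by
      rw [← dist_eq_norm]
      exact pow_le_pow_left₀ hr.le hu 2
    rw [norm_sub_sq_real, norm_coe_sphere, norm_coe_sphere, real_inner_comm, inner_direction,
      real_inner_comm] at h1
    have h2 : ‖y‖ * (inner ℝ (u : E d) y / ‖y‖) = inner ℝ (u : E d) y := by field_simp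
    nlinarith
  -- Far from the maximizing direction the fixed loss beats every O(ε) perturbation.
  have hsmall : ∀ᶠ ε in 𝓝[>] (0 : ℝ), (C - L - η) * ε < ‖y‖ * r ^ 2 / 2 / m₀ := by
    have hc : Continuous fun ε : ℝ => (C - L - η) * ε := by fun_prop
    refine nhdsWithin_le_nhds ((hc.tendsto 0).eventually (gt_mem_nhds ?_))
    rw [mul_zero]
    positivity
  filter_upwards [hD η hη, hP, hs, hb, hsmall, self_mem_nhdsWithin] with ε h1 h2 h3 h4 h5 h6
  have h6 : 0 < ε := h6
  have hbdd : BddAbove (range fun u : Metric.sphere (0 : E d) 1 =>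
      (inner ℝ (u : E d) y - m ε u) / s ε u) := by
    obtain ⟨M, hM⟩ := bddAbove_inner (d := d) y m₀
    refine ⟨M + C * ε, ?_⟩
    rintro _ ⟨u, rfl⟩
    have := hM ⟨u, rfl⟩
    have := (abs_le.1 (h4 u)).2
    simp only at *
    linarith
  rw [Real.dist_eq, abs_lt]
  constructor
  -- Lower bound: the supremum is at least the ratio at the direction of y.
  · have k1 := le_ciSup hbdd (direction y hy)
    simp only [inner_direction_self, Function.comp_apply, Real.dist_eq, abs_lt] at k1 h1
    have : ((‖y‖ - m ε (direction y hy)) / s ε (direction y hy) - ‖y‖ / m₀) / ε ≤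
      ((⨆ u : Metric.sphere (0 : E d) 1, (inner ℝ (u : E d) y - m ε u) / s ε u) - ‖y‖ / m₀) / ε := by
      gcongr
    linarith [h1.1]
  -- Upper bound: near directions are controlled by the joint limit, far ones by the fixed loss.
  · have k1 : (⨆ u : Metric.sphere (0 : E d) 1, (inner ℝ (u : E d) y - m ε u) / s ε u) ≤
        max (‖y‖ / m₀ + ε * (L + η / 2)) (‖y‖ / m₀ + (C * ε - ‖y‖ * r ^ 2 / 2 / m₀)) := by
      refine ciSup_le fun u => ?_
      by_cases hu : dist u (direction y hy) < r
      · refine le_sup_of_le_left ?_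
        have k2 := hPV h2 (hrV hu)
        simp only [Real.dist_eq, abs_lt] at k2
        have k3 : ((‖y‖ - m ε u) / s ε u - ‖y‖ / m₀) / ε ≤ L + η / 2 := by linarith [k2.2]
        rw [div_le_iff₀' h6] at k3
        have k4 : (inner ℝ (u : E d) y - m ε u) / s ε u ≤ (‖y‖ - m ε u) / s ε u := by
          have := h3 u
          gcongr
          exact (le_abs_self _).trans (abs_inner_sphere_le u y)
        linarith
      · refine le_sup_of_le_right ?_
        have k2 := (abs_le.1 (h4 u)).2
        have k3 : inner ℝ (u : E d) y / m₀ ≤ (‖y‖ - ‖y‖ * r ^ 2 / 2) / m₀ := by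
          gcongr
          exact hfar u (not_lt.1 hu)
        rw [sub_div] at k3
        linarith
    rw [sub_lt_iff_lt_add', div_lt_iff₀ h6, sub_lt_iff_lt_add']
    refine k1.trans_lt (max_lt ?_ ?_)
    · nlinarith
    · nlinarith

/-- All projections of `F₀` in unit directions have the law `ν`. -/
structure IsSpherical (F₀ : Measure (E d)) (ν : Measure ℝ) : Prop where
  prob : IsProbabilityMeasure F₀
  projLaw_eq : ∀ u : E d, ‖u‖ = 1 → projLaw F₀ u = ν

lemma projLaw_contaminate (F : Measure (E d)) (ε : ℝ) (x u : E d) :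
    projLaw (contaminate F ε x) u = contaminateLine (projLaw F u) ε (inner ℝ u x) := by
  have hm : Measurable fun x : E d => inner ℝ u x := by fun_prop
  rw [projLaw, contaminate, Measure.map_add _ _ hm, Measure.map_smul, Measure.map_smul,
    Measure.map_dirac' hm, contaminateLine, projLaw]

lemma isProbabilityMeasure_contaminate (F : Measure (E d)) [IsProbabilityMeasure F] {ε : ℝ}
    (h0 : 0 ≤ ε) (h1 : ε ≤ 1) (x : E d) : IsProbabilityMeasure (contaminate F ε x) := by
  refine ⟨?_⟩
  simp [contaminate, ← ENNReal.ofReal_add (sub_nonneg.2 h1) h0]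

lemma projRatio_neg (y : E d) (F : Measure (E d)) (u : E d) :
    projRatio y F (-u) = -projRatio y F u := by
  have h : projLaw F (-u) = (projLaw F u).map fun y => -y := by
    rw [← neg_one_smul ℝ u, projLaw_smul]
    congr 1
    ext y; ring
  rw [projRatio, projRatio, h, median_map_neg, mad_map_neg, inner_neg_left]
  ring

/-- Opposite directions have opposite ratios, so one of the two is nonnegative. -/
lemma outlyingness_nonneg [NeZero d] {y : E d} {F : Measure (E d)}
    (hb : BddAbove (range fun u : Metric.sphere (0 : E d) 1 => projRatio y F u)) :
    0 ≤ outlyingness y F := by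
  obtain ⟨u⟩ := nonempty_sphere (d := d)
  have h1 := le_ciSup hb u
  have h2 := le_ciSup hb (-u)
  rw [outlyingness]
  simp only [projRatio_neg, coe_neg_sphere] at h1 h2
  linarith

lemma PD_mem_Icc {y : E d} {F : Measure (E d)} (h : 0 ≤ outlyingness y F) :
    PD y F ∈ Icc (0 : ℝ) 1 := by
  rw [PD]
  exact ⟨by positivity, div_le_one_of_le₀ (by linarith) (by linarith)⟩

namespace IsSpherical

variable {F₀ : Measure (E d)} {ν : Measure ℝ} {p : ℝ → ℝ} {m₀ : ℝ}

lemma projRatio_eq (hF : IsSpherical F₀ ν) (h : IsSymmLaw ν p m₀) (y : E d)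
    (u : Metric.sphere (0 : E d) 1) : projRatio y F₀ u = inner ℝ (u : E d) y / m₀ := by
  rw [projRatio, hF.projLaw_eq _ (norm_coe_sphere u), h.mad_eq, h.median_eq_zero, sub_zero]

lemma outlyingness_eq [NeZero d] (hF : IsSpherical F₀ ν) (h : IsSymmLaw ν p m₀) (y : E d) :
    outlyingness y F₀ = ‖y‖ / m₀ := by
  simp only [outlyingness, hF.projRatio_eq h]
  exact iSup_inner_div y h.mad_pos

lemma PD_eq [NeZero d] (hF : IsSpherical F₀ ν) (h : IsSymmLaw ν p m₀) (y : E d) :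
    PD y F₀ = s₀ m₀ ‖y‖ := by
  rw [PD, hF.outlyingness_eq h, s₀]

lemma projRatio_contaminate (hF : IsSpherical F₀ ν) (ε : ℝ) (x y : E d)
    (u : Metric.sphere (0 : E d) 1) : projRatio y (contaminate F₀ ε x) u =
      (inner ℝ (u : E d) y - median (contaminateLine ν ε (inner ℝ (u : E d) x))) /
        mad (contaminateLine ν ε (inner ℝ (u : E d) x)) := by
  rw [projRatio, projLaw_contaminate, hF.projLaw_eq _ (norm_coe_sphere u)]

lemma exists_ratio_bound (h : IsSymmLaw ν p m₀) :
    ∃ C, 0 < C ∧ ∀ᶠ ε in 𝓝[>] (0 : ℝ), ∀ t, m₀ / 2 ≤ mad (contaminateLine ν ε t) ∧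
      ∀ r, |(r - median (contaminateLine ν ε t)) / mad (contaminateLine ν ε t) - r / m₀| ≤
        C * ε * (1 + |r|) := by
  obtain ⟨C, hC, hb⟩ := h.exists_uniform_bound
  have hm := h.mad_pos
  refine ⟨2 * C * (1 + m₀) / m₀ ^ 2, by positivity, ?_⟩
  have e1 : ∀ᶠ ε in 𝓝[>] (0 : ℝ), C * ε < m₀ / 2 := by
    have hc : Continuous fun ε : ℝ => C * ε := by fun_prop
    exact nhdsWithin_le_nhds ((hc.tendsto 0).eventually (gt_mem_nhds (by simpa using hm)))
  filter_upwards [hb, e1, self_mem_nhdsWithin] with ε h1 h2 h3 t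
  have h3 : 0 < ε := h3
  have hs : m₀ / 2 ≤ mad (contaminateLine ν ε t) := by linarith [(abs_le.1 (h1 t).2).1]
  refine ⟨hs, fun r => ?_⟩
  set μ := median (contaminateLine ν ε t)
  set σ := mad (contaminateLine ν ε t)
  have hσ : 0 < σ := by linarith
  -- Both `σ - m₀` and `μ` are O(ε) uniformly in t, and `σ` is at least m₀/2.
  have e : (r - μ) / σ - r / m₀ = -(r * (σ - m₀) + μ * m₀) / (σ * m₀) := by
    field_simp
    ring
  rw [e, abs_div, abs_neg, abs_of_pos (by positivity : 0 < σ * m₀)]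
  calc |r * (σ - m₀) + μ * m₀| / (σ * m₀)
      ≤ (|r| * (C * ε) + C * ε * m₀) / (m₀ / 2 * m₀) := by
        gcongr
        refine (abs_add_le _ _).trans ?_
        rw [abs_mul, abs_mul, abs_of_pos hm]
        gcongr
        · exact (h1 t).2
        · exact (h1 t).1
    _ = 2 * C * (|r| + m₀) / m₀ ^ 2 * ε := by field_simp
    _ ≤ 2 * C * ((1 + m₀) * (1 + |r|)) / m₀ ^ 2 * ε := by
        gcongr
        nlinarith [mul_nonneg hm.le (abs_nonneg r)]
    _ = _ := by ring

/-- Uniform control of the outlyingness of a slightly contaminated spherical distribution. -/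
lemma exists_outlyingness_bound [NeZero d] (hF : IsSpherical F₀ ν) (h : IsSymmLaw ν p m₀)
    (x : E d) : ∃ C, 0 < C ∧ ∀ᶠ ε in 𝓝[>] (0 : ℝ),
      (∀ u : Metric.sphere (0 : E d) 1, 0 < mad (projLaw (contaminate F₀ ε x) u)) ∧
      (∀ y, BddAbove (range fun u : Metric.sphere (0 : E d) 1 =>
        projRatio y (contaminate F₀ ε x) u)) ∧
      Continuous (fun y => outlyingness y (contaminate F₀ ε x)) ∧
      ∀ y, |outlyingness y (contaminate F₀ ε x) - ‖y‖ / m₀| ≤ C * ε * (1 + ‖y‖) := by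
  obtain ⟨C, hC, hb⟩ := exists_ratio_bound h
  have hm := h.mad_pos
  refine ⟨C, hC, ?_⟩
  filter_upwards [hb, self_mem_nhdsWithin] with ε h1 h2
  have h2 : 0 < ε := h2
  have key : ∀ (y : E d) (u : Metric.sphere (0 : E d) 1),
      |projRatio y (contaminate F₀ ε x) u - inner ℝ (u : E d) y / m₀| ≤ C * ε * (1 + ‖y‖) := by
    intro y u
    rw [hF.projRatio_contaminate]
    refine ((h1 _).2 _).trans ?_
    gcongr
    exact abs_inner_sphere_le u y
  have hbdd : ∀ y, BddAbove (range fun u : Metric.sphere (0 : E d) 1 =>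
      projRatio y (contaminate F₀ ε x) u) := by
    intro y
    obtain ⟨M, hM⟩ := bddAbove_inner (d := d) y m₀
    refine ⟨M + C * ε * (1 + ‖y‖), ?_⟩
    rintro _ ⟨u, rfl⟩
    have k1 := hM ⟨u, rfl⟩
    have k2 := (abs_le.1 (key y u)).2
    simp only at k1 k2 ⊢
    linarith
  refine ⟨fun u => ?_, hbdd, ?_, fun y => ?_⟩
  · rw [projLaw_contaminate, hF.projLaw_eq _ (norm_coe_sphere u)]
    linarith [(h1 (inner ℝ (u : E d) x)).1]
  -- A supremum of functions with a common Lipschitz constant; continuity later supplies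
  -- measurability of the weights.
  · refine (LipschitzWith.of_dist_le_mul (K := Real.toNNReal (2 / m₀)) fun y z => ?_).continuous
    rw [Real.dist_eq, dist_eq_norm, Real.coe_toNNReal _ (by positivity)]
    refine abs_ciSup_sub_ciSup_le (hbdd y) (hbdd z) fun u => ?_
    have hs := (h1 (inner ℝ (u : E d) x)).1
    rw [hF.projRatio_contaminate, hF.projRatio_contaminate, ← sub_div, sub_sub_sub_cancel_right,
      ← inner_sub_right, abs_div, abs_of_pos (by linarith :
        0 < mad (contaminateLine ν ε (inner ℝ (u : E d) x)))]
    calc |inner ℝ (u : E d) (y - z)| / mad (contaminateLine ν ε (inner ℝ (u : E d) x))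
        ≤ ‖y - z‖ / (m₀ / 2) := by
          gcongr
          exact abs_inner_sphere_le u (y - z)
      _ = 2 / m₀ * ‖y - z‖ := by field_simp
  · rw [← iSup_inner_div y hm, outlyingness]
    exact abs_ciSup_sub_ciSup_le (hbdd y) (bddAbove_inner y m₀) (key y)

/-- The sign limits require y'x/‖y‖ to avoid 0 and ±m₀. The case x = 0 is allowed separately: an
atom at the centre of symmetry leaves the median exactly 0. -/
lemma tendsto_outlyingness [NeZero d] (hF : IsSpherical F₀ ν) (h : IsSymmLaw ν p m₀)
    {x y : E d} (hy : y ≠ 0) (hxy : x = 0 ∨ inner ℝ y x ≠ 0) (hm : |inner ℝ y x / ‖y‖| ≠ m₀) :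
    Tendsto (fun ε => (outlyingness y (contaminate F₀ ε x) - ‖y‖ / m₀) / ε) (𝓝[>] 0)
      (𝓝 (-(1 / (2 * p 0) * Real.sign (inner ℝ y x)) / m₀ -
        ‖y‖ * (1 / (4 * p m₀) * Real.sign (|inner ℝ y x / ‖y‖| - m₀)) / m₀ ^ 2)) := by
  have hny : 0 < ‖y‖ := norm_pos_iff.2 hy
  obtain ⟨C, hC, hb⟩ := exists_ratio_bound h
  have hcont : Tendsto (fun q : ℝ × Metric.sphere (0 : E d) 1 =>
      (q.1, inner ℝ (q.2 : E d) x)) (𝓝[>] 0 ×ˢ 𝓝 (direction y hy))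
      (𝓝[>] 0 ×ˢ 𝓝 (inner ℝ y x / ‖y‖)) := by
    have h1 : Continuous fun u : Metric.sphere (0 : E d) 1 => inner ℝ (u : E d) x := by fun_prop
    have h2 := h1.tendsto (direction y hy)
    rw [inner_direction y hy] at h2
    exact tendsto_fst.prodMk (h2.comp tendsto_snd)
  have h1 : ∀ᶠ ε in 𝓝[>] (0 : ℝ), ∀ u : Metric.sphere (0 : E d) 1,
      0 < mad (contaminateLine ν ε (inner ℝ (u : E d) x)) := by
    filter_upwards [hb] with ε h1 u
    linarith [(h1 (inner ℝ (u : E d) x)).1, h.mad_pos]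
  have h2 : ∀ᶠ ε in 𝓝[>] (0 : ℝ), ∀ u : Metric.sphere (0 : E d) 1,
      |(inner ℝ (u : E d) y - median (contaminateLine ν ε (inner ℝ (u : E d) x))) /
        mad (contaminateLine ν ε (inner ℝ (u : E d) x)) - inner ℝ (u : E d) y / m₀| ≤
          C * (1 + ‖y‖) * ε := by
    filter_upwards [hb, self_mem_nhdsWithin] with ε h1 h2 u
    have h2 : 0 < ε := h2
    refine ((h1 _).2 _).trans ?_
    rw [mul_right_comm]
    gcongr
    exact abs_inner_sphere_le u y
  have h3 : Tendsto (fun q : ℝ × Metric.sphere (0 : E d) 1 =>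
      median (contaminateLine ν q.1 (inner ℝ (q.2 : E d) x)) / q.1)
      (𝓝[>] 0 ×ˢ 𝓝 (direction y hy)) (𝓝 (1 / (2 * p 0) * Real.sign (inner ℝ y x))) := by
    rcases hxy with rfl | hxy
    · simp only [inner_zero_right, h.median_contaminateLine_zero, zero_div, Real.sign_zero, mul_zero]
      exact tendsto_const_nhds
    · have h1 : inner ℝ y x / ‖y‖ ≠ 0 := div_ne_zero hxy hny.ne'
      have h2 : Real.sign (inner ℝ y x) = Real.sign (inner ℝ y x / ‖y‖) := by
        rcases hxy.lt_or_gt with h3 | h3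
        · rw [Real.sign_of_neg h3, Real.sign_of_neg (div_neg_of_neg_of_pos h3 hny)]
        · rw [Real.sign_of_pos h3, Real.sign_of_pos (div_pos h3 hny)]
      rw [h2]
      have := (h.tendsto_median h1).comp hcont
      simpa only [Function.comp_def] using this
  have h4 : Tendsto (fun q : ℝ × Metric.sphere (0 : E d) 1 =>
      (mad (contaminateLine ν q.1 (inner ℝ (q.2 : E d) x)) - m₀) / q.1)
      (𝓝[>] 0 ×ˢ 𝓝 (direction y hy))
      (𝓝 (1 / (4 * p m₀) * Real.sign (|inner ℝ y x / ‖y‖| - m₀))) := by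
    have := (h.tendsto_mad hm).comp hcont
    simpa only [Function.comp_def] using this
  have key : Tendsto (fun ε => ((⨆ u : Metric.sphere (0 : E d) 1, 
      (inner ℝ (u : E d) y - median (contaminateLine ν ε (inner ℝ (u : E d) x))) /
        mad (contaminateLine ν ε (inner ℝ (u : E d) x))) - ‖y‖ / m₀) / ε) (𝓝[>] 0) (𝓝 (-(1 / (2 * p 0) * Real.sign (inner ℝ y x)) / m₀ -
        ‖y‖ * (1 / (4 * p m₀) * Real.sign (|inner ℝ y x / ‖y‖| - m₀)) / m₀ ^ 2)) := by
    refine tendsto_iSup_ratio (C := C * (1 + ‖y‖))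
      (m := fun ε u => median (contaminateLine ν ε (inner ℝ (u : E d) x)))
      (s := fun ε u => mad (contaminateLine ν ε (inner ℝ (u : E d) x))) 
      (a := 1 / (2 * p 0) * Real.sign (inner ℝ y x)) 
      (b := 1 / (4 * p m₀) * Real.sign (|inner ℝ y x / ‖y‖| - m₀)) h.mad_pos ?_ hy ?_ ?_ ?_
    · exact h1
    · exact h2
    · exact h3
    · exact h4
  refine key.congr fun ε => ?_
  rw [outlyingness]
  congr 3
  ext u
  exact (hF.projRatio_contaminate ε x y u).symm

end IsSpherical

end Outlyingness

/-! ### Decay and differentiability of the weights -/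

section Weights

variable {d : ℕ}

lemma s₀_mem_Icc {m₀ r : ℝ} (hm : 0 < m₀) (hr : 0 ≤ r) : s₀ m₀ r ∈ Icc (0 : ℝ) 1 := by
  rw [s₀]
  have : 0 ≤ r / m₀ := by positivity
  exact ⟨by positivity, div_le_one_of_le₀ (by linarith) (by linarith)⟩

lemma continuous_s₀_norm {m₀ : ℝ} (hm : 0 < m₀) : Continuous fun y : E d => s₀ m₀ ‖y‖ := by
  unfold s₀
  refine continuous_const.div (by fun_prop) fun y => ?_
  positivity

lemma IsSmoothWeight.exists_deriv_bound {i : ℕ} {w : ℝ → ℝ} (hw : IsSmoothWeight i w) :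
    ∃ K, 0 < K ∧ ∀ r ∈ Icc (0 : ℝ) 1, |wderiv w r| ≤ K * r ^ i := by
  obtain ⟨-, hc, hO⟩ := hw
  obtain ⟨K, hK, hO⟩ := hO.exists_pos
  obtain ⟨δ, hδ, hO⟩ := Metric.mem_nhdsWithin_iff.1 hO.bound
  obtain ⟨M, hM⟩ := isCompact_Icc.exists_bound_of_continuousOn hc
  have hM0 : 0 ≤ M := (norm_nonneg _).trans (hM 0 (by simp))
  -- `K` serves r < δ, and `M / δ ^ i` turns the bound `M` on r ≥ δ into a multiple of r^i.
  refine ⟨K + M / δ ^ i, by positivity, fun r hr => ?_⟩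
  have hri : 0 ≤ r ^ i := pow_nonneg hr.1 i
  rcases lt_or_ge r δ with h | h
  · have h1 : ‖wderiv w r‖ ≤ K * ‖r ^ i‖ :=
      hO ⟨by rw [Metric.mem_ball, Real.dist_eq, sub_zero, abs_of_nonneg hr.1]; exact h, hr.1⟩
    rw [Real.norm_eq_abs, Real.norm_of_nonneg hri] at h1
    have : 0 ≤ M / δ ^ i * r ^ i := by positivity
    linarith
  · have h1 := hM r hr
    rw [Real.norm_eq_abs] at h1
    have h2 : M ≤ M / δ ^ i * r ^ i := by
      rw [div_mul_eq_mul_div, le_div_iff₀ (by positivity)]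
      gcongr
    have : 0 ≤ K * r ^ i := by positivity
    linarith

lemma IsSmoothWeight.hasDerivWithinAt {i : ℕ} {w : ℝ → ℝ} (hw : IsSmoothWeight i w) {r : ℝ}
    (hr : r ∈ Icc (0 : ℝ) 1) : HasDerivWithinAt w (wderiv w r) (Icc 0 1) r :=
  (hw.1 r hr).hasDerivWithinAt

/-- Mean value inequality on [0, min ρ 1]. Applied with ρ of order 1/(1 + ‖y‖), it converts the
vanishing of w' at 0 into decay at infinity. -/
lemma IsSmoothWeight.exists_sub_bound {i : ℕ} {w : ℝ → ℝ} (hw : IsSmoothWeight i w) :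
    ∃ K, 0 < K ∧ ∀ ρ : ℝ, ∀ a ∈ Icc (0 : ℝ) 1, ∀ b ∈ Icc (0 : ℝ) 1, a ≤ ρ → b ≤ ρ →
      |w a - w b| ≤ K * ρ ^ i * |a - b| := by
  obtain ⟨K, hK, hb⟩ := hw.exists_deriv_bound
  refine ⟨K, hK, fun ρ a ha b hb' haρ hbρ => ?_⟩
  have hsub : Icc 0 (min ρ 1) ⊆ Icc (0 : ℝ) 1 := Icc_subset_Icc_right (min_le_right _ _)
  refine (convex_Icc (0 : ℝ) (min ρ 1)).norm_image_sub_le_of_norm_hasDerivWithin_le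
    (f := w) (f' := wderiv w) (fun r hr => (hw.hasDerivWithinAt (hsub hr)).mono hsub)
    (fun r hr => ?_) ⟨hb'.1, le_min hbρ hb'.2⟩ ⟨ha.1, le_min haρ ha.2⟩
  refine (hb r (hsub hr)).trans ?_
  have := hr.1
  gcongr
  exact hr.2.trans (min_le_left _ _)

lemma IsSmoothWeight.continuous_comp {i : ℕ} {w : ℝ → ℝ} (hw : IsSmoothWeight i w) {f : E d → ℝ}
    (hf : Continuous f) (hmem : ∀ y, f y ∈ Icc (0 : ℝ) 1) : Continuous fun y => w (f y) :=
  hw.1.continuousOn.comp_continuous hf hmem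

lemma contaminate_zero (F : Measure (E d)) (x : E d) : contaminate F 0 x = F := by
  simp [contaminate]

lemma one_div_sub_one_div_abs_le {a b C κ ε t : ℝ} (hκ : 0 < κ) (ht : 0 < t)
    (ha : κ / 2 * t ≤ 1 + a) (hb : κ * t ≤ 1 + b) (hab : |a - b| ≤ C * ε * t) :
    |1 / (1 + a) - 1 / (1 + b)| ≤ 2 * C / κ ^ 2 * ε / t := by
  have ha0 : 0 < 1 + a := lt_of_lt_of_le (by positivity) ha
  have hb0 : 0 < 1 + b := lt_of_lt_of_le (by positivity) hb
  have e : 1 / (1 + a) - 1 / (1 + b) = -(a - b) / ((1 + a) * (1 + b)) := by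
    field_simp
    ring
  rw [e, abs_div, abs_neg, abs_of_pos (by positivity : 0 < (1 + a) * (1 + b))]
  calc |a - b| / ((1 + a) * (1 + b)) ≤ C * ε * t / (κ / 2 * t * (κ * t)) := by
        gcongr
        exact (abs_nonneg _).trans hab
    _ = _ := by field_simp

namespace IsSpherical

variable {F₀ : Measure (E d)} {ν : Measure ℝ} {p : ℝ → ℝ} {m₀ : ℝ}

lemma exists_PD_bound [NeZero d] (hF : IsSpherical F₀ ν) (h : IsSymmLaw ν p m₀) (x : E d) :
    ∃ C, 0 < C ∧ ∀ᶠ ε in 𝓝[>] (0 : ℝ),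
      Continuous (fun y => PD y (contaminate F₀ ε x)) ∧
      ∀ y, PD y (contaminate F₀ ε x) ∈ Icc (0 : ℝ) 1 ∧
        PD y (contaminate F₀ ε x) ≤ C / (1 + ‖y‖) ∧ s₀ m₀ ‖y‖ ≤ C / (1 + ‖y‖) ∧
        |PD y (contaminate F₀ ε x) - s₀ m₀ ‖y‖| ≤ C * ε / (1 + ‖y‖) := by
  obtain ⟨K, hK, hb⟩ := hF.exists_outlyingness_bound h x
  have hm := h.mad_pos
  -- Chosen so that κ(1 + r) ≤ 1 + r/m₀; half of it survives the contamination.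
  set κ := min 1 (1 / m₀) with hκ
  have hκ0 : 0 < κ := lt_min one_pos (by positivity)
  have hκ1 : ∀ r : ℝ, 0 ≤ r → κ * (1 + r) ≤ 1 + r / m₀ := by
    intro r hr
    have h1 : κ ≤ 1 := min_le_left _ _
    have h2 : κ * r ≤ 1 / m₀ * r := by gcongr; exact min_le_right _ _
    rw [div_eq_mul_one_div, mul_comm r]
    linarith
  refine ⟨2 / κ + 2 * K / κ ^ 2, by positivity, ?_⟩
  have e1 : ∀ᶠ ε in 𝓝[>] (0 : ℝ), K * ε < κ / 2 := by
    have hc : Continuous fun ε : ℝ => K * ε := by fun_prop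
    exact nhdsWithin_le_nhds ((hc.tendsto 0).eventually (gt_mem_nhds (by simpa using hκ0)))
  filter_upwards [hb, e1, self_mem_nhdsWithin] with ε h1 h2 h3
  have h3 : 0 < ε := h3
  obtain ⟨-, hbdd, hcont, hO⟩ := h1
  have hO0 := fun y => outlyingness_nonneg (hbdd y)
  refine ⟨?_, fun y => ⟨PD_mem_Icc (hO0 y), ?_, ?_, ?_⟩⟩
  · unfold PD
    refine continuous_const.div (by fun_prop) fun y => ?_
    have := hO0 y
    positivity
  all_goals
    have hy := hκ1 ‖y‖ (norm_nonneg y)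
    have hlow : κ / 2 * (1 + ‖y‖) ≤ 1 + outlyingness y (contaminate F₀ ε x) := by
      have k1 := (abs_le.1 (hO y)).1
      have k2 : K * ε * (1 + ‖y‖) ≤ κ / 2 * (1 + ‖y‖) := by gcongr
      linarith
    have ht : 0 < 1 + ‖y‖ := by positivity
  · calc PD y (contaminate F₀ ε x) ≤ 1 / (κ / 2 * (1 + ‖y‖)) := by
          rw [PD]; gcongr
      _ = 2 / κ / (1 + ‖y‖) := by field_simp
      _ ≤ _ := by
        gcongr
        have : 0 < 2 * K / κ ^ 2 := by positivity
        linarith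
  · calc s₀ m₀ ‖y‖ ≤ 1 / (κ / 2 * (1 + ‖y‖)) := by
          rw [s₀]
          gcongr
          have : 0 < κ * (1 + ‖y‖) := by positivity
          linarith
      _ = 2 / κ / (1 + ‖y‖) := by field_simp
      _ ≤ _ := by
        gcongr
        have : 0 < 2 * K / κ ^ 2 := by positivity
        linarith
  · refine (one_div_sub_one_div_abs_le hκ0 ht hlow hy (hO y)).trans ?_
    gcongr
    have : 0 < 2 / κ := by positivity
    linarith

/-- The decay has i powers from w' and one more from the difference of the depths. -/
lemma exists_weight_bound [NeZero d] (hF : IsSpherical F₀ ν) (h : IsSymmLaw ν p m₀) (x : E d)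
    {i : ℕ} {w : ℝ → ℝ} (hw : IsSmoothWeight i w) :
    ∃ C, 0 < C ∧ ∀ᶠ ε in 𝓝[>] (0 : ℝ),
      Continuous (fun y => w (PD y (contaminate F₀ ε x))) ∧
      ∀ y, |w (PD y (contaminate F₀ ε x)) - w (s₀ m₀ ‖y‖)| ≤ C * ε / (1 + ‖y‖) ^ (i + 1) := by
  obtain ⟨C, hC, hb⟩ := hF.exists_PD_bound h x
  obtain ⟨K, hK, hwb⟩ := hw.exists_sub_bound
  refine ⟨K * C ^ (i + 1), by positivity, ?_⟩
  filter_upwards [hb, self_mem_nhdsWithin] with ε h1 h2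
  have h2 : 0 < ε := h2
  refine ⟨hw.continuous_comp h1.1 fun y => (h1.2 y).1, fun y => ?_⟩
  obtain ⟨a1, a2, a3, a4⟩ := h1.2 y
  have ht : 0 < 1 + ‖y‖ := by positivity
  calc |w (PD y (contaminate F₀ ε x)) - w (s₀ m₀ ‖y‖)|
      ≤ K * (C / (1 + ‖y‖)) ^ i * |PD y (contaminate F₀ ε x) - s₀ m₀ ‖y‖| :=
        hwb _ _ a1 _ (s₀_mem_Icc h.mad_pos (norm_nonneg y)) a2 a3
    _ ≤ K * (C / (1 + ‖y‖)) ^ i * (C * ε / (1 + ‖y‖)) := by gcongr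
    _ = _ := by
      rw [div_pow]
      field_simp
      ring

/-- The derivative at `ε = 0` of the depth of `y` under contamination at `x`. -/
def _root_.DepthScatter.depthDeriv (p : ℝ → ℝ) (m₀ : ℝ) (x y : E d) : ℝ :=
  s₀ m₀ ‖y‖ ^ 2 * (1 / (2 * p 0) * Real.sign (inner ℝ y x) / m₀ +
    ‖y‖ * (1 / (4 * p m₀) * Real.sign (|inner ℝ y x / ‖y‖| - m₀)) / m₀ ^ 2)

lemma hasDerivWithinAt_PD [NeZero d] (hF : IsSpherical F₀ ν) (h : IsSymmLaw ν p m₀)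
    {x y : E d} (hy : y ≠ 0) (hxy : x = 0 ∨ inner ℝ y x ≠ 0) (hm : |inner ℝ y x / ‖y‖| ≠ m₀) :
    HasDerivWithinAt (fun ε => PD y (contaminate F₀ ε x)) (depthDeriv p m₀ x y) (Ioi 0) 0 := by
  have hpos := h.mad_pos
  have h1 : HasDerivWithinAt (fun ε => outlyingness y (contaminate F₀ ε x))
      (-(1 / (2 * p 0) * Real.sign (inner ℝ y x)) / m₀ -
        ‖y‖ * (1 / (4 * p m₀) * Real.sign (|inner ℝ y x / ‖y‖| - m₀)) / m₀ ^ 2) (Ioi 0) 0 := by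
    rw [hasDerivWithinAt_iff_tendsto_slope' self_notMem_Ioi]
    refine (hF.tendsto_outlyingness h hy hxy hm).congr fun ε => ?_
    rw [slope_def_field, contaminate_zero, hF.outlyingness_eq h, sub_zero]
  have h2 := (h1.const_add 1).inv (by
    rw [contaminate_zero, hF.outlyingness_eq h]
    positivity)
  have e : (fun ε => PD y (contaminate F₀ ε x)) =
      (fun ε => 1 + outlyingness y (contaminate F₀ ε x))⁻¹ := by
    ext ε
    simp [PD]
  rw [e]
  refine h2.congr_deriv ?_
  rw [contaminate_zero, hF.outlyingness_eq h, depthDeriv, s₀]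
  field_simp
  ring

lemma hasDerivWithinAt_weight [NeZero d] (hF : IsSpherical F₀ ν) (h : IsSymmLaw ν p m₀)
    {i : ℕ} {w : ℝ → ℝ} (hw : IsSmoothWeight i w)
    {x y : E d} (hy : y ≠ 0) (hxy : x = 0 ∨ inner ℝ y x ≠ 0) (hm : |inner ℝ y x / ‖y‖| ≠ m₀) :
    HasDerivWithinAt (fun ε => w (PD y (contaminate F₀ ε x)))
      (wderiv w (s₀ m₀ ‖y‖) * depthDeriv p m₀ x y) (Ioi 0) 0 := by
  obtain ⟨C, hC, hb⟩ := hF.exists_PD_bound h x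
  obtain ⟨δ, hδ, hb⟩ := mem_nhdsGT_iff_exists_Ioo_subset.1 hb
  have hδ : 0 < δ := hδ
  have h0 : PD y (contaminate F₀ 0 x) = s₀ m₀ ‖y‖ := by rw [contaminate_zero, hF.PD_eq h]
  -- The weight is differentiable only within [0, 1], so the chain rule runs on an interval of ε
  -- where the depth is known to stay there.
  have h1 := (hF.hasDerivWithinAt_PD h hy hxy hm).mono fun z (hz : z ∈ Ioo 0 δ) => hz.1
  have h2 : HasDerivWithinAt w (wderiv w (s₀ m₀ ‖y‖)) (Icc 0 1) (PD y (contaminate F₀ 0 x)) := by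
    rw [h0]
    exact hw.hasDerivWithinAt (s₀_mem_Icc h.mad_pos (norm_nonneg y))
  have h3 := HasDerivWithinAt.comp (0 : ℝ) h2 h1 fun ε hε => ((hb hε).2 y).1
  rw [hasDerivWithinAt_iff_tendsto_slope' (by simp)] at h3 ⊢
  rwa [nhdsWithin_Ioo_eq_nhdsGT hδ] at h3

end IsSpherical

end Weights

/-! ### Differentiating weighted integrals under contamination -/

section Integrals

variable {d : ℕ}

lemma integrable_contaminate {F : Measure (E d)} {ε : ℝ} {x : E d} {f : E d → ℝ}
    (hf : Integrable f F) : Integrable f (contaminate F ε x) := by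
  rw [contaminate]
  refine (hf.smul_measure ENNReal.ofReal_ne_top).add_measure
    (Integrable.smul_measure ?_ ENNReal.ofReal_ne_top)
  exact integrable_dirac (by simp)

lemma integral_contaminate {F : Measure (E d)} {ε : ℝ} (h0 : 0 ≤ ε) (h1 : ε ≤ 1) {x : E d}
    {f : E d → ℝ} (hf : Integrable f F) :
    ∫ y, f y ∂(contaminate F ε x) = (1 - ε) * ∫ y, f y ∂F + ε * f x := by
  rw [contaminate, integral_add_measure (hf.smul_measure ENNReal.ofReal_ne_top)
    (Integrable.smul_measure (integrable_dirac (by simp)) ENNReal.ofReal_ne_top),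
    integral_smul_measure, integral_smul_measure, integral_dirac, ENNReal.toReal_ofReal h0,
    ENNReal.toReal_ofReal (sub_nonneg.2 h1), smul_eq_mul, smul_eq_mul]

namespace IsSpherical

variable {F₀ : Measure (E d)} {ν : Measure ℝ} {p : ℝ → ℝ} {m₀ : ℝ}

/-- Growth i + 1 of `k` is exactly absorbed by the decay of the weight difference. The resulting
bound, uniform in y, gives integrability, continuity and domination without further moments of `F₀`.
-/
lemma exists_mul_weight_bound [NeZero d] (hF : IsSpherical F₀ ν) (h : IsSymmLaw ν p m₀) (x : E d)
    {i : ℕ} {w : ℝ → ℝ} (hw : IsSmoothWeight i w) {k : E d → ℝ} {M : ℝ}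
    (hk : ∀ y, |k y| ≤ M * (1 + ‖y‖) ^ (i + 1)) :
    ∃ C, 0 < C ∧ ∀ᶠ ε in 𝓝[>] (0 : ℝ),
      Continuous (fun y => w (PD y (contaminate F₀ ε x))) ∧
      ∀ y, |k y * w (PD y (contaminate F₀ ε x)) - k y * w (PD y F₀)| ≤ C * ε := by
  obtain ⟨C, hC, hb⟩ := hF.exists_weight_bound h x hw
  have hM : 0 ≤ M := by simpa using (abs_nonneg _).trans (hk 0)
  refine ⟨(M + 1) * C, by positivity, ?_⟩
  filter_upwards [hb, self_mem_nhdsWithin] with ε h1 h2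
  have h2 : 0 < ε := h2
  refine ⟨h1.1, fun y => ?_⟩
  have ht : 0 < 1 + ‖y‖ := by positivity
  rw [hF.PD_eq h, ← mul_sub, abs_mul]
  calc |k y| * |w (PD y (contaminate F₀ ε x)) - w (s₀ m₀ ‖y‖)|
      ≤ ((M + 1) * (1 + ‖y‖) ^ (i + 1)) * (C * ε / (1 + ‖y‖) ^ (i + 1)) := by
        gcongr
        · exact (hk y).trans (by gcongr; linarith)
        · exact h1.2 y
    _ = _ := by field_simp

variable {i : ℕ} {w : ℝ → ℝ} {k : E d → ℝ} {M : ℝ} {x : E d}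

lemma eventually_integrable [NeZero d] (hF : IsSpherical F₀ ν) (h : IsSymmLaw ν p m₀) (x : E d)
    (hw : IsSmoothWeight i w) (hkm : Measurable k)
    (hk : ∀ y, |k y| ≤ M * (1 + ‖y‖) ^ (i + 1))
    (hint : Integrable (fun y => k y * w (PD y F₀)) F₀) :
    ∀ᶠ ε in 𝓝[>] (0 : ℝ), Integrable (fun y => k y * w (PD y (contaminate F₀ ε x))) F₀ := by
  have := hF.prob
  obtain ⟨C, hC, hb⟩ := hF.exists_mul_weight_bound h x hw hk
  filter_upwards [hb] with ε h1
  have h2 : Integrable (fun y => k y * w (PD y (contaminate F₀ ε x)) - k y * w (PD y F₀)) F₀ :=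
    Integrable.of_bound ((hkm.mul h1.1.measurable).aestronglyMeasurable.sub
      hint.aestronglyMeasurable) (C * ε) (ae_of_all _ h1.2)
  refine (h2.add hint).congr (ae_of_all _ fun y => ?_)
  simp

lemma tendsto_integral_contaminate [NeZero d] (hF : IsSpherical F₀ ν) (h : IsSymmLaw ν p m₀)
    (x : E d) (hw : IsSmoothWeight i w) (hkm : Measurable k)
    (hk : ∀ y, |k y| ≤ M * (1 + ‖y‖) ^ (i + 1))
    (hint : Integrable (fun y => k y * w (PD y F₀)) F₀) :
    Tendsto (fun ε => ∫ y, k y * w (PD y (contaminate F₀ ε x)) ∂(contaminate F₀ ε x))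
      (𝓝[>] 0) (𝓝 (∫ y, k y * w (PD y F₀) ∂F₀)) := by
  have := hF.prob
  obtain ⟨C, hC, hb⟩ := hF.exists_mul_weight_bound h x hw hk
  have hε : Tendsto (fun ε : ℝ => ε) (𝓝[>] 0) (𝓝 0) := nhdsWithin_le_nhds
  have hCε : Tendsto (fun ε : ℝ => C * ε) (𝓝[>] 0) (𝓝 0) := by simpa using hε.const_mul C
  have h1 : Tendsto (fun ε => ∫ y, k y * w (PD y (contaminate F₀ ε x)) ∂F₀)
      (𝓝[>] 0) (𝓝 (∫ y, k y * w (PD y F₀) ∂F₀)) := by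
    rw [tendsto_iff_norm_sub_tendsto_zero]
    refine squeeze_zero' (.of_forall fun _ => norm_nonneg _) ?_ hCε
    filter_upwards [hb, hF.eventually_integrable h x hw hkm hk hint] with ε h1 h2
    rw [← integral_sub h2 hint]
    refine (norm_integral_le_of_norm_le_const (ae_of_all _ h1.2)).trans ?_
    simp
  have h2 : Tendsto (fun ε => k x * w (PD x (contaminate F₀ ε x))) (𝓝[>] 0)
      (𝓝 (k x * w (PD x F₀))) := by
    rw [tendsto_iff_norm_sub_tendsto_zero]
    refine squeeze_zero' (.of_forall fun _ => norm_nonneg _) ?_ hCε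
    filter_upwards [hb] with ε h1
    exact h1.2 x
  have h3 := ((hε.const_sub 1).mul h1).add (hε.mul h2)
  rw [sub_zero, one_mul, zero_mul, add_zero] at h3
  refine h3.congr' ?_
  filter_upwards [hF.eventually_integrable h x hw hkm hk hint, self_mem_nhdsWithin,
    nhdsWithin_le_nhds (gt_mem_nhds one_pos)] with ε h4 h5 h6
  rw [integral_contaminate (le_of_lt h5) h6.le h4]

lemma eventually_weightIntegrable [NeZero d] (hF : IsSpherical F₀ ν) (h : IsSymmLaw ν p m₀)
    (x : E d) (hw : IsSmoothWeight i w) (hi : WeightIntegrable i w F₀) :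
    ∀ᶠ ε in 𝓝[>] (0 : ℝ), WeightIntegrable i w (contaminate F₀ ε x) := by
  have k1 : ∀ y : E d, |(fun _ => (1 : ℝ)) y| ≤ 1 * (1 + ‖y‖) ^ (i + 1) := fun y => by
    rw [abs_one, one_mul]
    exact one_le_pow₀ (by linarith [norm_nonneg y])
  have k2 : ∀ y : E d, |(fun y : E d => ‖y‖ ^ i) y| ≤ 1 * (1 + ‖y‖) ^ (i + 1) := fun y => by
    have h1 : ‖y‖ ≤ 1 + ‖y‖ := by linarith
    have h2 : (1 : ℝ) ≤ 1 + ‖y‖ := by linarith [norm_nonneg y]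
    rw [one_mul, abs_of_nonneg (by positivity)]
    calc ‖y‖ ^ i ≤ (1 + ‖y‖) ^ i := by gcongr
      _ ≤ _ := pow_le_pow_right₀ h2 (Nat.le_succ i)
  have i1 : Integrable (fun y => (fun _ => (1 : ℝ)) y * w (PD y F₀)) F₀ := by
    simpa using hi.integrable
  have h1 := hF.tendsto_integral_contaminate h x hw measurable_const k1 i1
  simp only [one_mul] at h1
  filter_upwards [h1.eventually (lt_mem_nhds hi.1),
    hF.eventually_integrable h x hw (by fun_prop) k2 hi.2] with ε h2 h3
  exact ⟨h2, integrable_contaminate h3⟩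

lemma wellDefined [NeZero d] (hF : IsSpherical F₀ ν) (h : IsSymmLaw ν p m₀) {w₁ w₂ : ℝ → ℝ}
    (h₁ : WeightIntegrable 1 w₁ F₀) (h₂ : WeightIntegrable 2 w₂ F₀) :
    PWSWellDefined w₁ w₂ F₀ := by
  refine ⟨fun u => ?_, fun y => ?_, h₁, h₂⟩
  · rw [hF.projLaw_eq _ (norm_coe_sphere u), h.mad_eq]
    exact h.mad_pos
  · simp only [hF.projRatio_eq h]
    exact bddAbove_inner y m₀

lemma eventually_wellDefined [NeZero d] (hF : IsSpherical F₀ ν) (h : IsSymmLaw ν p m₀)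
    {w₁ w₂ : ℝ → ℝ} (hw₁ : IsSmoothWeight 1 w₁) (hw₂ : IsSmoothWeight 2 w₂)
    (h₁ : WeightIntegrable 1 w₁ F₀) (h₂ : WeightIntegrable 2 w₂ F₀) (x : E d) :
    ∀ᶠ ε in 𝓝[>] (0 : ℝ), PWSWellDefined w₁ w₂ (contaminate F₀ ε x) := by
  obtain ⟨C, -, hb⟩ := hF.exists_outlyingness_bound h x
  filter_upwards [hb, hF.eventually_weightIntegrable h x hw₁ h₁,
    hF.eventually_weightIntegrable h x hw₂ h₂] with ε h3 h4 h5
  exact ⟨h3.1, h3.2.1, h4, h5⟩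

/-- Almost every point is regular: its depth is differentiable under contamination at `x`. -/
def RegularAt (F₀ : Measure (E d)) (m₀ : ℝ) (x : E d) : Prop :=
  ∀ᵐ y ∂F₀, y ≠ 0 ∧ (x = 0 ∨ inner ℝ y x ≠ 0) ∧ |inner ℝ y x / ‖y‖| ≠ m₀

lemma hasDerivWithinAt_integral [NeZero d] (hF : IsSpherical F₀ ν) (h : IsSymmLaw ν p m₀)
    (hx : RegularAt F₀ m₀ x) (hw : IsSmoothWeight i w) (hkm : Measurable k)
    (hk : ∀ y, |k y| ≤ M * (1 + ‖y‖) ^ (i + 1))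
    (hint : Integrable (fun y => k y * w (PD y F₀)) F₀) :
    HasDerivWithinAt (fun ε => ∫ y, k y * w (PD y (contaminate F₀ ε x)) ∂F₀)
      (∫ y, k y * (wderiv w (s₀ m₀ ‖y‖) * depthDeriv p m₀ x y) ∂F₀) (Ioi 0) 0 := by
  have := hF.prob
  obtain ⟨C, hC, hb⟩ := hF.exists_mul_weight_bound h x hw hk
  rw [hasDerivWithinAt_iff_tendsto_slope' self_notMem_Ioi]
  have key : Tendsto (fun ε => ∫ y, (k y * w (PD y (contaminate F₀ ε x)) - k y * w (PD y F₀)) / ε ∂F₀)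
      (𝓝[>] 0) (𝓝 (∫ y, k y * (wderiv w (s₀ m₀ ‖y‖) * depthDeriv p m₀ x y) ∂F₀)) := by
    -- The difference quotients are bounded by a constant, which is integrable for a probability
    -- measure.
    refine tendsto_integral_filter_of_dominated_convergence (fun _ => C) ?_ ?_
      (integrable_const C) ?_
    · filter_upwards [hb] with ε h1
      exact ((hkm.mul h1.1.measurable).aestronglyMeasurable.sub
        hint.aestronglyMeasurable).div₀ aestronglyMeasurable_const
    · filter_upwards [hb, self_mem_nhdsWithin] with ε h1 h2
      have h2 : 0 < ε := h2
      refine ae_of_all _ fun y => ?_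
      rw [norm_div, Real.norm_eq_abs, Real.norm_of_nonneg h2.le, div_le_iff₀ h2]
      exact h1.2 y
    · filter_upwards [hx] with y hy
      have h1 := (hF.hasDerivWithinAt_weight h hw hy.1 hy.2.1 hy.2.2).const_mul (k y)
      rw [hasDerivWithinAt_iff_tendsto_slope' self_notMem_Ioi] at h1
      refine h1.congr fun ε => ?_
      rw [slope_def_field, contaminate_zero, sub_zero]
  refine key.congr' ?_
  filter_upwards [hF.eventually_integrable h x hw hkm hk hint] with ε h1
  rw [slope_def_field, contaminate_zero, sub_zero, integral_div, integral_sub h1 hint]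

lemma hasDerivWithinAt_integral_contaminate [NeZero d] (hF : IsSpherical F₀ ν)
    (h : IsSymmLaw ν p m₀) (hx : RegularAt F₀ m₀ x) (hw : IsSmoothWeight i w) (hkm : Measurable k)
    (hk : ∀ y, |k y| ≤ M * (1 + ‖y‖) ^ (i + 1))
    (hint : Integrable (fun y => k y * w (PD y F₀)) F₀) :
    HasDerivWithinAt (fun ε => ∫ y, k y * w (PD y (contaminate F₀ ε x)) ∂(contaminate F₀ ε x))
      (∫ y, k y * (wderiv w (s₀ m₀ ‖y‖) * depthDeriv p m₀ x y) ∂F₀ -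
        ∫ y, k y * w (s₀ m₀ ‖y‖) ∂F₀ + k x * w (s₀ m₀ ‖x‖)) (Ioi 0) 0 := by
  obtain ⟨C, hC, hb⟩ := hF.exists_mul_weight_bound h x hw hk
  have hε : Tendsto (fun ε : ℝ => ε) (𝓝[>] 0) (𝓝 0) := nhdsWithin_le_nhds
  -- The atom carries the factor ε, so continuity of the depth at y = x suffices; x itself need not
  -- be a regular point.
  have h2 : Tendsto (fun ε => k x * w (PD x (contaminate F₀ ε x))) (𝓝[>] 0)
      (𝓝 (k x * w (PD x F₀))) := by
    rw [tendsto_iff_norm_sub_tendsto_zero]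
    refine squeeze_zero' (.of_forall fun _ => norm_nonneg _) ?_ (by simpa using hε.const_mul C)
    filter_upwards [hb] with ε h1
    exact h1.2 x
  have h3 : HasDerivWithinAt (fun ε => ε * (k x * w (PD x (contaminate F₀ ε x))))
      (k x * w (PD x F₀)) (Ioi 0) 0 := by
    rw [hasDerivWithinAt_iff_tendsto_slope' self_notMem_Ioi]
    refine h2.congr' ?_
    filter_upwards [self_mem_nhdsWithin] with ε hε
    have hε : 0 < ε := hε
    rw [slope_def_field, zero_mul, sub_zero, sub_zero]
    field_simp
  have h4 := (((hasDerivWithinAt_id (0 : ℝ) (Ioi 0)).const_sub 1).mul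
    (hF.hasDerivWithinAt_integral h hx hw hkm hk hint)).add h3
  have h5 := h4.congr_of_eventuallyEq
    (f₁ := fun ε => ∫ y, k y * w (PD y (contaminate F₀ ε x)) ∂(contaminate F₀ ε x)) ?_ ?_
  · refine h5.congr_deriv ?_
    simp only [contaminate_zero, hF.PD_eq h, id]
    ring
  · filter_upwards [hF.eventually_integrable h x hw hkm hk hint, self_mem_nhdsWithin,
      nhdsWithin_le_nhds (gt_mem_nhds one_pos)] with ε h4 h5 h6
    rw [integral_contaminate (le_of_lt h5) h6.le h4]
    rfl
  · simp [contaminate_zero]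

end IsSpherical

end Integrals

/-! ### Rotation invariance, null cones, and norm versus direction -/

section Rotation

variable {d : ℕ}

lemma measurable_sign : Measurable Real.sign := by
  unfold Real.sign
  exact Measurable.ite measurableSet_Iio measurable_const
    (Measurable.ite measurableSet_Ioi measurable_const measurable_const)

lemma abs_sign_le_one (r : ℝ) : |Real.sign r| ≤ 1 := by
  rcases Real.sign_apply_eq r with h | h | h <;> simp [h]

lemma exists_smul_unit [NeZero d] (t : E d) : ∃ u : E d, ‖u‖ = 1 ∧ t = ‖t‖ • u := by
  rcases eq_or_ne t 0 with rfl | ht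
  · obtain ⟨u⟩ := nonempty_sphere (d := d)
    exact ⟨u, norm_coe_sphere u, by simp⟩
  · refine ⟨‖t‖⁻¹ • t, norm_coe_sphere (direction t ht), ?_⟩
    rw [smul_smul, mul_inv_cancel₀ (norm_ne_zero_iff.2 ht), one_smul]

/-- The reflection in the hyperplane orthogonal to w - v exchanges `v` and `w` and fixes everything
orthogonal to both. -/
lemma exists_isometry_inner {v w : E d} (h : ‖v‖ = ‖w‖) :
    ∃ R : E d ≃ₗᵢ[ℝ] E d, (∀ y, inner ℝ (R y) v = inner ℝ y w) ∧
      ∀ e, inner ℝ e v = 0 → inner ℝ e w = 0 → ∀ y, inner ℝ (R y) e = inner ℝ y e := by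
  refine ⟨(ℝ ∙ (w - v))ᗮ.reflection, fun y => ?_, fun e hv hw y => ?_⟩
  · have hv := Submodule.reflection_sub h.symm
    calc inner ℝ ((ℝ ∙ (w - v))ᗮ.reflection y) v
        = inner ℝ ((ℝ ∙ (w - v))ᗮ.reflection y) ((ℝ ∙ (w - v))ᗮ.reflection w) := by rw [hv]
      _ = inner ℝ y w := LinearIsometryEquiv.inner_map_map _ _ _
  · have h1 : (ℝ ∙ (w - v))ᗮ.reflection e = e := by
      refine Submodule.reflection_mem_subspace_eq_self ?_
      rw [Submodule.mem_orthogonal_singleton_iff_inner_left, inner_sub_right, hv, hw, sub_zero]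
    conv_lhs => rw [← h1]
    rw [LinearIsometryEquiv.inner_map_map]

lemma exists_isometry_inner_neg (v : E d) :
    ∃ R : E d ≃ₗᵢ[ℝ] E d, (∀ y, inner ℝ (R y) v = -inner ℝ y v) ∧
      ∀ e, inner ℝ e v = 0 → ∀ y, inner ℝ (R y) e = inner ℝ y e := by
  obtain ⟨R, h1, h2⟩ := exists_isometry_inner (v := v) (w := -v) (norm_neg v).symm
  exact ⟨R, fun y => by rw [h1, inner_neg_right],
    fun e he => h2 e he (by rw [inner_neg_right, he, neg_zero])⟩

namespace IsSpherical

variable {F₀ G₀ : Measure (E d)} {ν : Measure ℝ} {p : ℝ → ℝ} {m₀ : ℝ}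

lemma charFun_eq [NeZero d] (hF : IsSpherical F₀ ν) (t : E d) : charFun F₀ t = charFun ν ‖t‖ := by
  obtain ⟨u, hu, ht⟩ := exists_smul_unit t
  rw [charFun_apply_real, ← hF.projLaw_eq u hu, projLaw, integral_map (by fun_prop)
    (by fun_prop), charFun_apply]
  congr 1
  ext y
  conv_lhs => rw [ht]
  rw [inner_smul_right, real_inner_comm]
  push_cast
  rfl

/-- Cramér–Wold: the projections determine the characteristic function. Invariance under isometries
follows, as a rotated law has the same projections. -/
lemma eq [NeZero d] (hF : IsSpherical F₀ ν) (hG : IsSpherical G₀ ν) : F₀ = G₀ := by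
  have := hF.prob
  have := hG.prob
  refine Measure.ext_of_charFun ?_
  ext t
  rw [hF.charFun_eq, hG.charFun_eq]

lemma map_isometry [NeZero d] (hF : IsSpherical F₀ ν) (R : E d ≃ₗᵢ[ℝ] E d) : F₀.map R = F₀ := by
  have := hF.prob
  refine IsSpherical.eq ⟨Measure.isProbabilityMeasure_map R.continuous.aemeasurable, fun u hu => ?_⟩
    hF
  rw [projLaw, Measure.map_map (by fun_prop) R.continuous.measurable,
    ← hF.projLaw_eq (R.symm u) (by simpa using hu), projLaw]
  congr 1
  ext y
  simp only [Function.comp_apply]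
  rw [← LinearIsometryEquiv.inner_map_map R.symm, LinearIsometryEquiv.symm_apply_apply]

lemma integral_comp_isometry [NeZero d] (hF : IsSpherical F₀ ν) (R : E d ≃ₗᵢ[ℝ] E d)
    (f : E d → ℝ) : ∫ y, f (R y) ∂F₀ = ∫ y, f y ∂F₀ := by
  conv_rhs => rw [← hF.map_isometry R]
  exact (R.toHomeomorph.measurableEmbedding.integral_map f).symm

lemma integral_eq_zero_of_odd [NeZero d] (hF : IsSpherical F₀ ν) {f : E d → ℝ}
    (hf : ∀ y, f (-y) = -f y) : ∫ y, f y ∂F₀ = 0 := by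
  have h := hF.integral_comp_isometry (LinearIsometryEquiv.neg ℝ) f
  simp only [LinearIsometryEquiv.coe_neg, hf, integral_neg] at h
  linarith

lemma ae_comp_isometry [NeZero d] (hF : IsSpherical F₀ ν) (R : E d ≃ₗᵢ[ℝ] E d) {P : E d → Prop}
    (h : ∀ᵐ y ∂F₀, P y) : ∀ᵐ y ∂F₀, P (R y) := by
  rw [← hF.map_isometry R] at h
  exact ae_of_ae_map R.continuous.aemeasurable h

lemma ae_inner_ne_zero (hF : IsSpherical F₀ ν) (h : IsSymmLaw ν p m₀) {x : E d}
    (hx : x ≠ 0) : ∀ᵐ y ∂F₀, inner ℝ y x ≠ 0 := by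
  have := h.nullSingletonClass
  have h1 : ∀ᵐ t ∂(projLaw F₀ (direction x hx)), t ≠ 0 := by
    rw [hF.projLaw_eq _ (norm_coe_sphere _)]
    exact compl_mem_ae_iff.2 (measure_singleton (μ := ν) 0)
  have h2 := ae_of_ae_map (by fun_prop) h1
  filter_upwards [h2] with y hy hyx
  rw [inner_direction, real_inner_comm, hyx, zero_div] at hy
  exact hy rfl

lemma ae_ne_zero [NeZero d] (hF : IsSpherical F₀ ν) (h : IsSymmLaw ν p m₀) :
    ∀ᵐ y ∂F₀, y ≠ 0 := by
  obtain ⟨u⟩ := nonempty_sphere (d := d)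
  have hu : (u : E d) ≠ 0 := by
    intro h0
    have := norm_coe_sphere u
    simp [h0] at this
  filter_upwards [hF.ae_inner_ne_zero h hu] with y hy hy0
  simp [hy0] at hy

lemma finite_quadratic_roots {a b K : ℝ} (hK : K ≠ 0) :
    {s : ℝ | (a + s * b) ^ 2 = K * (1 + s ^ 2)}.Finite := by
  open Polynomial in
  set P : ℝ[X] := (C a + X * C b) ^ 2 - C K * (1 + X ^ 2) with hP
  have hP0 : P ≠ 0 := by
    intro h0
    have e : ∀ s : ℝ, (a + b * s) ^ 2 - K * (1 + s ^ 2) = 0 := fun s => by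
      have := congrArg (Polynomial.eval s) h0
      simpa [hP] using this
    -- The values at 0, 1 and -1 already rule out the zero polynomial.
    have e0 := e 0
    have e1 := e 1
    have e2 := e (-1)
    have hab : a * b = 0 := by linarith
    rcases mul_eq_zero.1 hab with ha | hb
    · rw [ha] at e0
      apply hK
      linarith
    · rw [hb] at e1 e0
      apply hK
      linarith
  refine (Polynomial.finite_setOfPred_isRoot hP0).subset fun s hs => ?_
  have hs : (a + s * b) ^ 2 = K * (1 + s ^ 2) := hs
  rw [mul_comm s b] at hs
  simp [hP, Polynomial.IsRoot, hs]

/-- A circular cone other than a hyperplane is a null set in dimension at least two. -/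
lemma ae_cone [NeZero d] (hF : IsSpherical F₀ ν) (h : IsSymmLaw ν p m₀) {e f : E d}
    (he : ‖e‖ = 1) (hf : ‖f‖ = 1) (hef : inner ℝ e f = 0) {c : ℝ} (hc : c ≠ 0) :
    ∀ᵐ y ∂F₀, (inner ℝ y e) ^ 2 ≠ c * ‖y‖ ^ 2 := by
  have := hF.prob
  -- Tilt the axis from `e` to e + s f. A fixed y ≠ 0 lies on the tilted cone for finitely many s
  -- only, so by Fubini some tilted cone is null; a rotation then brings its axis back to `e`.
  have h1 : ∀ᵐ y ∂F₀, ∀ᵐ s ∂(volume : Measure ℝ),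
      ¬(inner ℝ y e + s * inner ℝ y f) ^ 2 = c * ‖y‖ ^ 2 * (1 + s ^ 2) := by
    filter_upwards [hF.ae_ne_zero h] with y hy
    have hfin := finite_quadratic_roots (a := inner ℝ y e) (b := inner ℝ y f)
      (K := c * ‖y‖ ^ 2) (mul_ne_zero hc (pow_ne_zero 2 (norm_ne_zero_iff.2 hy)))
    exact (compl_mem_ae_iff.2 (hfin.measure_zero volume))
  have h2 := (Measure.ae_ae_comm (μ := F₀) (ν := (volume : Measure ℝ))
    (p := fun y s => ¬(inner ℝ y e + s * inner ℝ y f) ^ 2 = c * ‖y‖ ^ 2 * (1 + s ^ 2)) (by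
      refine MeasurableSet.compl (s := {x : E d × ℝ | (inner ℝ x.1 e + x.2 * inner ℝ x.1 f) ^ 2 =
        c * ‖x.1‖ ^ 2 * (1 + x.2 ^ 2)}) ?_
      exact measurableSet_eq_fun (by fun_prop) (by fun_prop))).1 h1
  obtain ⟨s, hs⟩ := h2.exists
  have hr : 0 < √(1 + s ^ 2) := by positivity
  have hn : ‖e + s • f‖ = √(1 + s ^ 2) := by
    rw [← Real.sqrt_sq (norm_nonneg _), norm_add_sq_real, inner_smul_right, hef, norm_smul, he, hf]
    congr 1
    simp
  obtain ⟨R, hR, -⟩ := exists_isometry_inner (v := e + s • f) (w := √(1 + s ^ 2) • e) (by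
    rw [hn, norm_smul, he, mul_one, Real.norm_of_nonneg hr.le])
  filter_upwards [hF.ae_comp_isometry R hs] with y hy hy'
  apply hy
  have h3 := hR y
  rw [inner_add_right, inner_smul_right, inner_smul_right] at h3
  rw [h3, mul_pow, hy', Real.sq_sqrt (by positivity), R.norm_map]
  ring

lemma exists_unit_orthogonal (hd : d ≠ 1) [NeZero d] (e : E d) :
    ∃ f : E d, ‖f‖ = 1 ∧ inner ℝ e f = 0 := by
  have hfr : 0 < Module.finrank ℝ (ℝ ∙ e)ᗮ := by
    have h1 := Submodule.finrank_add_finrank_orthogonal (ℝ ∙ e)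
    have h2 : Module.finrank ℝ (ℝ ∙ e) ≤ 1 := by
      simpa using finrank_span_le_card (R := ℝ) ({e} : Set (E d))
    have h3 : Module.finrank ℝ (E d) = d := by simp
    have := NeZero.ne d
    omega
  have := Module.finrank_pos_iff.1 hfr
  obtain ⟨f, hf⟩ := exists_ne (0 : (ℝ ∙ e)ᗮ)
  have hf0 : (f : E d) ≠ 0 := fun h0 => hf (Subtype.ext h0)
  refine ⟨direction _ hf0, norm_coe_sphere _, ?_⟩
  rw [real_inner_comm, inner_direction, real_inner_comm,
    Submodule.mem_orthogonal_singleton_iff_inner_right.1 f.2, zero_div]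

lemma abs_inner_eq_of_dim_one (y x : E 1) : |inner ℝ y x| = ‖y‖ * ‖x‖ := by
  simp only [EuclideanSpace.inner_eq_star_dotProduct, EuclideanSpace.norm_eq, dotProduct,
    Finset.univ_unique, Finset.sum_singleton, Real.norm_eq_abs, sq_abs, Real.sqrt_sq_eq_abs]
  simp [abs_mul, mul_comm]

/-- For d ≥ 2 and x ≠ 0 the bad set |y'x| = m₀‖y‖ lies on a null cone. For d = 1 it is everything or
nothing off the origin according to whether ‖x‖ = m₀, hence the exclusion. -/
lemma regularAt [NeZero d] (hF : IsSpherical F₀ ν) (h : IsSymmLaw ν p m₀) {x : E d}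
    (hx : d = 1 → ‖x‖ ≠ m₀) : RegularAt F₀ m₀ x := by
  have hm := h.mad_pos
  rcases eq_or_ne x 0 with rfl | hx0
  · filter_upwards [hF.ae_ne_zero h] with y hy
    refine ⟨hy, Or.inl rfl, ?_⟩
    simp [hm.ne]
  have hnx : 0 < ‖x‖ := norm_pos_iff.2 hx0
  by_cases hd : d = 1
  · subst hd
    filter_upwards [hF.ae_ne_zero h, hF.ae_inner_ne_zero h hx0] with y hy hyx
    refine ⟨hy, Or.inr hyx, ?_⟩
    have := norm_pos_iff.2 hy
    rw [abs_div, abs_inner_eq_of_dim_one, abs_norm, mul_div_cancel_left₀ _ this.ne']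
    exact hx rfl
  · obtain ⟨f, hf, hxf⟩ := exists_unit_orthogonal hd x
    have hcone := hF.ae_cone h (e := direction x hx0) (norm_coe_sphere _) hf
      (by rw [inner_direction, hxf, zero_div]) (c := (m₀ / ‖x‖) ^ 2) (by positivity)
    filter_upwards [hF.ae_ne_zero h, hF.ae_inner_ne_zero h hx0, hcone] with y hy hyx hyc
    refine ⟨hy, Or.inr hyx, fun heq => hyc ?_⟩
    have hny := norm_pos_iff.2 hy
    rw [real_inner_comm, inner_direction, real_inner_comm, ← sq_abs, ← heq]
    rw [abs_div, abs_div, abs_norm, abs_norm]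
    field_simp

/-- Under a spherical law the norm and the projection of the direction are uncorrelated. -/
lemma integral_norm_mul_direction [NeZero d] (hF : IsSpherical F₀ ν) (h : IsSymmLaw ν p m₀)
    {g k : ℝ → ℝ} (hg : Integrable (fun y => g ‖y‖) F₀) (hk : Measurable k) {M : ℝ}
    (hkM : ∀ t, |t| ≤ 1 → |k t| ≤ M) {e : E d} (he : ‖e‖ = 1) :
    ∫ y, g ‖y‖ * k (inner ℝ y e / ‖y‖) ∂F₀ =
      (∫ y, g ‖y‖ ∂F₀) * ∫ y, k (inner ℝ y e / ‖y‖) ∂F₀ := by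
  have := hF.prob
  -- By invariance the axis may be replaced by any v ≠ 0, hence by an independent copy of y. After
  -- exchanging the integrals, v is integrated first against a fixed axis y and the norm factors
  -- out.
  have rot : ∀ (g : ℝ → ℝ) (v : E d), v ≠ 0 → ∫ y, g ‖y‖ * k (inner ℝ y v / (‖y‖ * ‖v‖)) ∂F₀ =
      ∫ y, g ‖y‖ * k (inner ℝ y e / ‖y‖) ∂F₀ := by
    intro g v hv
    obtain ⟨R, hR, -⟩ := exists_isometry_inner (v := (direction v hv : E d)) (w := e)
      (by rw [he, norm_coe_sphere])
    rw [← hF.integral_comp_isometry R]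
    congr 1
    ext y
    rw [R.norm_map, ← hR, real_inner_comm (direction v hv : E d), inner_direction,
      real_inner_comm (R y), div_div, mul_comm ‖v‖]
  have hint : Integrable (Function.uncurry fun v y : E d =>
      g ‖y‖ * k (inner ℝ y v / (‖y‖ * ‖v‖))) (F₀.prod F₀) := by
    refine Integrable.mul_bdd (c := M) (hg.comp_snd F₀) ?_ (ae_of_all _ fun z => ?_)
    · refine (hk.comp ?_).aestronglyMeasurable
      fun_prop
    · exact hkM _ (abs_real_inner_div_norm_mul_norm_le_one _ _)
  have hswap := integral_integral_swap hint
  have h1 : ∫ v, ∫ y, g ‖y‖ * k (inner ℝ y v / (‖y‖ * ‖v‖)) ∂F₀ ∂F₀ =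
      ∫ y, g ‖y‖ * k (inner ℝ y e / ‖y‖) ∂F₀ := by
    rw [integral_congr_ae (g := fun _ => ∫ y, g ‖y‖ * k (inner ℝ y e / ‖y‖) ∂F₀)]
    · simp
    · filter_upwards [hF.ae_ne_zero h] with v hv
      exact rot g v hv
  rw [← h1, hswap, ← integral_mul_const]
  refine integral_congr_ae ?_
  filter_upwards [hF.ae_ne_zero h] with y hy
  rw [integral_const_mul]
  congr 1
  have h2 := rot (fun _ => 1) y hy
  simp only [one_mul] at h2
  rw [← h2]
  congr 1
  ext v
  rw [real_inner_comm, mul_comm ‖y‖]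

end IsSpherical

end Rotation

/-! ### Second moment matrices under axial and radial symmetry -/

section SecondMoments

variable {d : ℕ}

/-- The weighted second moment `∫ (y'v) (y'w) g(y) dF`. -/
def crossMoment (F : Measure (E d)) (g : E d → ℝ) (v w : E d) : ℝ :=
  ∫ y, inner ℝ y v * inner ℝ y w * g y ∂F

lemma inner_single (y : E d) (i : Fin d) : inner ℝ y (EuclideanSpace.single i (1 : ℝ)) = y i := by
  simp [EuclideanSpace.inner_single_right]

variable {F : Measure (E d)} {g : E d → ℝ}

lemma crossMoment_single (i j : Fin d) :
    crossMoment F g (EuclideanSpace.single i 1) (EuclideanSpace.single j 1) =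
      ∫ y, y i * y j * g y ∂F := by
  simp only [crossMoment, inner_single]

lemma crossMoment_comm (v w : E d) : crossMoment F g v w = crossMoment F g w v := by
  simp only [crossMoment]
  congr 1
  ext y
  ring

lemma crossMoment_smul_right (c : ℝ) (v w : E d) :
    crossMoment F g v (c • w) = c * crossMoment F g v w := by
  simp only [crossMoment, inner_smul_right, ← integral_const_mul]
  congr 1
  ext y
  ring

lemma integrable_crossMoment (hg : Measurable g) (hint : Integrable (fun y => ‖y‖ ^ 2 * g y) F)
    (v w : E d) : Integrable (fun y => inner ℝ y v * inner ℝ y w * g y) F := by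
  refine (hint.norm.const_mul (‖v‖ * ‖w‖)).mono' (Measurable.aestronglyMeasurable (by fun_prop))
    (ae_of_all _ fun y => ?_)
  rw [norm_mul, norm_mul, norm_mul, norm_pow, norm_norm]
  calc ‖inner ℝ y v‖ * ‖inner ℝ y w‖ * ‖g y‖ ≤ (‖y‖ * ‖v‖) * (‖y‖ * ‖w‖) * ‖g y‖ := by
        gcongr <;> exact norm_inner_le_norm _ _
    _ = _ := by ring

lemma crossMoment_add_right (hg : Measurable g) (hint : Integrable (fun y => ‖y‖ ^ 2 * g y) F)
    (u v w : E d) : crossMoment F g u (v + w) = crossMoment F g u v + crossMoment F g u w := by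
  rw [crossMoment, crossMoment, crossMoment, ← integral_add (integrable_crossMoment hg hint u v)
    (integrable_crossMoment hg hint u w)]
  congr 1
  ext y
  rw [inner_add_right]
  ring

lemma crossMoment_add_self (hg : Measurable g) (hint : Integrable (fun y => ‖y‖ ^ 2 * g y) F)
    (v w : E d) : crossMoment F g (v + w) (v + w) =
      crossMoment F g v v + 2 * crossMoment F g v w + crossMoment F g w w := by
  rw [crossMoment_add_right hg hint, crossMoment_comm (v + w) v, crossMoment_comm (v + w) w,
    crossMoment_add_right hg hint, crossMoment_add_right hg hint, crossMoment_comm w v]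
  ring

lemma sum_crossMoment_single (hg : Measurable g) (hint : Integrable (fun y => ‖y‖ ^ 2 * g y) F) :
    ∑ i, crossMoment F g (EuclideanSpace.single i 1) (EuclideanSpace.single i 1) =
      ∫ y, ‖y‖ ^ 2 * g y ∂F := by
  simp only [crossMoment]
  rw [← integral_finsetSum _ fun i _ => integrable_crossMoment hg hint _ _]
  congr 1
  ext y
  rw [EuclideanSpace.real_norm_sq_eq, Finset.sum_mul]
  refine Finset.sum_congr rfl fun i _ => ?_
  rw [inner_single]
  ring

lemma crossMoment_of_quadratic (hg : Measurable g) (hint : Integrable (fun y => ‖y‖ ^ 2 * g y) F)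
    {e : E d} {a b : ℝ} (h : ∀ v, crossMoment F g v v = a * inner ℝ v e ^ 2 + b * ‖v‖ ^ 2)
    (v w : E d) : crossMoment F g v w = a * (inner ℝ v e * inner ℝ w e) + b * inner ℝ v w := by
  have h1 := crossMoment_add_self hg hint v w
  rw [h, h, h, inner_add_left, norm_add_sq_real] at h1
  linarith

namespace IsSpherical

variable {F₀ : Measure (E d)} {ν : Measure ℝ} {p : ℝ → ℝ} {m₀ : ℝ}

lemma crossMoment_isometry [NeZero d] (hF : IsSpherical F₀ ν) (R : E d ≃ₗᵢ[ℝ] E d)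
    (hgR : ∀ y, g (R y) = g y) (v w : E d) :
    crossMoment F₀ g v w = ∫ y, inner ℝ (R y) v * inner ℝ (R y) w * g y ∂F₀ := by
  rw [crossMoment, ← hF.integral_comp_isometry R]
  simp only [hgR]

/-- Second moments weighted by a function invariant under the rotations that fix `e`. -/
lemma crossMoment_axial [NeZero d] (hF : IsSpherical F₀ ν) {e : E d} (he : ‖e‖ = 1)
    (hg : Measurable g) (hint : Integrable (fun y => ‖y‖ ^ 2 * g y) F₀)
    (hinv : ∀ R : E d ≃ₗᵢ[ℝ] E d, (∀ y, inner ℝ (R y) e = inner ℝ y e) → ∀ y, g (R y) = g y)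
    {b : ℝ} (hb : b = if d = 1 then 0 else
      ((∫ y, ‖y‖ ^ 2 * g y ∂F₀) - crossMoment F₀ g e e) / ((d : ℝ) - 1)) (i j : Fin d) :
    ∫ y, y i * y j * g y ∂F₀ = (crossMoment F₀ g e e - b) * (e i * e j) +
      b * (1 : Matrix (Fin d) (Fin d) ℝ) i j := by
  have hdecomp : ∀ v : E d, ∃ u, inner ℝ e u = 0 ∧ v = inner ℝ v e • e + u := fun v =>
    ⟨v - inner ℝ v e • e, by
      rw [inner_sub_right, inner_smul_right, real_inner_self_eq_norm_sq, he, real_inner_comm]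
      ring, by abel⟩
  -- Reflecting u to -u fixes `e`, so the mixed moment equals its negative.
  have horth : ∀ u : E d, inner ℝ e u = 0 → crossMoment F₀ g e u = 0 := by
    intro u hu
    obtain ⟨R, hR1, hR2⟩ := exists_isometry_inner_neg u
    have h1 := hF.crossMoment_isometry R (hinv R (hR2 e hu)) e u
    simp only [hR1, hR2 e hu, mul_neg, neg_mul, integral_neg] at h1
    have h2 : crossMoment F₀ g e u = -crossMoment F₀ g e u := h1
    linarith
  have hquad : ∀ c : ℝ, (∀ u : E d, inner ℝ e u = 0 → crossMoment F₀ g u u = c * ‖u‖ ^ 2) →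
      ∀ v, crossMoment F₀ g v v = (crossMoment F₀ g e e - c) * inner ℝ v e ^ 2 + c * ‖v‖ ^ 2 := by
    intro c hc v
    obtain ⟨u, hu, hv⟩ := hdecomp v
    have hn : ‖v‖ ^ 2 = inner ℝ v e ^ 2 + ‖u‖ ^ 2 := by
      conv_lhs => rw [hv]
      rw [norm_add_sq_real, inner_smul_left, hu, norm_smul, he]
      simp
    conv_lhs => rw [hv]
    rw [crossMoment_add_self hg hint, hc u hu, crossMoment_smul_right, crossMoment_comm _ e,
      crossMoment_comm _ u, crossMoment_smul_right, crossMoment_smul_right, crossMoment_comm u e,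
      horth u hu, hn]
    ring
  suffices hmain : ∀ u : E d, inner ℝ e u = 0 → crossMoment F₀ g u u = b * ‖u‖ ^ 2 by
    have h1 := crossMoment_of_quadratic hg hint (hquad b hmain)
      (EuclideanSpace.single i 1) (EuclideanSpace.single j 1)
    rw [crossMoment_single, inner_single, real_inner_comm, inner_single,
      real_inner_comm _ (EuclideanSpace.single j (1 : ℝ)), inner_single] at h1
    rw [h1, PiLp.single_apply, Matrix.one_apply, if_congr eq_comm rfl rfl]
  by_cases hd : d = 1
  · intro u hu
    -- In dimension one only u = 0 is orthogonal to `e`, and the default b = 0 is harmless.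
    have hu0 : ‖u‖ = 0 := by
      subst hd
      have := abs_inner_eq_of_dim_one e u
      rw [hu, abs_zero, he, one_mul] at this
      exact this.symm
    rw [norm_eq_zero] at hu0
    simp [hu0, crossMoment]
  · obtain ⟨f, hf, hef⟩ := exists_unit_orthogonal hd e
    have hc : ∀ u : E d, inner ℝ e u = 0 → crossMoment F₀ g u u = crossMoment F₀ g f f * ‖u‖ ^ 2 := by
      intro u hu
      obtain ⟨R, hR1, hR2⟩ := exists_isometry_inner (v := u) (w := ‖u‖ • f) (by
        rw [norm_smul, hf, norm_norm, mul_one])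
      have hRe := hR2 e hu (by rw [inner_smul_right, hef, mul_zero])
      have h1 := hF.crossMoment_isometry R (hinv R hRe) u u
      simp only [hR1] at h1
      have h2 : crossMoment F₀ g u u = crossMoment F₀ g (‖u‖ • f) (‖u‖ • f) := h1
      rw [h2, crossMoment_smul_right, crossMoment_comm, crossMoment_smul_right]
      ring
    -- The trace is the moment along `e` plus d - 1 equal transverse moments, which determines b.
    have hsum := sum_crossMoment_single hg hint
    rw [Finset.sum_congr rfl fun i _ => hquad _ hc (EuclideanSpace.single i 1),
      Finset.sum_add_distrib, ← Finset.mul_sum, ← Finset.mul_sum] at hsum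
    have h1 : ∑ i, inner ℝ (EuclideanSpace.single i (1 : ℝ)) e ^ 2 = (1 : ℝ) := by
      have h2 := EuclideanSpace.real_norm_sq_eq e
      rw [he, one_pow] at h2
      refine (Finset.sum_congr rfl fun i _ => ?_).trans h2.symm
      rw [real_inner_comm, inner_single]
    have h2 : ∑ i : Fin d, ‖EuclideanSpace.single i (1 : ℝ)‖ ^ 2 = (d : ℝ) := by simp
    rw [h1, h2] at hsum
    have hd1 : (d : ℝ) - 1 ≠ 0 := sub_ne_zero.2 (by exact_mod_cast hd)
    have hbf : b = crossMoment F₀ g f f := by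
      rw [hb, if_neg hd, div_eq_iff hd1, ← hsum]
      ring
    rw [hbf]
    exact hc

/-- Second moments weighted by a radial function. -/
lemma integral_mul_radial [NeZero d] (hF : IsSpherical F₀ ν) (hg : Measurable g)
    (hint : Integrable (fun y => ‖y‖ ^ 2 * g y) F₀)
    (hinv : ∀ R : E d ≃ₗᵢ[ℝ] E d, ∀ y, g (R y) = g y) (i j : Fin d) :
    ∫ y, y i * y j * g y ∂F₀ =
      (∫ y, ‖y‖ ^ 2 * g y ∂F₀) / d * (1 : Matrix (Fin d) (Fin d) ℝ) i j := by
  set e : E d := EuclideanSpace.single 0 1 with he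
  have hne : ‖e‖ = 1 := by simp [he]
  have hquad : ∀ v, crossMoment F₀ g v v =
      0 * inner ℝ v e ^ 2 + crossMoment F₀ g e e * ‖v‖ ^ 2 := by
    intro v
    obtain ⟨R, hR1, -⟩ := exists_isometry_inner (v := v) (w := ‖v‖ • e) (by
      rw [norm_smul, hne, norm_norm, mul_one])
    have h1 := hF.crossMoment_isometry R (hinv R) v v
    simp only [hR1] at h1
    have h2 : crossMoment F₀ g v v = crossMoment F₀ g (‖v‖ • e) (‖v‖ • e) := h1
    rw [h2, crossMoment_smul_right, crossMoment_comm, crossMoment_smul_right]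
    ring
  have hsum := sum_crossMoment_single hg hint
  rw [Finset.sum_congr rfl fun i _ => hquad (EuclideanSpace.single i 1)] at hsum
  have hd : (d : ℝ) ≠ 0 := Nat.cast_ne_zero.2 (NeZero.ne d)
  have hval : crossMoment F₀ g e e = (∫ y, ‖y‖ ^ 2 * g y ∂F₀) / d := by
    rw [eq_div_iff hd, ← hsum]
    simp [mul_comm]
  rw [← crossMoment_single, crossMoment_of_quadratic hg hint hquad, zero_mul, zero_add,
    inner_single, hval, PiLp.single_apply, Matrix.one_apply, if_congr eq_comm rfl rfl]

end IsSpherical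

end SecondMoments

/-! ### Identification of the constants -/

section Constants

variable {d : ℕ}

/-- The radial factor `w'(s₀(r)) s₀(r)²` of the derivative of the weights. -/
def radialFactor (w : ℝ → ℝ) (m₀ r : ℝ) : ℝ := wderiv w (s₀ m₀ r) * s₀ m₀ r ^ 2

/-- The even part of the derivative of the weight of `y` under contamination at `x`. -/
def evenDeriv (w p : ℝ → ℝ) (m₀ : ℝ) (x y : E d) : ℝ :=
  radialFactor w m₀ ‖y‖ * ‖y‖ / (4 * m₀ ^ 2 * p m₀) * Real.sign (|inner ℝ y x / ‖y‖| - m₀)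

lemma continuous_radialFactor {i : ℕ} {w : ℝ → ℝ} {m₀ : ℝ} (hw : IsSmoothWeight i w)
    (hm : 0 < m₀) : Continuous fun y : E d => radialFactor w m₀ ‖y‖ :=
  (hw.2.1.comp_continuous (continuous_s₀_norm hm) fun y =>
    s₀_mem_Icc hm (norm_nonneg y)).mul ((continuous_s₀_norm hm).pow 2)

lemma s₀_le {m₀ r : ℝ} (hm : 0 < m₀) (hr : 0 ≤ r) : s₀ m₀ r * (1 + r) ≤ 1 + m₀ := by
  rw [s₀, div_mul_eq_mul_div, one_mul, div_le_iff₀ (by positivity)]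
  have : (1 + m₀) * (1 + r / m₀) = 1 + m₀ + r / m₀ + r := by
    field_simp
    ring
  rw [this]
  have : 0 ≤ r / m₀ := by positivity
  linarith

/-- The factors w'(s₀) = O(s₀²) and s₀² together decay like (1 + r)^(-4); cubic decay is all that
the integrand of c₃ needs. -/
lemma exists_radialFactor_bound {w : ℝ → ℝ} {m₀ : ℝ} (hw : IsSmoothWeight 2 w) (hm : 0 < m₀) :
    ∃ C, 0 < C ∧ ∀ r, 0 ≤ r → (1 + r) ^ 3 * |radialFactor w m₀ r| ≤ C := by
  obtain ⟨K, hK, hb⟩ := hw.exists_deriv_bound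
  refine ⟨K * (1 + m₀) ^ 4, by positivity, fun r hr => ?_⟩
  have hs := s₀_mem_Icc hm hr
  have h0 : 0 ≤ s₀ m₀ r := hs.1
  rw [radialFactor, abs_mul, abs_of_nonneg (by positivity : 0 ≤ s₀ m₀ r ^ 2)]
  calc (1 + r) ^ 3 * (|wderiv w (s₀ m₀ r)| * s₀ m₀ r ^ 2)
      ≤ (1 + r) ^ 4 * ((K * s₀ m₀ r ^ 2) * s₀ m₀ r ^ 2) := by
        gcongr
        · linarith
        · norm_num
        · exact hb _ hs
    _ = K * (s₀ m₀ r * (1 + r)) ^ 4 := by ring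
    _ ≤ _ := by
        gcongr
        exact s₀_le hm hr

lemma measurable_sign_inner (x : E d) :
    Measurable fun y : E d => Real.sign (inner ℝ y x) :=
  measurable_sign.comp (by fun_prop)

lemma measurable_evenDeriv {i : ℕ} {w p : ℝ → ℝ} {m₀ : ℝ} (hw : IsSmoothWeight i w) (hm : 0 < m₀)
    (x : E d) : Measurable fun y => evenDeriv w p m₀ x y := by
  unfold evenDeriv
  refine Measurable.mul ?_ (measurable_sign.comp ?_)
  · exact ((continuous_radialFactor hw hm).measurable.mul measurable_norm).div_const _
  · fun_prop

lemma abs_evenDeriv_le {w p : ℝ → ℝ} {m₀ C : ℝ} (hp : 0 < p m₀) (hm : 0 < m₀)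
    (hC : ∀ r, 0 ≤ r → (1 + r) ^ 3 * |radialFactor w m₀ r| ≤ C) (x y : E d) :
    (1 + ‖y‖) ^ 2 * |evenDeriv w p m₀ x y| ≤ C / (4 * m₀ ^ 2 * p m₀) := by
  rw [evenDeriv, abs_mul, abs_div, abs_mul, abs_norm,
    abs_of_pos (by positivity : 0 < 4 * m₀ ^ 2 * p m₀)]
  calc (1 + ‖y‖) ^ 2 * (|radialFactor w m₀ ‖y‖| * ‖y‖ / (4 * m₀ ^ 2 * p m₀) *
        |Real.sign (|inner ℝ y x / ‖y‖| - m₀)|)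
      ≤ (1 + ‖y‖) ^ 2 * (|radialFactor w m₀ ‖y‖| * (1 + ‖y‖) / (4 * m₀ ^ 2 * p m₀) * 1) := by
        gcongr
        · linarith
        · exact abs_sign_le_one _
    _ = (1 + ‖y‖) ^ 3 * |radialFactor w m₀ ‖y‖| / (4 * m₀ ^ 2 * p m₀) := by ring
    _ ≤ _ := by
        gcongr
        exact hC _ (norm_nonneg y)

namespace IsSpherical

variable {F₀ : Measure (E d)} {ν : Measure ℝ} {p : ℝ → ℝ} {m₀ : ℝ} {w : ℝ → ℝ}

lemma integrable_mul_evenDeriv (hF : IsSpherical F₀ ν) (h : IsSymmLaw ν p m₀)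
    (hw : IsSmoothWeight 2 w) (x : E d) {k : E d → ℝ} (hkm : Measurable k)
    (hk : ∀ y, |k y| ≤ (1 + ‖y‖) ^ 2) :
    Integrable (fun y => k y * evenDeriv w p m₀ x y) F₀ := by
  have := hF.prob
  obtain ⟨C, hC, hb⟩ := exists_radialFactor_bound hw h.mad_pos
  refine Integrable.of_bound (hkm.mul (measurable_evenDeriv hw h.mad_pos x)).aestronglyMeasurable
    (C / (4 * m₀ ^ 2 * p m₀)) (ae_of_all _ fun y => ?_)
  rw [norm_mul, Real.norm_eq_abs, Real.norm_eq_abs]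
  refine le_trans ?_ (abs_evenDeriv_le h.pos_mad h.mad_pos hb x y)
  gcongr
  exact hk y

/-- The odd part of the derivative of the weights does not contribute to even moments. -/
lemma integral_mul_depthDeriv [NeZero d] (hF : IsSpherical F₀ ν) (h : IsSymmLaw ν p m₀)
    (hw : IsSmoothWeight 2 w) (x : E d) {k : E d → ℝ} (hkm : Measurable k)
    (hk : ∀ y, |k y| ≤ (1 + ‖y‖) ^ 2) (heven : ∀ y, k (-y) = k y) :
    ∫ y, k y * (wderiv w (s₀ m₀ ‖y‖) * depthDeriv p m₀ x y) ∂F₀ =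
      ∫ y, k y * evenDeriv w p m₀ x y ∂F₀ := by
  have := hF.prob
  have hm := h.mad_pos
  have h0 := h.pos_zero
  have hp := h.pos_mad
  obtain ⟨C, hC, hb⟩ := exists_radialFactor_bound hw hm
  set o : E d → ℝ := fun y =>
    k y * (radialFactor w m₀ ‖y‖ * (1 / (2 * p 0 * m₀) * Real.sign (inner ℝ y x))) with ho
  have hoint : Integrable o F₀ := by
    refine Integrable.of_bound (hkm.mul ((continuous_radialFactor hw hm).measurable.mul
      ((measurable_sign_inner x).const_mul _))).aestronglyMeasurable
      (C * (1 / (2 * p 0 * m₀))) (ae_of_all _ fun y => ?_)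
    rw [ho, Real.norm_eq_abs, abs_mul, abs_mul, abs_mul,
      abs_of_pos (by positivity : 0 < 1 / (2 * p 0 * m₀))]
    have h1 : (1 : ℝ) ≤ 1 + ‖y‖ := by linarith [norm_nonneg y]
    calc |k y| * (|radialFactor w m₀ ‖y‖| * (1 / (2 * p 0 * m₀) * |Real.sign (inner ℝ y x)|))
        ≤ (1 + ‖y‖) ^ 3 * (|radialFactor w m₀ ‖y‖| * (1 / (2 * p 0 * m₀) * 1)) := by
          gcongr
          · exact (hk y).trans (pow_le_pow_right₀ h1 (by norm_num))
          · exact abs_sign_le_one _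
      _ = (1 + ‖y‖) ^ 3 * |radialFactor w m₀ ‖y‖| * (1 / (2 * p 0 * m₀)) := by ring
      _ ≤ _ := by
          gcongr
          exact hb _ (norm_nonneg y)
  -- The median part carries sign(y'x), which is odd, while `k` and the radial factor are even.
  have hodd : ∫ y, o y ∂F₀ = 0 := by
    refine hF.integral_eq_zero_of_odd fun y => ?_
    simp only [ho, heven, norm_neg, inner_neg_left, Real.sign_neg]
    ring
  have hsplit : ∀ y, k y * (wderiv w (s₀ m₀ ‖y‖) * depthDeriv p m₀ x y) =
      o y + k y * evenDeriv w p m₀ x y := by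
    intro y
    simp only [ho, depthDeriv, evenDeriv, radialFactor]
    field_simp
  simp only [hsplit]
  rw [integral_add hoint (hF.integrable_mul_evenDeriv h hw x hkm hk), hodd, zero_add]

lemma integral_direction_eq [NeZero d] (hF : IsSpherical F₀ ν) (k : ℝ → ℝ) {e : E d}
    (he : ‖e‖ = 1) : ∫ y, k (inner ℝ y e / ‖y‖) ∂F₀ = ∫ y, k (y 0 / ‖y‖) ∂F₀ := by
  obtain ⟨R, hR, -⟩ := exists_isometry_inner (v := e) (w := EuclideanSpace.single 0 1)
    (by simp [he])
  rw [← hF.integral_comp_isometry R]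
  simp only [hR, inner_single, R.norm_map]

lemma evenDeriv_eq (w p : ℝ → ℝ) (m₀ r : ℝ) (hr : 0 ≤ r) (e y : E d) :
    evenDeriv w p m₀ (r • e) y = radialFactor w m₀ ‖y‖ * ‖y‖ / (4 * m₀ ^ 2 * p m₀) *
      Real.sign (|inner ℝ y e / ‖y‖| * r - m₀) := by
  have h1 : |inner ℝ y (r • e) / ‖y‖| = |inner ℝ y e / ‖y‖| * r := by
    rw [inner_smul_right, mul_div_assoc, abs_mul, abs_of_nonneg hr, mul_comm]
  rw [evenDeriv, h1]

/-- Uncorrelatedness of norm and direction splits the integral: the radial factor gives c_j, the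
directional one s_i. -/
lemma integral_radial_mul_sign [NeZero d] (hF : IsSpherical F₀ ν) (h : IsSymmLaw ν p m₀)
    (hw : IsSmoothWeight 2 w) {e : E d} (he : ‖e‖ = 1) (r : ℝ) {i j : ℕ} (hj : j = 2 ∨ j = 3) :
    ∫ y, (‖y‖ ^ (2 * j - 3) * radialFactor w m₀ ‖y‖ / (4 * m₀ ^ 2 * p m₀)) *
      ((inner ℝ y e / ‖y‖) ^ (2 * (i - 1)) * Real.sign (|inner ℝ y e / ‖y‖| * r - m₀)) ∂F₀ =
        c w F₀ m₀ (p m₀) j * s F₀ m₀ i r := by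
  have := hF.prob
  obtain ⟨C, hC, hb⟩ := exists_radialFactor_bound hw h.mad_pos
  have hint : Integrable
      (fun y => (fun r => r ^ (2 * j - 3) * radialFactor w m₀ r / (4 * m₀ ^ 2 * p m₀)) ‖y‖) F₀ := by
    refine Integrable.div_const (Integrable.of_bound (Measurable.aestronglyMeasurable
      ((measurable_norm.pow_const _).mul (continuous_radialFactor hw h.mad_pos).measurable))
      C (ae_of_all _ fun y => ?_)) _
    refine le_trans ?_ (hb _ (norm_nonneg y))
    change ‖‖y‖ ^ (2 * j - 3) * radialFactor w m₀ ‖y‖‖ ≤ _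
    rw [norm_mul, Real.norm_eq_abs, Real.norm_eq_abs, abs_of_nonneg (by positivity)]
    have h1 : (1 : ℝ) ≤ 1 + ‖y‖ := by linarith [norm_nonneg y]
    gcongr
    calc ‖y‖ ^ (2 * j - 3) ≤ (1 + ‖y‖) ^ (2 * j - 3) := by gcongr; linarith
      _ ≤ (1 + ‖y‖) ^ 3 := pow_le_pow_right₀ h1 (by omega)
  have hfac := hF.integral_norm_mul_direction h
    (g := fun r => r ^ (2 * j - 3) * radialFactor w m₀ r / (4 * m₀ ^ 2 * p m₀)) hint
    (k := fun t => t ^ (2 * (i - 1)) * Real.sign (|t| * r - m₀)) (M := 1)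
    ((measurable_id.pow_const _).mul (measurable_sign.comp (by fun_prop))) (fun t ht => ?_) he
  · rw [hfac, hF.integral_direction_eq (fun t => t ^ (2 * (i - 1)) * Real.sign (|t| * r - m₀)) he,
      integral_div, c, s]
    congr 3
    ext y
    rw [radialFactor]
    ring
  · rw [abs_mul, abs_pow]
    calc |t| ^ (2 * (i - 1)) * |Real.sign (|t| * r - m₀)| ≤ 1 * 1 := by
          gcongr
          · exact pow_le_one₀ (abs_nonneg t) ht
          · exact abs_sign_le_one _
      _ = 1 := one_mul 1

lemma integral_evenDeriv [NeZero d] (hF : IsSpherical F₀ ν) (h : IsSymmLaw ν p m₀)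
    (hw : IsSmoothWeight 2 w) (x : E d) :
    ∫ y, evenDeriv w p m₀ x y ∂F₀ = c w F₀ m₀ (p m₀) 2 * s F₀ m₀ 1 ‖x‖ := by
  obtain ⟨e, he, hx⟩ := exists_smul_unit x
  rw [← hF.integral_radial_mul_sign h hw he ‖x‖ (Or.inl rfl)]
  congr 1
  ext y
  conv_lhs => rw [hx]
  rw [evenDeriv_eq _ _ _ _ (norm_nonneg x)]
  rw [show 2 * 2 - 3 = 1 from rfl, show 2 * (1 - 1) = 0 from rfl]
  ring

lemma integral_sq_mul_evenDeriv [NeZero d] (hF : IsSpherical F₀ ν) (h : IsSymmLaw ν p m₀)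
    (hw : IsSmoothWeight 2 w) (x : E d) :
    ∫ y, ‖y‖ ^ 2 * evenDeriv w p m₀ x y ∂F₀ = c w F₀ m₀ (p m₀) 3 * s F₀ m₀ 1 ‖x‖ := by
  obtain ⟨e, he, hx⟩ := exists_smul_unit x
  rw [← hF.integral_radial_mul_sign h hw he ‖x‖ (Or.inr rfl)]
  congr 1
  ext y
  conv_lhs => rw [hx]
  rw [evenDeriv_eq _ _ _ _ (norm_nonneg x)]
  rw [show 2 * 3 - 3 = 3 from rfl, show 2 * (1 - 1) = 0 from rfl]
  ring

lemma crossMoment_evenDeriv [NeZero d] (hF : IsSpherical F₀ ν) (h : IsSymmLaw ν p m₀)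
    (hw : IsSmoothWeight 2 w) {x e : E d} (he : ‖e‖ = 1) (hx : x = ‖x‖ • e) :
    crossMoment F₀ (evenDeriv w p m₀ x) e e = c w F₀ m₀ (p m₀) 3 * s F₀ m₀ 2 ‖x‖ := by
  rw [← hF.integral_radial_mul_sign h hw he ‖x‖ (Or.inr rfl), crossMoment]
  refine integral_congr_ae ?_
  filter_upwards [hF.ae_ne_zero h] with y hy
  have hny := norm_ne_zero_iff.2 hy
  conv_lhs => rw [hx]
  rw [evenDeriv_eq _ _ _ _ (norm_nonneg x)]
  rw [show 2 * 3 - 3 = 3 from rfl, show 2 * (2 - 1) = 2 from rfl]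
  field_simp

lemma integral_coord_mul_evenDeriv [NeZero d] (hF : IsSpherical F₀ ν) (h : IsSymmLaw ν p m₀)
    (hw : IsSmoothWeight 2 w) {x e : E d} (he : ‖e‖ = 1) (hx : x = ‖x‖ • e) (i j : Fin d) :
    ∫ y, y i * y j * evenDeriv w p m₀ x y ∂F₀ = c w F₀ m₀ (p m₀) 3 *
      ((s F₀ m₀ 2 ‖x‖ - sTilde F₀ m₀ ‖x‖) * (e i * e j) +
        sTilde F₀ m₀ ‖x‖ * (1 : Matrix (Fin d) (Fin d) ℝ) i j) := by
  have hint : Integrable (fun y => ‖y‖ ^ 2 * evenDeriv w p m₀ x y) F₀ := by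
    refine hF.integrable_mul_evenDeriv h hw x (by fun_prop) fun y => ?_
    rw [abs_of_nonneg (by positivity)]
    gcongr
    linarith
  rw [hF.crossMoment_axial he (measurable_evenDeriv hw h.mad_pos x) hint ?_
    (b := c w F₀ m₀ (p m₀) 3 * sTilde F₀ m₀ ‖x‖) ?_ i j, hF.crossMoment_evenDeriv h hw he hx]
  · ring
  · intro R hR y
    have hRx : inner ℝ (R y) x = inner ℝ y x := by
      rw [hx, inner_smul_right, inner_smul_right, hR]
    rw [evenDeriv, evenDeriv, R.norm_map, hRx]
  · rw [hF.integral_sq_mul_evenDeriv h hw, hF.crossMoment_evenDeriv h hw he hx, sTilde]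
    split_ifs
    · rw [mul_zero]
    · ring

lemma integral_coord_mul_weight [NeZero d] (hF : IsSpherical F₀ ν) (h : IsSymmLaw ν p m₀)
    (hw : IsSmoothWeight 2 w) (hi : WeightIntegrable 2 w F₀) (i j : Fin d) :
    ∫ y, y i * y j * w (s₀ m₀ ‖y‖) ∂F₀ =
      c₀ w F₀ m₀ * c₁ w F₀ m₀ * (1 : Matrix (Fin d) (Fin d) ℝ) i j := by
  have hc0 : c₀ w F₀ m₀ ≠ 0 := by
    have := hi.1
    simp only [hF.PD_eq h] at this
    exact this.ne'
  have hcont : Continuous fun y : E d => w (s₀ m₀ ‖y‖) :=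
    hw.continuous_comp (continuous_s₀_norm h.mad_pos) fun y => s₀_mem_Icc h.mad_pos (norm_nonneg y)
  have hint := hi.2
  simp only [hF.PD_eq h] at hint
  rw [hF.integral_mul_radial hcont.measurable hint (fun R y => by rw [R.norm_map]), c₁]
  have hd : (d : ℝ) ≠ 0 := Nat.cast_ne_zero.2 (NeZero.ne d)
  field_simp

/-- At the centre the axial part vanishes in dimension at least two. -/
lemma axial_eq_dirOuter [NeZero d] (hF : IsSpherical F₀ ν) (h : IsSymmLaw ν p m₀) {x e : E d}
    (he : ‖e‖ = 1) (hx : x = ‖x‖ • e) (i j : Fin d) :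
    (s F₀ m₀ 2 ‖x‖ - sTilde F₀ m₀ ‖x‖) * (e i * e j) =
      (s F₀ m₀ 2 ‖x‖ - sTilde F₀ m₀ ‖x‖) * dirOuter x i j := by
  have := hF.prob
  have hd : (d : ℝ) ≠ 0 := Nat.cast_ne_zero.2 (NeZero.ne d)
  rcases eq_or_ne x 0 with rfl | hx0
  · rw [dirOuter, if_pos rfl, norm_zero]
    -- For d = 1 both e e' and I/d equal 1. For d ≥ 2 every sign is -1 at the centre, so s₁ = -1, s₂
    -- = -1/d, and the axial coefficient vanishes.
    by_cases hd1 : d = 1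
    · subst hd1
      have hij : i = j := Subsingleton.elim i j
      have h1 := EuclideanSpace.real_norm_sq_eq e
      rw [he, Fin.sum_univ_one] at h1
      have hi : i = 0 := Subsingleton.elim i 0
      subst hij hi
      rw [← sq, ← h1]
      simp
    · have hsign : Real.sign (-m₀) = -1 := Real.sign_of_neg (by linarith [h.mad_pos])
      have h1 : s F₀ m₀ 1 0 = -1 := by
        simp [s, hsign]
      have h2 : s F₀ m₀ 2 0 = -(1 / d) := by
        have hrad := hF.integral_mul_radial (g := fun y => (‖y‖ ^ 2)⁻¹) (by fun_prop) ?_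
          (fun R y => by rw [R.norm_map]) 0 0
        · have hone : ∫ y, ‖y‖ ^ 2 * (‖y‖ ^ 2)⁻¹ ∂F₀ = 1 := by
            rw [integral_congr_ae (g := fun _ => (1 : ℝ))]
            · simp
            · filter_upwards [hF.ae_ne_zero h] with y hy
              exact mul_inv_cancel₀ (pow_ne_zero 2 (norm_ne_zero_iff.2 hy))
          rw [hone, Matrix.one_apply_eq, mul_one] at hrad
          rw [← hrad, ← integral_neg, s]
          congr 1
          ext y
          rw [mul_zero, zero_sub, hsign]
          simp only [Nat.add_one_sub_one, mul_one]
          rw [div_pow, div_eq_mul_inv]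
          ring
        · refine Integrable.of_bound (Measurable.aestronglyMeasurable (by fun_prop)) 1
            (ae_of_all _ fun y => ?_)
          rw [Real.norm_of_nonneg (by positivity)]
          exact mul_inv_le_one
      have hd2 : (d : ℝ) - 1 ≠ 0 := sub_ne_zero.2 (by exact_mod_cast hd1)
      have h3 : s F₀ m₀ 2 0 - sTilde F₀ m₀ 0 = 0 := by
        rw [sTilde, if_neg hd1, h1, h2]
        field_simp
        ring
      rw [h3, zero_mul, zero_mul]
  · have hnx := norm_ne_zero_iff.2 hx0
    rw [dirOuter, if_neg hx0, Matrix.smul_apply, outer, Matrix.of_apply, smul_eq_mul]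
    conv_rhs => rw [hx]
    rw [norm_smul, he, norm_norm, PiLp.smul_apply, PiLp.smul_apply, smul_eq_mul, smul_eq_mul]
    field_simp

end IsSpherical

end Constants

/-! ### The influence function at the spherical law -/

section Influence

variable {d : ℕ}

/-- The weighted integral `∫ k(y) w(PD(y, F)) dF`. -/
def weightedIntegral (w : ℝ → ℝ) (k : E d → ℝ) (F : Measure (E d)) : ℝ :=
  ∫ y, k y * w (PD y F) ∂F

lemma depthMean_apply {w : ℝ → ℝ} {G : Measure (E d)} (h : WeightIntegrable 1 w G) (a : Fin d) :
    depthMean w PD G a =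
      (weightedIntegral w (fun _ => 1) G)⁻¹ * weightedIntegral w (fun y => y a) G := by
  have h1 := (EuclideanSpace.proj (𝕜 := ℝ) a).integral_comp_comm h.integrable_smul
  simp only [PiLp.proj_apply, PiLp.smul_apply, smul_eq_mul] at h1
  rw [depthMean, PiLp.smul_apply, smul_eq_mul, weightedIntegral, weightedIntegral, ← h1]
  simp only [one_mul, fun y : E d => mul_comm (y a) (w (PD y G))]

lemma abs_one_le_growth (i : ℕ) (y : E d) : |(1 : ℝ)| ≤ 1 * (1 + ‖y‖) ^ i := by
  rw [abs_one, one_mul]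
  exact one_le_pow₀ (by linarith [norm_nonneg y])

lemma abs_coord_le_growth (a : Fin d) {i : ℕ} (hi : i ≠ 0) (y : E d) :
    |y a| ≤ 1 * (1 + ‖y‖) ^ i := by
  rw [one_mul]
  have h1 : (1 : ℝ) ≤ 1 + ‖y‖ := by linarith [norm_nonneg y]
  calc |y a| ≤ 1 + ‖y‖ := by linarith [abs_apply_le_norm y a]
    _ ≤ _ := le_self_pow₀ h1 hi

lemma abs_coord_mul_le_growth (a b : Fin d) {i : ℕ} (hi : 2 ≤ i) (y : E d) :
    |y a * y b| ≤ 1 * (1 + ‖y‖) ^ i := by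
  have h1 : (1 : ℝ) ≤ 1 + ‖y‖ := by linarith [norm_nonneg y]
  have h2 : ∀ a, |y a| ≤ 1 + ‖y‖ := fun a => by linarith [abs_apply_le_norm y a]
  rw [one_mul, abs_mul]
  calc |y a| * |y b| ≤ (1 + ‖y‖) * (1 + ‖y‖) := by
        gcongr
        · exact h2 a
        · exact h2 b
    _ = (1 + ‖y‖) ^ 2 := by ring
    _ ≤ _ := pow_le_pow_right₀ h1 hi

lemma PWS_apply {w₁ w₂ : ℝ → ℝ} {G : Measure (E d)} (h₂ : WeightIntegrable 2 w₂ G)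
    (a b : Fin d) : PWS w₁ w₂ G a b =
      (weightedIntegral w₂ (fun y => y a * y b) G -
        depthMean w₁ PD G a * weightedIntegral w₂ (fun y => y b) G -
        depthMean w₁ PD G b * weightedIntegral w₂ (fun y => y a) G +
        depthMean w₁ PD G a * depthMean w₁ PD G b * weightedIntegral w₂ (fun _ => 1) G) /
          weightedIntegral w₂ (fun _ => 1) G := by
  set la := depthMean w₁ PD G a with hla
  set lb := depthMean w₁ PD G b with hlb
  have i1 := h₂.integrable_mul (k := fun y => y a * y b) (by fun_prop)
    (abs_coord_mul_le_growth a b le_rfl)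
  have i2 := fun a => h₂.integrable_mul (k := fun y => y a) (by fun_prop)
    (abs_coord_le_growth a two_ne_zero)
  have i3 := h₂.integrable_mul (k := fun _ => 1) measurable_const (abs_one_le_growth 2)
  have hsplit : ∀ x : E d, outer (x - depthMean w₁ PD G) a b * w₂ (PD x G) =
      x a * x b * w₂ (PD x G) - la * (x b * w₂ (PD x G)) - lb * (x a * w₂ (PD x G)) +
        la * lb * (1 * w₂ (PD x G)) := by
    intro x
    simp only [outer, Matrix.of_apply, PiLp.sub_apply, ← hla, ← hlb]
    ring
  rw [PWS, depthScatter, Matrix.of_apply]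
  simp only [hsplit, weightedIntegral, one_mul] at i3 ⊢
  have j1 : Integrable (fun x => x a * x b * w₂ (PD x G) - la * (x b * w₂ (PD x G))) G :=
    i1.sub ((i2 b).const_mul la)
  have j2 : Integrable (fun x => x a * x b * w₂ (PD x G) - la * (x b * w₂ (PD x G)) -
      lb * (x a * w₂ (PD x G))) G := j1.sub ((i2 a).const_mul lb)
  rw [integral_add j2 (i3.const_mul _), integral_sub j1 ((i2 a).const_mul lb),
    integral_sub i1 ((i2 b).const_mul la), integral_const_mul, integral_const_mul,
    integral_const_mul]

namespace IsSpherical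

variable {F₀ : Measure (E d)} {ν : Measure ℝ} {p : ℝ → ℝ} {m₀ : ℝ} {w₁ w₂ : ℝ → ℝ} {x : E d}

lemma weightedIntegral_odd [NeZero d] (hF : IsSpherical F₀ ν) (h : IsSymmLaw ν p m₀) (w : ℝ → ℝ)
    {k : E d → ℝ} (hk : ∀ y, k (-y) = -k y) : weightedIntegral w k F₀ = 0 := by
  refine hF.integral_eq_zero_of_odd fun y => ?_
  rw [hF.PD_eq h, hF.PD_eq h, norm_neg, hk]
  ring

lemma hasDerivWithinAt_weightedIntegral [NeZero d] (hF : IsSpherical F₀ ν)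
    (h : IsSymmLaw ν p m₀) (hx : RegularAt F₀ m₀ x) {i : ℕ} {w : ℝ → ℝ} (hw : IsSmoothWeight i w)
    (hi : WeightIntegrable i w F₀) {k : E d → ℝ} (hkm : Measurable k)
    (hk : ∀ y, |k y| ≤ 1 * (1 + ‖y‖) ^ i) :
    HasDerivWithinAt (fun ε => weightedIntegral w k (contaminate F₀ ε x))
      (∫ y, k y * (wderiv w (s₀ m₀ ‖y‖) * depthDeriv p m₀ x y) ∂F₀ -
        ∫ y, k y * w (s₀ m₀ ‖y‖) ∂F₀ + k x * w (s₀ m₀ ‖x‖)) (Ioi 0) 0 :=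
  hF.hasDerivWithinAt_integral_contaminate h hx hw hkm (M := 1) (fun y => (hk y).trans (by
    gcongr
    · linarith [norm_nonneg y]
    · exact Nat.le_succ i)) (hi.integrable_mul hkm hk)

/-- The mean does not contribute to the derivative of the scatter functional. -/
lemma hasDerivWithinAt_PWS [NeZero d] (hF : IsSpherical F₀ ν) (h : IsSymmLaw ν p m₀)
    (hx : RegularAt F₀ m₀ x) (hw₁ : IsSmoothWeight 1 w₁) (hw₂ : IsSmoothWeight 2 w₂)
    (h₁ : WeightIntegrable 1 w₁ F₀) (h₂ : WeightIntegrable 2 w₂ F₀) (a b : Fin d) {M' W' : ℝ}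
    (hM : HasDerivWithinAt
      (fun ε => weightedIntegral w₂ (fun y => y a * y b) (contaminate F₀ ε x)) M' (Ioi 0) 0)
    (hW : HasDerivWithinAt
      (fun ε => weightedIntegral w₂ (fun _ => 1) (contaminate F₀ ε x)) W' (Ioi 0) 0) :
    HasDerivWithinAt (fun ε => PWS w₁ w₂ (contaminate F₀ ε x) a b)
      ((M' * weightedIntegral w₂ (fun _ => 1) F₀ -
        weightedIntegral w₂ (fun y => y a * y b) F₀ * W') /
          weightedIntegral w₂ (fun _ => 1) F₀ ^ 2) (Ioi 0) 0 := by
  have hW₁0 : weightedIntegral w₁ (fun _ => 1) F₀ ≠ 0 := by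
    simpa [weightedIntegral] using h₁.1.ne'
  have hW₂0 : weightedIntegral w₂ (fun _ => 1) F₀ ≠ 0 := by
    simpa [weightedIntegral] using h₂.1.ne'
  -- Each correction by the mean is a product with two factors that vanish at ε = 0, so its
  -- derivative is 0. The mean need only be differentiable; the value of its derivative is
  -- irrelevant.
  have hzero : ∀ (w : ℝ → ℝ) (a : Fin d), weightedIntegral w (fun y => y a) F₀ = 0 := fun w a =>
    hF.weightedIntegral_odd h w fun y => by simp
  have hone := hF.hasDerivWithinAt_weightedIntegral h hx hw₁ h₁ (k := fun _ => 1)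
    measurable_const (abs_one_le_growth 1)
  have hcoord₁ := fun a => hF.hasDerivWithinAt_weightedIntegral h hx hw₁ h₁ (k := fun y => y a)
    (by fun_prop) (abs_coord_le_growth a one_ne_zero)
  have hcoord₂ := fun a => hF.hasDerivWithinAt_weightedIntegral h hx hw₂ h₂ (k := fun y => y a)
    (by fun_prop) (abs_coord_le_growth a two_ne_zero)
  have hL : ∀ a : Fin d, ∃ L', HasDerivWithinAt
      (fun ε => (weightedIntegral w₁ (fun _ => 1) (contaminate F₀ ε x))⁻¹ *
        weightedIntegral w₁ (fun y => y a) (contaminate F₀ ε x)) L' (Ioi 0) 0 := fun a =>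
    ⟨_, (hone.inv (by rwa [contaminate_zero])).mul (hcoord₁ a)⟩
  choose L' hL using hL
  have hD := ((((hM.sub ((hL a).mul (hcoord₂ b))).sub ((hL b).mul (hcoord₂ a))).add
    (((hL a).mul (hL b)).mul hW)).div hW (by rwa [contaminate_zero]))
  have hD' := hD.congr_of_eventuallyEq
    (f₁ := fun ε => PWS w₁ w₂ (contaminate F₀ ε x) a b) ?_ ?_
  · refine hD'.congr_deriv ?_
    simp only [Pi.sub_apply, Pi.add_apply, Pi.mul_apply, contaminate_zero, hzero]
    ring
  · filter_upwards [hF.eventually_weightIntegrable h x hw₁ h₁,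
      hF.eventually_weightIntegrable h x hw₂ h₂] with ε k1 k2
    rw [PWS_apply k2, depthMean_apply k1, depthMean_apply k1]
    rfl
  · rw [contaminate_zero, PWS_apply h₂, depthMean_apply h₁, depthMean_apply h₁]
    simp only [Pi.sub_apply, Pi.add_apply, Pi.mul_apply, Pi.div_apply, contaminate_zero]

lemma hasInfluenceFunction_iff (T : Measure (E d) → Matrix (Fin d) (Fin d) ℝ) (F : Measure (E d))
    (x : E d) (M : Matrix (Fin d) (Fin d) ℝ) : HasInfluenceFunction T F x M ↔
      ∀ a b, HasDerivWithinAt (fun ε => T (contaminate F ε x) a b) (M a b) (Ioi 0) 0 := by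
  refine tendsto_pi_nhds.trans (forall_congr' fun a => ?_)
  refine tendsto_pi_nhds.trans (forall_congr' fun b => ?_)
  rw [hasDerivWithinAt_iff_tendsto_slope' self_notMem_Ioi]
  refine iff_of_eq ?_
  congr 1
  ext ε
  rw [slope_def_field, contaminate_zero, sub_zero, Matrix.smul_apply, Matrix.sub_apply,
    smul_eq_mul, div_eq_inv_mul]

/-- The influence function of the projection depth weighted scatter at a spherical law. -/
theorem hasInfluenceFunction_PWS [NeZero d] (hF : IsSpherical F₀ ν) (h : IsSymmLaw ν p m₀)
    (hx : d = 1 → ‖x‖ ≠ m₀) (hw₁ : IsSmoothWeight 1 w₁) (hw₂ : IsSmoothWeight 2 w₂)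
    (h₁ : WeightIntegrable 1 w₁ F₀) (h₂ : WeightIntegrable 2 w₂ F₀) :
    HasInfluenceFunction (PWS w₁ w₂) F₀ x
      ((1 / c₀ w₂ F₀ m₀) • (t₁ w₂ F₀ m₀ (p m₀) ‖x‖ • dirOuter x +
        t₂ w₂ F₀ m₀ (p m₀) ‖x‖ • (1 : Matrix (Fin d) (Fin d) ℝ))) := by
  have hreg := hF.regularAt h hx
  obtain ⟨e, he, hxe⟩ := exists_smul_unit x
  have hW0 : weightedIntegral w₂ (fun _ => 1) F₀ = c₀ w₂ F₀ m₀ := by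
    simp only [weightedIntegral, hF.PD_eq h, one_mul, c₀]
  have hc0 : c₀ w₂ F₀ m₀ ≠ 0 := by
    rw [← hW0]
    simpa [weightedIntegral] using h₂.1.ne'
  rw [hasInfluenceFunction_iff]
  intro a b
  have hM := hF.hasDerivWithinAt_weightedIntegral h hreg hw₂ h₂ (k := fun y => y a * y b)
    (by fun_prop) (abs_coord_mul_le_growth a b le_rfl)
  have hW := hF.hasDerivWithinAt_weightedIntegral h hreg hw₂ h₂ (k := fun _ => 1)
    measurable_const (abs_one_le_growth 2)
  refine (hF.hasDerivWithinAt_PWS h hreg hw₁ hw₂ h₁ h₂ a b hM hW).congr_deriv ?_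
  have hM0 : weightedIntegral w₂ (fun y => y a * y b) F₀ =
      c₀ w₂ F₀ m₀ * c₁ w₂ F₀ m₀ * (1 : Matrix (Fin d) (Fin d) ℝ) a b := by
    simp only [weightedIntegral, hF.PD_eq h]
    exact hF.integral_coord_mul_weight h hw₂ h₂ a b
  rw [hF.integral_mul_depthDeriv h hw₂ x (k := fun y => y a * y b) (by fun_prop)
      (fun y => by simpa using abs_coord_mul_le_growth a b le_rfl y) (fun y => by simp),
    hF.integral_mul_depthDeriv h hw₂ x (k := fun _ => 1) (by fun_prop)
      (fun y => by simpa using abs_one_le_growth 2 y) (fun y => rfl),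
    hF.integral_coord_mul_weight h hw₂ h₂, hF.integral_coord_mul_evenDeriv h hw₂ he hxe,
    hF.axial_eq_dirOuter h he hxe, hM0, hW0]
  simp only [one_mul]
  rw [hF.integral_evenDeriv h hw₂, show ∫ y, w₂ (s₀ m₀ ‖y‖) ∂F₀ = c₀ w₂ F₀ m₀ from rfl]
  -- At x = 0 both sides vanish, so the convention for `dirOuter` plays no role in this term.
  have hxx : x a * x b = ‖x‖ ^ 2 * dirOuter x a b := by
    rcases eq_or_ne x 0 with rfl | hx0
    · simp
    · have hnx := norm_ne_zero_iff.2 hx0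
      rw [dirOuter, if_neg hx0, Matrix.smul_apply, outer, Matrix.of_apply, smul_eq_mul]
      field_simp
  rw [hxx]
  simp only [Matrix.smul_apply, Matrix.add_apply, smul_eq_mul, t₁, t₂]
  field_simp
  ring

end IsSpherical

end Influence

/-! ### From elliptical to spherical laws and back -/

section Elliptical

variable {d : ℕ}

lemma rootMat_mul_self {A : Matrix (Fin d) (Fin d) ℝ} (hA : A.PosDef) :
    rootMat A * rootMat A = A :=
  CFC.sqrt_mul_sqrt_self A hA.posSemidef.nonneg

lemma transpose_rootMat (A : Matrix (Fin d) (Fin d) ℝ) : (rootMat A)ᵀ = rootMat A := by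
  have h := (Matrix.nonneg_iff_posSemidef.1 (CFC.sqrt_nonneg A)).isHermitian
  rw [Matrix.IsHermitian, Matrix.conjTranspose_eq_transpose_of_trivial] at h
  exact h

lemma isUnit_det_rootMat {A : Matrix (Fin d) (Fin d) ℝ} (hA : A.PosDef) :
    IsUnit (rootMat A).det := by
  rw [isUnit_iff_ne_zero]
  intro h
  have h1 := congrArg Matrix.det (rootMat_mul_self hA)
  rw [Matrix.det_mul, h, zero_mul] at h1
  exact hA.det_pos.ne h1

lemma isUnit_det_inv {B : Matrix (Fin d) (Fin d) ℝ} (hB : IsUnit B.det) : IsUnit B⁻¹.det :=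
  Matrix.isUnit_nonsing_inv_det B hB

lemma standardize_eq_affine (θ : E d) (A : Matrix (Fin d) (Fin d) ℝ) :
    standardize θ A = affine (rootMat A)⁻¹ (-act (rootMat A)⁻¹ θ) := by
  ext1 x
  rw [standardize, act_sub, affine, sub_eq_add_neg]

lemma affine_standardize {A : Matrix (Fin d) (Fin d) ℝ} (hA : A.PosDef) (θ x : E d) :
    affine (rootMat A) θ (standardize θ A x) = x := by
  rw [affine, standardize, act_act, Matrix.mul_nonsing_inv _ (isUnit_det_rootMat hA), act_one,
    sub_add_cancel]

lemma map_affine_map_standardize {A : Matrix (Fin d) (Fin d) ℝ} (hA : A.PosDef) (θ : E d)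
    (F : Measure (E d)) : (F.map (standardize θ A)).map (affine (rootMat A) θ) = F := by
  rw [Measure.map_map (continuous_affine _ _).measurable (by
    rw [standardize_eq_affine]; exact (continuous_affine _ _).measurable)]
  have : affine (rootMat A) θ ∘ standardize θ A = id := by
    ext1 x
    exact affine_standardize hA θ x
  rw [this, Measure.map_id]

lemma map_contaminate (F : Measure (E d)) (ε : ℝ) (x : E d) {f : E d → E d} (hf : Measurable f) :
    (contaminate F ε x).map f = contaminate (F.map f) ε (f x) := by
  rw [contaminate, contaminate, Measure.map_add _ _ hf, Measure.map_smul, Measure.map_smul,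
    Measure.map_dirac' hf]

lemma quad_eq_inner (A : Matrix (Fin d) (Fin d) ℝ) (v : E d) : quad A v = inner ℝ v (act A v) := by
  rw [quad, EuclideanSpace.inner_eq_star_dotProduct, star_trivial, dotProduct_comm, act]

/-- With v = A^(-1/2)u one has v'Av = ‖u‖² = 1. The projection in direction u is ‖v‖ times the one
of X - θ along v/‖v‖, whose scale is 1/‖v‖. -/
lemma isSpherical_standardize {F : Measure (E d)} [IsProbabilityMeasure F] {θ : E d}
    {A : Matrix (Fin d) (Fin d) ℝ} {ν : Measure ℝ} (hF : IsElliptical F θ A ν) :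
    IsSpherical (F.map (standardize θ A)) ν := by
  obtain ⟨hA, -, hlaw⟩ := hF
  have hm : Measurable (standardize θ A) := by
    rw [standardize_eq_affine]
    exact (continuous_affine _ _).measurable
  refine ⟨Measure.isProbabilityMeasure_map hm.aemeasurable, fun u hu => ?_⟩
  have hR := isUnit_det_rootMat hA
  have hT : ((rootMat A)⁻¹)ᵀ = (rootMat A)⁻¹ := by
    rw [Matrix.transpose_nonsing_inv, transpose_rootMat]
  set v := act (rootMat A)⁻¹ u with hv
  have hquad : quad A v = 1 := by
    have h1 : act A v = act (rootMat A) u := by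
      rw [hv, act_act]
      congr 1
      calc A * (rootMat A)⁻¹ = rootMat A * rootMat A * (rootMat A)⁻¹ := by rw [rootMat_mul_self hA]
        _ = rootMat A := Matrix.mul_nonsing_inv_cancel_right _ _ hR
    rw [quad_eq_inner, h1, inner_act, transpose_rootMat, hv, act_act,
      Matrix.mul_nonsing_inv _ hR, act_one, real_inner_self_eq_norm_sq, hu, one_pow]
  have hv0 : v ≠ 0 := by
    intro h0
    rw [h0, quad_eq_inner, inner_zero_left] at hquad
    exact zero_ne_one hquad
  have hnv : 0 < ‖v‖ := norm_pos_iff.2 hv0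
  have hscale : ‖v‖ * √(quad A (‖v‖⁻¹ • v)) = 1 := by
    rw [quad_eq_inner, act_smul, inner_smul_left, inner_smul_right, ← quad_eq_inner, hquad]
    simp only [conj_trivial, mul_one]
    rw [Real.sqrt_mul_self (by positivity), mul_inv_cancel₀ hnv.ne']
  have hproj : projLaw (F.map (standardize θ A)) u =
      (F.map fun x => inner ℝ (‖v‖⁻¹ • v) (x - θ)).map fun y => ‖v‖ * y := by
    rw [projLaw, Measure.map_map (by fun_prop) hm, Measure.map_map (by fun_prop) (by fun_prop)]
    congr 1
    ext x
    simp only [Function.comp_apply]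
    rw [standardize, inner_act, hT, ← hv, inner_smul_left]
    simp only [conj_trivial]
    rw [mul_inv_cancel_left₀ hnv.ne']
  have hunit : ‖‖v‖⁻¹ • v‖ = 1 := norm_coe_sphere (direction v hv0)
  rw [hproj, hlaw _ hunit, Measure.map_map (by fun_prop) (by fun_prop)]
  have : (fun y => ‖v‖ * y) ∘ (fun y => √(quad A (‖v‖⁻¹ • v)) * y) = id := by
    ext y
    simp only [Function.comp_apply, id]
    rw [← mul_assoc, hscale, one_mul]
  rw [this, Measure.map_id]

lemma tendsto_conj {f : ℝ → Matrix (Fin d) (Fin d) ℝ} {l : Filter ℝ}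
    {M : Matrix (Fin d) (Fin d) ℝ} (B : Matrix (Fin d) (Fin d) ℝ) (h : Tendsto f l (𝓝 M)) :
    Tendsto (fun ε => B * f ε * B) l (𝓝 (B * M * B)) := by
  have hc : Continuous fun N : Matrix (Fin d) (Fin d) ℝ => B * N * B :=
    (continuous_const.matrix_mul continuous_id).matrix_mul continuous_const
  exact (hc.tendsto M).comp h

lemma tendsto_conj_iff {f : ℝ → Matrix (Fin d) (Fin d) ℝ} {l : Filter ℝ}
    {M B : Matrix (Fin d) (Fin d) ℝ} (hB : IsUnit B.det) :
    Tendsto (fun ε => B * f ε * B) l (𝓝 (B * M * B)) ↔ Tendsto f l (𝓝 M) := by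
  refine ⟨fun h => ?_, tendsto_conj B⟩
  have h1 := tendsto_conj B⁻¹ h
  have h2 : ∀ N : Matrix (Fin d) (Fin d) ℝ, B⁻¹ * (B * N * B) * B⁻¹ = N := fun N => by
    rw [Matrix.mul_assoc B N B, Matrix.nonsing_inv_mul_cancel_left _ _ hB,
      Matrix.mul_nonsing_inv_cancel_right _ _ hB]
  simpa only [h2] using h1

/-- Affine equivariance of the influence function. -/
lemma hasInfluenceFunction_map_affine_iff {w₁ w₂ : ℝ → ℝ} {G : Measure (E d)}
    [IsProbabilityMeasure G] {B : Matrix (Fin d) (Fin d) ℝ} (hB : IsUnit B.det) (hBt : Bᵀ = B)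
    (b z : E d) (hG : PWSWellDefined w₁ w₂ G)
    (hc : ∀ᶠ ε in 𝓝[>] (0 : ℝ), PWSWellDefined w₁ w₂ (contaminate G ε z))
    (M : Matrix (Fin d) (Fin d) ℝ) :
    HasInfluenceFunction (PWS w₁ w₂) G z M ↔
      HasInfluenceFunction (PWS w₁ w₂) (G.map (affine B b)) (affine B b z) (B * M * B) := by
  rw [HasInfluenceFunction, HasInfluenceFunction, ← tendsto_conj_iff hB]
  refine tendsto_congr' ?_
  filter_upwards [hc, self_mem_nhdsWithin, nhdsWithin_le_nhds (gt_mem_nhds one_pos)]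
    with ε h1 h2 h3
  have := isProbabilityMeasure_contaminate G (le_of_lt h2) h3.le z
  rw [← map_contaminate G ε z (continuous_affine B b).measurable,
    PWS_map_affine h1.2.2.1 h1.2.2.2 hB, PWS_map_affine hG.2.2.1 hG.2.2.2 hB, hBt,
    ← Matrix.sub_mul, ← Matrix.mul_sub, Matrix.mul_smul, Matrix.smul_mul]

end Elliptical

end DepthScatter

end

open DepthScatter

theorem corollary3p2 (d : ℕ) [NeZero d] (w₁ w₂ : ℝ → ℝ)
    (θ : DepthScatter.E d) (A : Matrix (Fin d) (Fin d) ℝ)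
    (F : MeasureTheory.Measure (DepthScatter.E d)) [MeasureTheory.IsProbabilityMeasure F]
    (ν : MeasureTheory.Measure ℝ) [MeasureTheory.IsProbabilityMeasure ν]
    (p : ℝ → ℝ) (m₀ : ℝ)
    -- `F = F_{θ,A}` is elliptically symmetric, `ν` is the law of `Y`
    (hF : DepthScatter.IsElliptical F θ A ν)
    -- `Y` has the continuous density `p`, `MAD(Y) = m₀` and `p(0) p(m₀) > 0`
    (hp : Continuous p) (hp0 : ∀ y, 0 ≤ p y)
    (hν : ν = MeasureTheory.volume.withDensity fun y => ENNReal.ofReal (p y))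
    (hm₀ : DepthScatter.mad ν = m₀) (hpos : 0 < p 0 * p m₀)
    -- the conditions on the weight functions
    (hw₁ : DepthScatter.IsSmoothWeight 1 w₁) (hw₂ : DepthScatter.IsSmoothWeight 2 w₂)
    (hLip : ∃ K : NNReal, LipschitzOnWith K (DepthScatter.wderiv w₂) (Set.Icc 0 1))
    (hI₁ : DepthScatter.WeightIntegrable 1 w₁ F) (hI₂ : DepthScatter.WeightIntegrable 2 w₂ F)
    -- `F₀ = F_{0,I}` is the law of `Z = A^{-1/2} (X - θ)`
    (F₀ : MeasureTheory.Measure (DepthScatter.E d))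
    (hF₀ : F₀ = F.map (DepthScatter.standardize θ A)) :
    -- the functional is well defined at `F`, at `F₀` and under small contamination of either
    (DepthScatter.PWSWellDefined w₁ w₂ F ∧ DepthScatter.PWSWellDefined w₁ w₂ F₀ ∧
      ∀ x : DepthScatter.E d, ∀ᶠ ε in 𝓝[>] (0 : ℝ),
        DepthScatter.PWSWellDefined w₁ w₂ (DepthScatter.contaminate F ε x) ∧
        DepthScatter.PWSWellDefined w₁ w₂ (DepthScatter.contaminate F₀ ε x)) ∧
    -- the influence function at `F₀`
    (∀ x : DepthScatter.E d, (d = 1 → ‖x‖ ≠ m₀) →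
      DepthScatter.HasInfluenceFunction (DepthScatter.PWS w₁ w₂) F₀ x
        ((1 / DepthScatter.c₀ w₂ F₀ m₀) •
          (DepthScatter.t₁ w₂ F₀ m₀ (p m₀) ‖x‖ • DepthScatter.dirOuter x +
            DepthScatter.t₂ w₂ F₀ m₀ (p m₀) ‖x‖ • (1 : Matrix (Fin d) (Fin d) ℝ)))) ∧
    -- the influence function at `F`
    (∀ (x : DepthScatter.E d) (M : Matrix (Fin d) (Fin d) ℝ),
      DepthScatter.HasInfluenceFunction (DepthScatter.PWS w₁ w₂) F₀
          (DepthScatter.standardize θ A x) M ↔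
        DepthScatter.HasInfluenceFunction (DepthScatter.PWS w₁ w₂) F x
          (DepthScatter.rootMat A * M * DepthScatter.rootMat A)) := by
  have hA := hF.1
  have hR := isUnit_det_rootMat hA
  have hsph : IsSpherical F₀ ν := hF₀ ▸ isSpherical_standardize hF
  have := hsph.prob
  have hlaw : IsSymmLaw ν p m₀ :=
    { prob := inferInstance
      cont := hp
      nonneg := hp0
      density := hν
      symm := hF.2.1
      mad_eq := hm₀
      pos_zero := (hp0 0).lt_of_ne fun h => by rw [← h, zero_mul] at hpos; exact hpos.false
      pos_mad := (hp0 m₀).lt_of_ne fun h => by rw [← h, mul_zero] at hpos; exact hpos.false }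
  have hmap : F₀.map (affine (rootMat A) θ) = F := by
    rw [hF₀, map_affine_map_standardize hA]
  have hI₁' : WeightIntegrable 1 w₁ F₀ := by
    rw [hF₀, standardize_eq_affine]
    exact hI₁.map_affine (isUnit_det_inv hR) _
  have hI₂' : WeightIntegrable 2 w₂ F₀ := by
    rw [hF₀, standardize_eq_affine]
    exact hI₂.map_affine (isUnit_det_inv hR) _
  have hwd := hsph.wellDefined hlaw hI₁' hI₂'
  have hcont := hsph.eventually_wellDefined hlaw hw₁ hw₂ hI₁' hI₂'
  refine ⟨⟨?_, hwd, fun x => ?_⟩, fun x hx => ?_, fun x M => ?_⟩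
  · rw [← hmap]
    exact hwd.map_affine hR θ
  -- Contaminating `F` at x is the affine image of contaminating `F₀` at the standardized point,
  -- whereas the claim for `F₀` concerns x itself; hence two contamination points.
  · filter_upwards [hcont x, hcont (standardize θ A x), self_mem_nhdsWithin,
      nhdsWithin_le_nhds (gt_mem_nhds one_pos)] with ε h1 h2 h3 h4
    have := isProbabilityMeasure_contaminate F₀ (le_of_lt h3) h4.le (standardize θ A x)
    refine ⟨?_, h1⟩
    have h5 := h2.map_affine hR θ
    rwa [map_contaminate F₀ ε _ (continuous_affine _ θ).measurable, hmap,
      affine_standardize hA] at h5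
  · exact hsph.hasInfluenceFunction_PWS hlaw hx hw₁ hw₂ hI₁' hI₂'
  · rw [hasInfluenceFunction_map_affine_iff hR (transpose_rootMat A) θ _ hwd (hcont _), hmap,
      affine_standardize hA]
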